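/- Let $d\ge 1$ and $n$ be integers, let $1\le p<r<q\le\infty$, put $t=r/p$ and $s=(q/r)'$ (where $u'$ denotes the conjugate exponent of $u$), and let $\gamma>0$. There is a constant $C_2$, depending only on $d,n,p,q,r,\gamma$, such that the following holds. Let $B_1,B_2$ be real Banach spaces and let $\mathscr D$ be a dyadic lattice in $\mathbb R^d$, i.e. a collection of half-open cubes with side lengths $2^k$, $k\in\mathbb Z$, which contains all dyadic subcubes of its members, in which any two members are dyadic subcubes of a common member, and such that every compact set lies in some member. Let $F$ be a linear space of strongly measurable functions $\mathbb R^d\to B_1$ that belong to $L^p(Q,B_1)$ for all $Q\in\mathscr D$, and $G$ a linear space of strongly measurable functions $\mathbb R^d\to B_2^*$ that belong to $L^{q'}(Q,B_2^*)$ for all $Q\in\mathscr D$, where $G$ contains all functions $a\mathbf 1_Q$ with $a\in B_2^*$, $Q\in\mathscr D$ (functions equal almost everywhere are identified). Let $T$ be a linear operator from $F$ to the strongly measurable functions $\mathbb R^d\to B_2$ such that $\langle Tf,g\rangle=\int_{\mathbb R^d}\langle Tf(x),g(x)\rangle\,dx$ converges absolutely for all $f\in F$, $g\in G$. Put $T\vec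 f=(Tf_i)_{i=1}^n$ and $\langle T\vec f,\vec g\,\rangle=\sum_{i=1}^n\langle Tf_i,g_i\rangle$. Assume that $T$ satisfies $(Ł^p_{B_1},Ł^{q'}_{B_2^*})$ convex body domination with constant $C_1\ge 0$: for all $\vec f\in F^n$ and $\vec g\in G^n$ there is a $\gamma$-sparse collection $\mathscr Q\subset\mathscr D$ (there are pairwise disjoint measurable sets $E_Q\subset Q$, $Q\in\mathscr Q$, with $|E_Q|\ge\gamma|Q|$) such that $$|\langle T\vec f,\vec g\,\rangle|\le C_1\sum_{Q\in\mathscr Q}|Q|\,\langle\!\langle\vec f\,\rangle\!\rangle_{Ł^p(Q,B_1)}\cdot\langle\!\langle\vec g\,\rangle\!\rangle_{Ł^{q'}(Q,B_2^*)}.$$ Here $\|f\|_{Ł^p(Q,B)}=\big(\frac1{|Q|}\int_Q|f|_B^p\big)^{1/p}$; for a normed space $X$ and $\vec x\in X^n$, $\langle\!\langle\vec x\rangle\!\rangle_X=\{(\langle x_i,x^*\rangle)_{i=1}^n: x^*\in X^*,\ \|x^*\|\le 1\}\subset\mathbb R^n$; and for two such bodies $A\cdot B$ denotes the right end point of the interval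 $\{a\cdot b:a\in A,\ b\in B\}$. Let $W:\mathbb R^d\to\mathbb R^{n\times n}$ be a matrix weight (locally integrable and almost everywhere positive definite) such that $$[W]_{A_t}=\sup_Q\frac1{|Q|}\int_Q\Big(\frac1{|Q|}\int_Q|W^{1/t}(x)W^{-1/t}(y)|_{op}^{t'}\,dy\Big)^{t/t'}dx<\infty,$$ $$[W]_{RH_{t,s}}=\sup_{y\in\mathbb R^n}\sup_Q\Big(\frac1{|Q|}\int_Q|W^{1/t}(x)y|^{ts}\,dx\Big)^{1/s}\Big(\frac1{|Q|}\int_Q|W^{1/t}(x)y|^{t}\,dx\Big)^{-1}<\infty,$$ the suprema in $Q$ being over all axis-parallel cubes, and $y=0$ contributing $0$ to the second one. Then for every $\vec f\in F^n$ with $\vec f\in L^r_{B_1^n}(W)$ we have $T\vec f\in L^r_{B_2^n}(W)$ and $$\|T\vec f\|_{L^r_{B_2^n}(W)}\le C_1C_2\,[W]_{A_t}^{\frac{t'}{r}+\frac{s}{r'}}\,[W]_{RH_{t,s}}^{\frac1r+\frac{s}{r'}}\,\|\vec f\|_{L^r_{B_1^n}(W)},$$ where $\|\vec f\|_{L^r_{B^n}(W)}=\|W^{1/r}\vec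 f\|_{L^r(\mathbb R^d;B^n)}$ and $B^n$ carries the norm $(\sum_i|v_i|_B^2)^{1/2}$. -/

import Mathlib

open MeasureTheory
open scoped ENNReal NNReal

noncomputable section

namespace ConvexBody

/-! ### Cubes, dyadic lattices and sparse collections

`ℝ^d` is modelled by `Fin d → ℝ`; only its topology and its Lebesgue measure are used. -/

/-- The half-open axis-parallel cube with corner `a` and side length `ℓ`. -/
def cube {d : ℕ} (a : Fin d → ℝ) (ℓ : ℝ) : Set (Fin d → ℝ) :=
  Set.univ.pi fun i => Set.Ico (a i) (a i + ℓ)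

/-- The set of all axis-parallel cubes of `ℝ^d`. -/
def cubes (d : ℕ) : Set (Set (Fin d → ℝ)) :=
  {Q | ∃ (a : Fin d → ℝ) (ℓ : ℝ), 0 < ℓ ∧ Q = cube a ℓ}

/-- `𝒟(Q)`: for each `j`, bisecting the sides of the cube `Q` `j` times gives `2 ^ (j d)`
dyadic subcubes of `Q`. -/
def dyadicSubcubes {d : ℕ} (Q : Set (Fin d → ℝ)) : Set (Set (Fin d → ℝ)) :=
  {Q' | ∃ (a : Fin d → ℝ) (ℓ : ℝ) (j : ℕ) (m : Fin d → ℕ),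
    0 < ℓ ∧ Q = cube a ℓ ∧ (∀ i, m i < 2 ^ j) ∧
    Q' = cube (fun i => a i + (m i : ℝ) * (ℓ / 2 ^ j)) (ℓ / 2 ^ j)}

/-- Dyadic lattices of cubes in `ℝ^d`. -/
structure IsDyadicLattice {d : ℕ} (𝒟 : Set (Set (Fin d → ℝ))) : Prop where
  side_length : ∀ Q ∈ 𝒟, ∃ (a : Fin d → ℝ) (k : ℤ), Q = cube a ((2 : ℝ) ^ k)
  subcube_mem : ∀ Q ∈ 𝒟, ∀ Q' ∈ dyadicSubcubes Q, Q' ∈ 𝒟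
  common_ancestor : ∀ Q' ∈ 𝒟, ∀ Q'' ∈ 𝒟, ∃ Q ∈ 𝒟, Q' ∈ dyadicSubcubes Q ∧ Q'' ∈ dyadicSubcubes Q
  compact_subset : ∀ K : Set (Fin d → ℝ), IsCompact K → ∃ Q ∈ 𝒟, K ⊆ Q

/-- `γ`-sparse collections of cubes. -/
def IsSparse {d : ℕ} (γ : ℝ) (𝒬 : Set (Set (Fin d → ℝ))) : Prop :=
  ∃ E : Set (Fin d → ℝ) → Set (Fin d → ℝ),
    (∀ Q ∈ 𝒬, E Q ⊆ Q ∧ MeasurableSet (E Q) ∧ ENNReal.ofReal γ * volume Q ≤ volume (E Q)) ∧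
    𝒬.PairwiseDisjoint E

/-! ### Convex bodies -/

/-- The convex body `⟪x⟫_X ⊆ ℝ^n` of a vector `x ∈ X^n`. -/
def convexBody {X : Type*} [NormedAddCommGroup X] [NormedSpace ℝ X] {n : ℕ} (x : Fin n → X) :
    Set (Fin n → ℝ) :=
  {v | ∃ φ : StrongDual ℝ X, ‖φ‖ ≤ 1 ∧ v = fun i => φ (x i)}

/-- The right end point of the Minkowski dot product `A · B = {a · b : a ∈ A, b ∈ B}`, which is a
compact symmetric interval when `A` and `B` are convex bodies. -/
def bodyDot {n : ℕ} (A B : Set (Fin n → ℝ)) : ℝ :=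
  sSup {c | ∃ a ∈ A, ∃ b ∈ B, c = a ⬝ᵥ b}

/-- Normalized Lebesgue measure on `Q`. The space `Ł^p(Q, B)`, normed by
`(⨍_Q |f|_B ^ p) ^ (1 / p)`, is `Lp B p (avgMeasure Q)`. -/
def avgMeasure {d : ℕ} (Q : Set (Fin d → ℝ)) : Measure (Fin d → ℝ) :=
  ProbabilityTheory.cond volume Q

/-- The convex body of a vector of functions in `Ł^p(Q, B)`. -/
def localBody {d n : ℕ} {B : Type*} [NormedAddCommGroup B] [NormedSpace ℝ B] (p : ℝ≥0∞)
    [Fact (1 ≤ p)] (Q : Set (Fin d → ℝ)) (f : Fin n → ((Fin d → ℝ) →ₘ[volume] B))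
    (hf : ∀ i, MemLp (f i) p (avgMeasure Q)) : Set (Fin n → ℝ) :=
  convexBody fun i => ((hf i).toLp (f i) : Lp B p (avgMeasure Q))

/-- Step functions: finite linear combinations of `a • 1_Q` with `a ∈ B` and `Q ∈ 𝒟`. -/
def stepFunctions {d : ℕ} (𝒟 : Set (Set (Fin d → ℝ))) (B : Type*) [NormedAddCommGroup B]
    [NormedSpace ℝ B] : Submodule ℝ ((Fin d → ℝ) →ₘ[volume] B) :=
  Submodule.span ℝ {f | ∃ Q ∈ 𝒟, ∃ a : B, ⇑f =ᵐ[volume] Q.indicator fun _ => a}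

/-- The pointwise pairing `x ↦ ⟨u(x), v(x)⟩` of a `B`-valued and a `B*`-valued function. -/
def pairing {d : ℕ} {B : Type*} [NormedAddCommGroup B] [NormedSpace ℝ B]
    (u : (Fin d → ℝ) →ₘ[volume] B) (v : (Fin d → ℝ) →ₘ[volume] StrongDual ℝ B)
    (x : Fin d → ℝ) : ℝ :=
  v x (u x)

/-- Let `F` and `G` be spaces of functions with values in `B₁` and `B₂*`. A linear operator `T` from
`F` to the strongly measurable `B₂`-valued functions satisfies `(Ł^p_{B₁}, Ł^{q'}_{B₂*})` convex
body domination on `F^n × G^n`, with constant `C₁` and sparseness parameter `γ`. Here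
`⟨T f, g⟩ = ∑ᵢ ∫ ⟨T fᵢ(x), gᵢ(x)⟩ dx`, and the dominating sum takes values in `[0, ∞]`. -/
structure ConvexBodyDomination {d : ℕ} (𝒟 : Set (Set (Fin d → ℝ))) (n : ℕ) (p q' : ℝ≥0∞)
    [Fact (1 ≤ p)] [Fact (1 ≤ q')] (γ : ℝ) (C₁ : ℝ≥0)
    {B₁ B₂ : Type*} [NormedAddCommGroup B₁] [NormedSpace ℝ B₁]
    [NormedAddCommGroup B₂] [NormedSpace ℝ B₂]
    (F : Submodule ℝ ((Fin d → ℝ) →ₘ[volume] B₁))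
    (G : Submodule ℝ ((Fin d → ℝ) →ₘ[volume] StrongDual ℝ B₂))
    (T : F →ₗ[ℝ] ((Fin d → ℝ) →ₘ[volume] B₂)) : Prop where
  left_mem : ∀ f ∈ F, ∀ Q ∈ 𝒟, MemLp f p (avgMeasure Q)
  right_mem : ∀ g ∈ G, ∀ Q ∈ 𝒟, MemLp g q' (avgMeasure Q)
  integrable : ∀ (f : F) (g : G), Integrable (pairing (T f) g) volume
  domination : ∀ (f : Fin n → F) (g : Fin n → G),
    ∃ (𝒬 : Set (Set (Fin d → ℝ))) (h𝒬 : 𝒬 ⊆ 𝒟), IsSparse γ 𝒬 ∧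
      ENNReal.ofReal |∑ i, ∫ x, pairing (T (f i)) (g i) x| ≤
        C₁ * ∑' Q : 𝒬, volume (Q : Set (Fin d → ℝ)) * ENNReal.ofReal (bodyDot
          (localBody p (Q : Set (Fin d → ℝ)) (fun i => (f i : _ →ₘ[volume] B₁))
            fun i => left_mem _ (f i).2 _ (h𝒬 Q.2))
          (localBody q' (Q : Set (Fin d → ℝ)) (fun i => (g i : _ →ₘ[volume] StrongDual ℝ B₂))
            fun i => right_mem _ (g i).2 _ (h𝒬 Q.2)))

/-! ### Matrix weights -/

/-- The real power `A ^ α` of a positive definite matrix. -/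
def matPow {n : ℕ} (A : Matrix (Fin n) (Fin n) ℝ) (α : ℝ) : Matrix (Fin n) (Fin n) ℝ :=
  cfc (fun x : ℝ => x ^ α) A

/-- Matrix weights: locally integrable and almost everywhere positive definite. -/
structure IsMatrixWeight {d n : ℕ} (W : (Fin d → ℝ) → Matrix (Fin n) (Fin n) ℝ) : Prop where
  locallyIntegrable : ∀ i j, LocallyIntegrable (fun x => W x i j) volume
  posDef : ∀ᵐ x ∂volume, (W x).PosDef

/-- The operator norm of a matrix acting on Euclidean `ℝ^n`, as an element of `[0, ∞]`. -/
def opNorm {n : ℕ} (A : Matrix (Fin n) (Fin n) ℝ) : ℝ≥0∞ :=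
  ‖Matrix.toEuclideanCLM (n := Fin n) (𝕜 := ℝ) A‖ₑ

/-- The Euclidean norm `|A y|`, as an element of `[0, ∞]`. -/
def normMulVec {n : ℕ} (A : Matrix (Fin n) (Fin n) ℝ) (y : EuclideanSpace ℝ (Fin n)) : ℝ≥0∞ :=
  ‖Matrix.toEuclideanCLM (n := Fin n) (𝕜 := ℝ) A y‖ₑ

/-- The matrix `A_t` constant, `1 < t < ∞`:
`sup_Q ⨍_Q (⨍_Q |W^{1/t}(x) W^{-1/t}(y)|_op ^ t' dy) ^ (t / t') dx`. -/
def ApConst {d n : ℕ} (W : (Fin d → ℝ) → Matrix (Fin n) (Fin n) ℝ) (t : ℝ) : ℝ≥0∞ :=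
  ⨆ Q ∈ cubes d, ⨍⁻ x in Q, (⨍⁻ y in Q,
    opNorm (matPow (W x) (1 / t) * matPow (W y) (-(1 / t))) ^ t.conjExponent ∂volume)
      ^ (t / t.conjExponent) ∂volume

/-- The reverse Hölder constant `[W]_{RH_{t,s}}`:
`sup_y sup_Q (⨍_Q |W^{1/t}(x) y| ^ (t s) dx) ^ (1 / s) (⨍_Q |W^{1/t}(x) y| ^ t dx)⁻¹`.
The vector `y = 0` contributes `0 * ∞ = 0`. -/
def RHConst {d n : ℕ} (W : (Fin d → ℝ) → Matrix (Fin n) (Fin n) ℝ) (t s : ℝ) : ℝ≥0∞ :=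
  ⨆ y : EuclideanSpace ℝ (Fin n), ⨆ Q ∈ cubes d,
    (⨍⁻ x in Q, normMulVec (matPow (W x) (1 / t)) y ^ (t * s) ∂volume) ^ (1 / s) *
      (⨍⁻ x in Q, normMulVec (matPow (W x) (1 / t)) y ^ t ∂volume)⁻¹

/-- A matrix acting on `B^n`, which carries the norm `(∑ᵢ |vᵢ|_B ^ 2) ^ (1 / 2)`. -/
def matAct {n : ℕ} {B : Type*} [NormedAddCommGroup B] [NormedSpace ℝ B]
    (A : Matrix (Fin n) (Fin n) ℝ) (v : Fin n → B) : PiLp 2 (fun _ : Fin n => B) :=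
  WithLp.toLp 2 fun i => ∑ j, A i j • v j

/-- The function `W^{1/r} f`. -/
def weighted {d n : ℕ} {B : Type*} [NormedAddCommGroup B] [NormedSpace ℝ B]
    (W : (Fin d → ℝ) → Matrix (Fin n) (Fin n) ℝ) (r : ℝ≥0)
    (f : Fin n → ((Fin d → ℝ) →ₘ[volume] B)) : (Fin d → ℝ) → PiLp 2 (fun _ : Fin n => B) :=
  fun x => matAct (matPow (W x) (1 / r)) fun i => f i x

/-- Membership in `L^r_{B^n}(W)`. -/
def MemWeightedLp {d n : ℕ} {B : Type*} [NormedAddCommGroup B] [NormedSpace ℝ B]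
    (W : (Fin d → ℝ) → Matrix (Fin n) (Fin n) ℝ) (r : ℝ≥0)
    (f : Fin n → ((Fin d → ℝ) →ₘ[volume] B)) : Prop :=
  MemLp (weighted W r f) r volume

/-- The norm of `L^r_{B^n}(W)`, as an element of `[0, ∞]`. -/
def weightedNorm {d n : ℕ} {B : Type*} [NormedAddCommGroup B] [NormedSpace ℝ B]
    (W : (Fin d → ℝ) → Matrix (Fin n) (Fin n) ℝ) (r : ℝ≥0)
    (f : Fin n → ((Fin d → ℝ) →ₘ[volume] B)) : ℝ≥0∞ :=
  eLpNorm (weighted W r f) r volume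

end ConvexBody

end

/-!
By duality it suffices to bound `⟨T f, g⟩` by the norm of `W^{1/r} f` in `L^r` times the norm of
`W^{-1/r} g` in `L^{r'}`, for step functions `g`, and domination reduces this to a sum over sparse
cubes. On a cube `Q` the product of the two convex bodies is at most
`∑ᵢ ‖⟨f, eᵢ⟩‖_{Ł^p(Q)} ‖⟨g, eᵢ⟩‖_{Ł^{q'}(Q)}` for any orthonormal basis `e`. Moving the weight onto
`f` and `g` by Hölder's inequality leaves the averages of `|W^{-1/t} eᵢ|^{t'}` and
`|W^{1/t} eᵢ|^{ts}`, whose product is bounded by the weight characteristics if the basis is adapted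
to the norm `z ↦ (⨍_Q |W^{-1/t} z|^{t'})^{1/t'}`.

These scalar functions satisfy a reverse Hölder inequality with constant `K = [W]_{A_t}^{t'-1}` and
`K = ([W]_{A_t} [W]_{RH_{t,s}})^s` respectively, hence are integrable to a power `1 + c / K`. This
lowers the exponents of the averages of `W^{1/r} f` and `W^{-1/r} g` strictly below `r` and `r'`, so
the sparse sum is controlled by dyadic maximal functions, whose `L^r` and `L^{r'}` bounds cost
`K^{1/r}` and `K^{1/r'}`.
-/

noncomputable section

open ConvexBody

namespace MatrixWeighted

section LayerCake

variable {X : Type*} [MeasurableSpace X]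

theorem measurable_meas_ofReal_lt (μ : Measure X) (F : X → ℝ≥0∞) :
    Measurable fun t : ℝ => μ {x | ENNReal.ofReal t < F x} := by
  have anti : Antitone fun t : ℝ => μ {x | ENNReal.ofReal t < F x} := fun s t hst =>
    measure_mono fun x hx => lt_of_le_of_lt (ENNReal.ofReal_le_ofReal hst) hx
  exact anti.measurable

theorem lintegral_rpow_eq_lintegral_meas_ofReal_lt (μ : Measure X) {F : X → ℝ≥0∞}
    (hF : AEMeasurable F μ) (hF_fin : ∀ᵐ x ∂μ, F x ≠ ∞) {p : ℝ} (hp : 0 < p) :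
    ∫⁻ x, F x ^ p ∂μ = ENNReal.ofReal p *
      ∫⁻ t in Set.Ioi (0 : ℝ), μ {x | ENNReal.ofReal t < F x} * ENNReal.ofReal (t ^ (p - 1)) := by
  calc ∫⁻ x, F x ^ p ∂μ = ∫⁻ x, ENNReal.ofReal ((F x).toReal ^ p) ∂μ := by
        refine lintegral_congr_ae ?_
        filter_upwards [hF_fin] with x hx
        rw [ENNReal.toReal_rpow, ENNReal.ofReal_toReal (ENNReal.rpow_ne_top_of_nonneg hp.le hx)]
    _ = ENNReal.ofReal p * ∫⁻ t in Set.Ioi (0 : ℝ),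
          μ {x | t < (F x).toReal} * ENNReal.ofReal (t ^ (p - 1)) :=
        lintegral_rpow_eq_lintegral_meas_lt_mul μ
          (Filter.Eventually.of_forall fun _ => ENNReal.toReal_nonneg) hF.ennreal_toReal hp
    _ = _ := by
        congr 1
        refine setLIntegral_congr_fun measurableSet_Ioi fun t ht => ?_
        congr 1
        refine measure_congr ?_
        filter_upwards [hF_fin] with x hx
        exact propext (ENNReal.ofReal_lt_iff_lt_toReal (le_of_lt ht) hx).symm

theorem lintegral_rpow_le_of_meas_lt_le (ν μ : Measure X) {F : X → ℝ≥0∞} (hF : Measurable F)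
    (hν : ∀ᵐ x ∂ν, F x ≠ ∞) (hμ : ∀ᵐ x ∂μ, F x ≠ ∞) {A : ℝ} {c : ℝ≥0∞} {ε : ℝ} (hε : 0 < ε)
    (h : ∀ t, 0 < t → A ≤ t → ν {x | ENNReal.ofReal t < F x} ≤
      c * ENNReal.ofReal t * μ {x | ENNReal.ofReal t < F x}) :
    ∫⁻ x, F x ^ ε ∂ν ≤ ENNReal.ofReal A ^ ε * ν Set.univ +
      c * ENNReal.ofReal ε * ∫⁻ x, F x ^ (1 + ε) ∂μ := by
  set low : ℝ → ℝ≥0∞ := fun t =>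
    ν {_x | ENNReal.ofReal t < ENNReal.ofReal A} * ENNReal.ofReal (t ^ (ε - 1))
  set high : ℝ → ℝ≥0∞ := fun t =>
    μ {x | ENNReal.ofReal t < F x} * ENNReal.ofReal (t ^ (1 + ε - 1))
  have meas_rpow (a : ℝ) : Measurable fun t : ℝ => ENNReal.ofReal (t ^ a) := by fun_prop
  have low_meas : Measurable low :=
    (measurable_meas_ofReal_lt ν fun _ => ENNReal.ofReal A).mul (meas_rpow _)
  have high_meas : Measurable high := (measurable_meas_ofReal_lt μ F).mul (meas_rpow _)
  have low_eq : ENNReal.ofReal ε * ∫⁻ t in Set.Ioi (0 : ℝ), low t =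
      ENNReal.ofReal A ^ ε * ν Set.univ := by
    rw [← lintegral_rpow_eq_lintegral_meas_ofReal_lt ν aemeasurable_const
      (Filter.Eventually.of_forall fun _ => ENNReal.ofReal_ne_top) hε, lintegral_const]
  have level_le (t : ℝ) (ht : t ∈ Set.Ioi 0) :
      ν {x | ENNReal.ofReal t < F x} * ENNReal.ofReal (t ^ (ε - 1)) ≤ low t + c * high t := by
    rcases lt_or_ge t A with htA | hAt
    · refine le_trans (mul_le_mul' (measure_mono fun _ _ => ?_) le_rfl) le_self_add
      exact (ENNReal.ofReal_lt_ofReal_iff (lt_trans ht htA)).2 htA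
    · have t_mul_rpow : ENNReal.ofReal (t ^ (1 + ε - 1)) =
          ENNReal.ofReal t * ENNReal.ofReal (t ^ (ε - 1)) := by
        rw [← ENNReal.ofReal_mul ht.le, show 1 + ε - 1 = 1 + (ε - 1) by ring,
          Real.rpow_add ht, Real.rpow_one]
      refine le_trans (mul_le_mul' (h t ht hAt) le_rfl) (le_trans (le_of_eq ?_) le_add_self)
      simp only [high, t_mul_rpow]
      ring
  calc ∫⁻ x, F x ^ ε ∂ν
      ≤ ENNReal.ofReal ε * ∫⁻ t in Set.Ioi (0 : ℝ), (low t + c * high t) := by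
        rw [lintegral_rpow_eq_lintegral_meas_ofReal_lt ν hF.aemeasurable hν hε]
        exact mul_le_mul' le_rfl (setLIntegral_mono' measurableSet_Ioi level_le)
    _ = ENNReal.ofReal A ^ ε * ν Set.univ +
          c * ENNReal.ofReal ε * ∫⁻ t in Set.Ioi (0 : ℝ), high t := by
        rw [lintegral_add_left low_meas, mul_add, low_eq, lintegral_const_mul _ high_meas]
        ring
    _ ≤ _ := by
        rw [lintegral_rpow_eq_lintegral_meas_ofReal_lt μ hF.aemeasurable hμ (p := 1 + ε)
          (by linarith)]
        gcongr
        exact le_mul_of_one_le_left zero_le (ENNReal.one_le_ofReal.2 (by linarith))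

/-- Marcinkiewicz interpolation in the only form needed: the strong type estimate follows from the
weak type estimate for `M` in which `g` has been truncated at height `t / 2`. -/
theorem lintegral_rpow_le_of_truncated_weak_type {μ : Measure X} {M g : X → ℝ≥0∞}
    (hM : AEMeasurable M μ) (hM_fin : ∀ᵐ x ∂μ, M x ≠ ∞) (hg : AEMeasurable g μ)
    (hg_fin : ∀ᵐ x ∂μ, g x ≠ ∞)
    (weak : ∀ t : ℝ, 0 < t → ENNReal.ofReal t * μ {x | ENNReal.ofReal t < M x} ≤
      2 * (μ.withDensity g) {x | ENNReal.ofReal t < 2 * g x}) {b : ℝ} (hb : 1 < b) :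
    ∫⁻ x, M x ^ b ∂μ ≤ ENNReal.ofReal (2 ^ b * (b / (b - 1))) * ∫⁻ x, g x ^ b ∂μ := by
  have hb0 : 0 < b := by linarith
  have hb1 : 0 < b - 1 := by linarith
  have hac : μ.withDensity g ≪ μ := withDensity_absolutelyContinuous μ g
  set I : ℝ≥0∞ := ∫⁻ t in Set.Ioi (0 : ℝ),
    (μ.withDensity g) {x | ENNReal.ofReal t < 2 * g x} * ENNReal.ofReal (t ^ (b - 1 - 1))
  have lintegral_meas_le : ∫⁻ t in Set.Ioi (0 : ℝ), μ {x | ENNReal.ofReal t < M x} *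
      ENNReal.ofReal (t ^ (b - 1)) ≤ 2 * I := by
    rw [← lintegral_const_mul' _ _ ENNReal.ofNat_ne_top]
    refine setLIntegral_mono' measurableSet_Ioi fun t (ht : 0 < t) => ?_
    rw [show b - 1 = 1 + (b - 1 - 1) by ring, Real.rpow_add ht, Real.rpow_one,
      ENNReal.ofReal_mul ht.le, show 1 + (b - 1 - 1) - 1 = b - 1 - 1 by ring,
      ← mul_assoc, ← mul_assoc, mul_comm (μ _)]
    exact mul_le_mul' (weak t ht) le_rfl
  have layer_withDensity : ENNReal.ofReal (b - 1) * I =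
      ENNReal.ofReal (2 ^ (b - 1)) * ∫⁻ x, g x ^ b ∂μ := by
    rw [← lintegral_rpow_eq_lintegral_meas_ofReal_lt (μ.withDensity g) (F := fun x => 2 * g x)
        ((hg.const_mul 2).mono_ac hac)
        (hac.ae_le (hg_fin.mono fun x hx => ENNReal.mul_ne_top ENNReal.ofNat_ne_top hx)) hb1,
      lintegral_withDensity_eq_lintegral_mul₀ hg ((hg.const_mul 2).pow_const _),
      ← lintegral_const_mul' _ _ ENNReal.ofReal_ne_top]
    refine lintegral_congr fun x => ?_
    have g_mul_rpow : g x ^ b = g x * g x ^ (b - 1) := by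
      simpa using ENNReal.rpow_add_of_nonneg (x := g x) 1 (b - 1) zero_le_one hb1.le
    simp only [Pi.mul_apply, ENNReal.mul_rpow_of_nonneg _ _ hb1.le, g_mul_rpow,
      ← ENNReal.ofReal_rpow_of_pos (zero_lt_two' ℝ), ENNReal.ofReal_ofNat]
    ring
  have const_eq : ENNReal.ofReal b * 2 =
      ENNReal.ofReal (2 * (b / (b - 1))) * ENNReal.ofReal (b - 1) := by
    rw [← ENNReal.ofReal_mul (by positivity), ← ENNReal.ofReal_ofNat 2, ← ENNReal.ofReal_mul hb0.le]
    congr 1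
    field_simp
  calc ∫⁻ x, M x ^ b ∂μ ≤ ENNReal.ofReal b * (2 * I) := by
        rw [lintegral_rpow_eq_lintegral_meas_ofReal_lt μ hM hM_fin hb0]
        gcongr
    _ = ENNReal.ofReal (2 * (b / (b - 1))) * (ENNReal.ofReal (2 ^ (b - 1)) * ∫⁻ x, g x ^ b ∂μ) := by
        rw [← mul_assoc, const_eq, mul_assoc, layer_withDensity]
    _ = _ := by
        rw [← mul_assoc, ← ENNReal.ofReal_mul (by positivity)]
        congr 2
        rw [Real.rpow_sub_one two_ne_zero]
        ring

end LayerCake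

section Maximal

variable {X : Type*} [MeasurableSpace X]

/-- Laminar families: measurable sets of positive finite measure, any two of which are nested or
disjoint. They isolate what maximal function estimates use of a dyadic lattice. -/
structure IsLaminar (μ : Measure X) (𝒮 : Set (Set X)) : Prop where
  measurableSet : ∀ S ∈ 𝒮, MeasurableSet S
  ne_zero : ∀ S ∈ 𝒮, μ S ≠ 0
  ne_top : ∀ S ∈ 𝒮, μ S ≠ ∞
  nested : ∀ S ∈ 𝒮, ∀ S' ∈ 𝒮, S ⊆ S' ∨ S' ⊆ S ∨ Disjoint S S'

theorem IsLaminar.mono {μ : Measure X} {𝒮 𝒮' : Set (Set X)} (h : IsLaminar μ 𝒮) (hs : 𝒮' ⊆ 𝒮) :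
    IsLaminar μ 𝒮' where
  measurableSet S hS := h.measurableSet S (hs hS)
  ne_zero S hS := h.ne_zero S (hs hS)
  ne_top S hS := h.ne_top S (hs hS)
  nested S hS S' hS' := h.nested S (hs hS) S' (hs hS')

theorem IsLaminar.measure_biUnion_le {μ : Measure X} {𝒮 : Finset (Set X)}
    (h : IsLaminar μ (𝒮 : Set (Set X))) {ν ν' : Measure X}
    (le_of_maximal : ∀ S, Maximal (· ∈ 𝒮) S → ν S ≤ ν' S) :
    ν (⋃ S ∈ 𝒮, S) ≤ ν' (⋃ S ∈ 𝒮, S) := by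
  classical
  set 𝒯 := {S ∈ 𝒮 | Maximal (· ∈ 𝒮) S}
  have maximal_of_mem {S : Set X} (hS : S ∈ 𝒯) : Maximal (· ∈ 𝒮) S := (Finset.mem_filter.1 hS).2
  have biUnion_eq : (⋃ S ∈ 𝒮, S) = ⋃ S ∈ 𝒯, S := by
    refine subset_antisymm (Set.iUnion₂_subset fun S hS => ?_)
      (Set.biUnion_subset_biUnion_left fun S hS => (maximal_of_mem hS).1)
    obtain ⟨S', hSS', hS'⟩ := 𝒮.exists_le_maximal hS
    exact Set.subset_iUnion₂_of_subset S' (Finset.mem_filter.2 ⟨hS'.1, hS'⟩) hSS'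
  have disjoint : (𝒯 : Set (Set X)).PairwiseDisjoint id := fun S hS S' hS' hne => by
    rcases h.nested S (maximal_of_mem hS).1 S' (maximal_of_mem hS').1 with hsub | hsub | hdisj
    · exact absurd ((maximal_of_mem hS).eq_of_le (maximal_of_mem hS').1 hsub) hne
    · exact absurd ((maximal_of_mem hS').eq_of_le (maximal_of_mem hS).1 hsub).symm hne
    · exact hdisj
  have measure_eq_sum (κ : Measure X) : κ (⋃ S ∈ 𝒯, S) = ∑ S ∈ 𝒯, κ S :=
    measure_biUnion_finset disjoint fun S hS => h.measurableSet S (maximal_of_mem hS).1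
  rw [biUnion_eq, measure_eq_sum, measure_eq_sum]
  exact Finset.sum_le_sum fun S hS => le_of_maximal S (maximal_of_mem hS)

/-- The maximal function of `g` with respect to a finite family `𝒮` of sets, equal to `0` off
`⋃ 𝒮`. -/
def maxFn (μ : Measure X) (𝒮 : Finset (Set X)) (g : X → ℝ≥0∞) (x : X) : ℝ≥0∞ :=
  𝒮.sup fun S => S.indicator (fun _ => ⨍⁻ y in S, g y ∂μ) x

variable {μ : Measure X} {𝒮 : Finset (Set X)}

theorem laverage_le_maxFn (g : X → ℝ≥0∞) {S : Set X} (hS : S ∈ 𝒮) {x : X} (hx : x ∈ S) :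
    ⨍⁻ y in S, g y ∂μ ≤ maxFn μ 𝒮 g x := by
  have := Finset.le_sup (f := fun S => S.indicator (fun _ => ⨍⁻ y in S, g y ∂μ) x) hS
  rwa [Set.indicator_of_mem hx] at this

theorem maxFn_le_iff {g : X → ℝ≥0∞} {x : X} {c : ℝ≥0∞} :
    maxFn μ 𝒮 g x ≤ c ↔ ∀ S ∈ 𝒮, x ∈ S → ⨍⁻ y in S, g y ∂μ ≤ c := by
  classical
  simp only [maxFn, Finset.sup_le_iff, Set.indicator_apply]
  refine forall₂_congr fun S _ => ?_
  split_ifs with h <;> simp [h]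

theorem lt_maxFn_iff {g : X → ℝ≥0∞} {x : X} {c : ℝ≥0∞} :
    c < maxFn μ 𝒮 g x ↔ ∃ S ∈ 𝒮, x ∈ S ∧ c < ⨍⁻ y in S, g y ∂μ := by
  simpa only [not_le, not_forall, exists_prop] using
    (maxFn_le_iff (μ := μ) (𝒮 := 𝒮) (g := g) (x := x) (c := c)).not

theorem measurable_maxFn (h𝒮 : ∀ S ∈ 𝒮, MeasurableSet S) (g : X → ℝ≥0∞) :
    Measurable (maxFn μ 𝒮 g) := by
  have maxFn_eq_iSup :
      maxFn μ 𝒮 g = fun x => ⨆ S ∈ 𝒮, S.indicator (fun _ => ⨍⁻ y in S, g y ∂μ) x := by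
    ext x
    simp only [maxFn, Finset.sup_eq_iSup]
  rw [maxFn_eq_iSup]
  exact Measurable.biSup _ 𝒮.countable_toSet fun S hS => measurable_const.indicator (h𝒮 S hS)

theorem maxFn_ne_top {g : X → ℝ≥0∞} (hg : ∀ S ∈ 𝒮, ∫⁻ y in S, g y ∂μ ≠ ∞) (x : X) :
    maxFn μ 𝒮 g x ≠ ∞ := by
  refine ((Finset.sup_lt_iff ENNReal.zero_lt_top).2 fun S hS => ?_).ne
  refine lt_of_le_of_lt (Set.indicator_le_self S _ x) ?_
  rcases eq_or_ne (μ S) 0 with hS0 | hS0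
  · simp [Measure.restrict_eq_zero.2 hS0]
  · rw [setLAverage_eq]
    exact ENNReal.div_lt_top (hg S hS) hS0

theorem laverage_mul_measure {S : Set X} (hS0 : μ S ≠ 0) (hS_top : μ S ≠ ∞) (g : X → ℝ≥0∞) :
    (⨍⁻ y in S, g y ∂μ) * μ S = ∫⁻ y in S, g y ∂μ := by
  rw [setLAverage_eq, ENNReal.div_mul_cancel hS0 hS_top]

theorem IsLaminar.mul_meas_lt_maxFn_le_lintegral (h : IsLaminar μ (𝒮 : Set (Set X)))
    (g : X → ℝ≥0∞) (c : ℝ≥0∞) : c * μ {x | c < maxFn μ 𝒮 g x} ≤ ∫⁻ x, g x ∂μ := by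
  classical
  set 𝒯 := 𝒮.filter fun S => c < ⨍⁻ y in S, g y ∂μ
  have h𝒯 : (𝒯 : Set (Set X)) ⊆ 𝒮 := fun S hS => (Finset.mem_filter.1 hS).1
  have level_eq : {x | c < maxFn μ 𝒮 g x} = ⋃ S ∈ 𝒯, S := by
    ext x
    simp only [Set.mem_ofPred_eq, lt_maxFn_iff, 𝒯, Set.mem_iUnion, Finset.mem_filter, exists_prop]
    exact exists_congr fun S => by tauto
  have measure_le (S : Set X) (hS : Maximal (· ∈ 𝒯) S) : (c • μ) S ≤ μ.withDensity g S := by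
    obtain ⟨hS𝒮, hcS⟩ := Finset.mem_filter.1 hS.1
    rw [withDensity_apply _ (h.measurableSet S hS𝒮),
      ← laverage_mul_measure (h.ne_zero S hS𝒮) (h.ne_top S hS𝒮), Measure.smul_apply, smul_eq_mul]
    gcongr
  calc c * μ {x | c < maxFn μ 𝒮 g x} = (c • μ) (⋃ S ∈ 𝒯, S) := by
        rw [level_eq, Measure.smul_apply, smul_eq_mul]
    _ ≤ μ.withDensity g (⋃ S ∈ 𝒯, S) := (h.mono h𝒯).measure_biUnion_le measure_le
    _ = ∫⁻ x in ⋃ S ∈ 𝒯, S, g x ∂μ :=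
        withDensity_apply _ (𝒯.measurableSet_biUnion fun S hS => h.measurableSet S (h𝒯 hS))
    _ ≤ _ := setLIntegral_le_lintegral _ _

theorem setLIntegral_ne_top_of_lintegral_rpow {g : X → ℝ≥0∞} {b : ℝ} (hb : 1 ≤ b)
    (hg : ∫⁻ x, g x ^ b ∂μ ≠ ∞) {S : Set X} (hS : μ S ≠ ∞) : ∫⁻ y in S, g y ∂μ ≠ ∞ := by
  refine ne_top_of_le_ne_top (b := ∫⁻ y in S, (1 + g y ^ b) ∂μ) ?_ (lintegral_mono fun y => ?_)
  · rw [lintegral_add_left measurable_const, setLIntegral_one]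
    exact ENNReal.add_ne_top.2 ⟨hS, ne_top_of_le_ne_top hg (setLIntegral_le_lintegral _ _)⟩
  · rcases le_total (g y) 1 with hy | hy
    · exact hy.trans le_self_add
    · calc g y = g y ^ (1 : ℝ) := (ENNReal.rpow_one _).symm
        _ ≤ g y ^ b := ENNReal.rpow_le_rpow_of_exponent_le hy hb
        _ ≤ _ := le_add_self

theorem laverage_le_laverage_indicator_add {S : Set X} (hS0 : μ S ≠ 0) (hS_top : μ S ≠ ∞)
    (g : X → ℝ≥0∞) {E : Set X} {c : ℝ≥0∞} (hE : ∀ y ∉ E, g y ≤ c) :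
    ⨍⁻ y in S, g y ∂μ ≤ (⨍⁻ y in S, E.indicator g y ∂μ) + c := by
  have : Fact (μ S < ∞) := ⟨hS_top.lt_top⟩
  have laverage_c : ⨍⁻ _ in S, c ∂μ = c := setLAverage_const hS0 hS_top c
  conv_rhs => rw [← laverage_c]
  simp only [laverage]
  rw [← lintegral_add_right _ measurable_const]
  refine lintegral_mono fun y => ?_
  by_cases hy : y ∈ E
  · rw [Set.indicator_of_mem hy]
    exact le_self_add
  · rw [Set.indicator_of_notMem hy, zero_add]
    exact hE y hy

theorem IsLaminar.mul_meas_lt_maxFn_le_withDensity (h : IsLaminar μ (𝒮 : Set (Set X)))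
    {g : X → ℝ≥0∞} (hg : AEMeasurable g μ) (t : ℝ) :
    ENNReal.ofReal t * μ {x | ENNReal.ofReal t < maxFn μ 𝒮 g x} ≤
      2 * (μ.withDensity g) {x | ENNReal.ofReal t < 2 * g x} := by
  set c := ENNReal.ofReal t / 2
  have two_mul_c : 2 * c = ENNReal.ofReal t :=
    ENNReal.mul_div_cancel two_ne_zero ENNReal.ofNat_ne_top
  set E := {x | ENNReal.ofReal t < 2 * g x}
  have hE : NullMeasurableSet E μ := nullMeasurableSet_lt aemeasurable_const (hg.const_mul 2)
  have le_of_notMem (y : X) (hy : y ∉ E) : g y ≤ c :=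
    (ENNReal.mul_le_mul_iff_right two_ne_zero ENNReal.ofNat_ne_top).1
      (two_mul_c ▸ not_lt.1 hy)
  have level_subset : {x | ENNReal.ofReal t < maxFn μ 𝒮 g x} ⊆
      {x | c < maxFn μ 𝒮 (E.indicator g) x} := by
    intro x hx
    obtain ⟨S, hS, hxS, hlt⟩ := lt_maxFn_iff.1 hx
    refine lt_maxFn_iff.2 ⟨S, hS, hxS, lt_of_add_lt_add_right (a := c) ?_⟩
    rw [← two_mul, two_mul_c]
    exact hlt.trans_le
      (laverage_le_laverage_indicator_add (h.ne_zero S hS) (h.ne_top S hS) g le_of_notMem)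
  calc ENNReal.ofReal t * μ {x | ENNReal.ofReal t < maxFn μ 𝒮 g x}
      ≤ 2 * (c * μ {x | c < maxFn μ 𝒮 (E.indicator g) x}) := by
        rw [← mul_assoc, two_mul_c]
        exact mul_le_mul' le_rfl (measure_mono level_subset)
    _ ≤ 2 * ∫⁻ x, E.indicator g x ∂μ := by
        gcongr
        exact h.mul_meas_lt_maxFn_le_lintegral _ _
    _ = _ := by rw [lintegral_indicator₀ hE, withDensity_apply₀ _ hE]

/-- The constant must stay explicit: its order `b / (b - 1)` as `b → 1` decides the powers of the
weight characteristics in the final bound. -/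
theorem IsLaminar.lintegral_maxFn_rpow_le (h : IsLaminar μ (𝒮 : Set (Set X))) {g : X → ℝ≥0∞}
    (hg : AEMeasurable g μ) {b : ℝ} (hb : 1 < b) :
    ∫⁻ x, maxFn μ 𝒮 g x ^ b ∂μ ≤ ENNReal.ofReal (2 ^ b * (b / (b - 1))) * ∫⁻ x, g x ^ b ∂μ := by
  by_cases hg_top : ∫⁻ x, g x ^ b ∂μ = ∞
  · have : 0 < 2 ^ b * (b / (b - 1)) :=
      mul_pos (by positivity) (div_pos (by linarith) (by linarith))
    rw [hg_top, ENNReal.mul_top (ENNReal.ofReal_pos.2 this).ne']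
    exact le_top
  · have maxFn_fin := maxFn_ne_top (μ := μ) (𝒮 := 𝒮) (g := g) fun S hS =>
      setLIntegral_ne_top_of_lintegral_rpow hb.le hg_top (h.ne_top S hS)
    have g_fin : ∀ᵐ x ∂μ, g x ≠ ∞ := by
      filter_upwards [ae_lt_top' (hg.pow_const b) hg_top] with x hx
      rintro hx'
      simp [hx', ENNReal.top_rpow_of_pos (zero_lt_one.trans hb)] at hx
    exact lintegral_rpow_le_of_truncated_weak_type
      (measurable_maxFn h.measurableSet g).aemeasurable (.of_forall maxFn_fin) hg g_fin
      (fun t _ => h.mul_meas_lt_maxFn_le_withDensity hg t) hb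

end Maximal

section Cubes
open Filter Topology

variable {d : ℕ}

theorem measurableSet_cube (a : Fin d → ℝ) (ℓ : ℝ) : MeasurableSet (cube a ℓ) :=
  MeasurableSet.univ_pi fun _ => measurableSet_Ico

theorem volume_cube (a : Fin d → ℝ) (ℓ : ℝ) : volume (cube a ℓ) = ENNReal.ofReal ℓ ^ d := by
  simp [cube, volume_pi_pi]

theorem volume_cube_ne_zero (a : Fin d → ℝ) {ℓ : ℝ} (hℓ : 0 < ℓ) : volume (cube a ℓ) ≠ 0 := by
  rw [volume_cube]
  exact pow_ne_zero _ (ENNReal.ofReal_pos.2 hℓ).ne'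

theorem volume_cube_ne_top (a : Fin d → ℝ) (ℓ : ℝ) : volume (cube a ℓ) ≠ ∞ := by
  rw [volume_cube]
  exact ENNReal.pow_ne_top ENNReal.ofReal_ne_top

theorem measurableSet_of_mem_cubes {Q : Set (Fin d → ℝ)} (hQ : Q ∈ cubes d) : MeasurableSet Q := by
  obtain ⟨a, ℓ, -, rfl⟩ := hQ
  exact measurableSet_cube a ℓ

theorem volume_ne_zero_of_mem_cubes {Q : Set (Fin d → ℝ)} (hQ : Q ∈ cubes d) : volume Q ≠ 0 := by
  obtain ⟨a, ℓ, hℓ, rfl⟩ := hQ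
  exact volume_cube_ne_zero a hℓ

theorem volume_ne_top_of_mem_cubes {Q : Set (Fin d → ℝ)} (hQ : Q ∈ cubes d) : volume Q ≠ ∞ := by
  obtain ⟨a, ℓ, -, rfl⟩ := hQ
  exact volume_cube_ne_top a ℓ

theorem isLaminar_of_subset_cubes {𝒮 : Set (Set (Fin d → ℝ))} (h𝒮 : 𝒮 ⊆ cubes d)
    (nested : ∀ S ∈ 𝒮, ∀ S' ∈ 𝒮, S ⊆ S' ∨ S' ⊆ S ∨ Disjoint S S') : IsLaminar volume 𝒮 where
  measurableSet _ hS := measurableSet_of_mem_cubes (h𝒮 hS)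
  ne_zero _ hS := volume_ne_zero_of_mem_cubes (h𝒮 hS)
  ne_top _ hS := volume_ne_top_of_mem_cubes (h𝒮 hS)
  nested := nested

theorem mem_cube {a : Fin d → ℝ} {ℓ : ℝ} {x : Fin d → ℝ} :
    x ∈ cube a ℓ ↔ ∀ i, a i ≤ x i ∧ x i < a i + ℓ := by
  simp [cube, Set.mem_pi]

theorem cube_inj (hd : 0 < d) {a a' : Fin d → ℝ} {ℓ ℓ' : ℝ} (hℓ : 0 < ℓ) (hℓ' : 0 < ℓ')
    (h : cube a ℓ = cube a' ℓ') : a = a' ∧ ℓ = ℓ' := by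
  have nonempty : (cube a ℓ).Nonempty := ⟨a, mem_cube.2 fun i => ⟨le_rfl, by linarith⟩⟩
  have nonempty' : (cube a' ℓ').Nonempty := h ▸ nonempty
  have side_eq (i : Fin d) : Set.Ico (a i) (a i + ℓ) = Set.Ico (a' i) (a' i + ℓ') := by
    have := congrArg (fun S => Function.eval i '' S) h
    simp only [cube] at this nonempty nonempty'
    rwa [Set.eval_image_univ_pi nonempty, Set.eval_image_univ_pi nonempty'] at this
  have corner_eq (i : Fin d) : a i = a' i := by
    have := congrArg sInf (side_eq i)
    rwa [csInf_Ico (by linarith), csInf_Ico (by linarith)] at this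
  refine ⟨funext corner_eq, ?_⟩
  have := congrArg sSup (side_eq ⟨0, hd⟩)
  rw [csSup_Ico (by linarith), csSup_Ico (by linarith), corner_eq] at this
  linarith

/-- The cube with index `m` in the grid of generation `j`, obtained by bisecting the sides of
`cube a ℓ` `j` times. It is a subcube of `cube a ℓ` when all `m i < 2 ^ j`. -/
def gridCube (a : Fin d → ℝ) (ℓ : ℝ) (j : ℕ) (m : Fin d → ℕ) : Set (Fin d → ℝ) :=
  cube (fun i => a i + (m i : ℝ) * (ℓ / 2 ^ j)) (ℓ / 2 ^ j)

/-- The index of the grid cube of generation `j` that contains `x`. -/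
def gridIndex (a : Fin d → ℝ) (ℓ : ℝ) (j : ℕ) (x : Fin d → ℝ) : Fin d → ℕ :=
  fun i => ⌊(x i - a i) / (ℓ / 2 ^ j)⌋₊

theorem mem_gridCube_iff {a : Fin d → ℝ} {ℓ : ℝ} (hℓ : 0 < ℓ) {j : ℕ} {m : Fin d → ℕ}
    {x : Fin d → ℝ} (hx : x ∈ cube a ℓ) : x ∈ gridCube a ℓ j m ↔ gridIndex a ℓ j x = m := by
  have hs : 0 < ℓ / 2 ^ j := by positivity
  rw [gridCube, mem_cube, funext_iff]
  refine forall_congr' fun i => ?_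
  have hxi := (mem_cube.1 hx i).1
  rw [gridIndex, Nat.floor_eq_iff (div_nonneg (by linarith) hs.le), le_div_iff₀ hs, div_lt_iff₀ hs]
  constructor
  · rintro ⟨lower_le, lt_upper⟩
    constructor <;> linarith
  · rintro ⟨lower_le, lt_upper⟩
    constructor <;> linarith

theorem gridCube_mem_cubes (a : Fin d → ℝ) {ℓ : ℝ} (hℓ : 0 < ℓ) (j : ℕ) (m : Fin d → ℕ) :
    gridCube a ℓ j m ∈ cubes d := ⟨_, _, by positivity, rfl⟩

theorem gridCube_subset {a : Fin d → ℝ} {ℓ : ℝ} (hℓ : 0 < ℓ) {j : ℕ} {m : Fin d → ℕ}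
    (hm : ∀ i, m i < 2 ^ j) : gridCube a ℓ j m ⊆ cube a ℓ := by
  intro x hx
  refine mem_cube.2 fun i => ?_
  obtain ⟨lower, upper⟩ := mem_cube.1 hx i
  have succ_le : (m i : ℝ) + 1 ≤ 2 ^ j := by exact_mod_cast hm i
  have right_end_le : ((m i : ℝ) + 1) * (ℓ / 2 ^ j) ≤ ℓ := by
    calc ((m i : ℝ) + 1) * (ℓ / 2 ^ j) ≤ 2 ^ j * (ℓ / 2 ^ j) := by gcongr
      _ = ℓ := by field_simp
  have : 0 ≤ (m i : ℝ) * (ℓ / 2 ^ j) := by positivity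
  exact ⟨by linarith, by linarith⟩

theorem gridIndex_lt {a : Fin d → ℝ} {ℓ : ℝ} (hℓ : 0 < ℓ) (j : ℕ) {x : Fin d → ℝ}
    (hx : x ∈ cube a ℓ) (i : Fin d) : gridIndex a ℓ j x i < 2 ^ j := by
  have hs : 0 < ℓ / 2 ^ j := by positivity
  have hxi := mem_cube.1 hx i
  rw [gridIndex, Nat.floor_lt (div_nonneg (by linarith) hs.le), div_lt_iff₀ hs]
  have : ((2 ^ j : ℕ) : ℝ) * (ℓ / 2 ^ j) = ℓ := by
    push_cast
    field_simp
  linarith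

theorem mem_gridCube_gridIndex {a : Fin d → ℝ} {ℓ : ℝ} (hℓ : 0 < ℓ) (j : ℕ) {x : Fin d → ℝ}
    (hx : x ∈ cube a ℓ) : x ∈ gridCube a ℓ j (gridIndex a ℓ j x) :=
  (mem_gridCube_iff hℓ hx).2 rfl

theorem gridIndex_div (a : Fin d → ℝ) (ℓ : ℝ) (j k : ℕ) (x : Fin d → ℝ) (i : Fin d) :
    gridIndex a ℓ j x i = gridIndex a ℓ (j + k) x i / 2 ^ k := by
  have := Nat.floor_div_natCast ((x i - a i) / (ℓ / 2 ^ (j + k))) (2 ^ k)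
  rw [gridIndex, gridIndex, ← this]
  congr 1
  push_cast
  rw [pow_add]
  field_simp

theorem gridCube_subset_of_mem {a : Fin d → ℝ} {ℓ : ℝ} (hℓ : 0 < ℓ) {j k : ℕ} {m m' : Fin d → ℕ}
    (hm' : ∀ i, m' i < 2 ^ (j + k)) {x : Fin d → ℝ} (hx : x ∈ gridCube a ℓ j m)
    (hx' : x ∈ gridCube a ℓ (j + k) m') : gridCube a ℓ (j + k) m' ⊆ gridCube a ℓ j m := by
  intro y hy
  have hxQ := gridCube_subset hℓ hm' hx'
  have hyQ := gridCube_subset hℓ hm' hy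
  rw [mem_gridCube_iff hℓ hxQ] at hx hx'
  rw [mem_gridCube_iff hℓ hyQ] at hy ⊢
  rw [← hx]
  funext i
  rw [gridIndex_div a ℓ j k, gridIndex_div a ℓ j k x, hy, hx']

theorem gridCube_nested {a : Fin d → ℝ} {ℓ : ℝ} (hℓ : 0 < ℓ) {j j' : ℕ} {m m' : Fin d → ℕ}
    (hm : ∀ i, m i < 2 ^ j) (hm' : ∀ i, m' i < 2 ^ j') :
    gridCube a ℓ j m ⊆ gridCube a ℓ j' m' ∨ gridCube a ℓ j' m' ⊆ gridCube a ℓ j m ∨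
      Disjoint (gridCube a ℓ j m) (gridCube a ℓ j' m') := by
  rw [← or_assoc, or_iff_not_imp_right]
  intro hdis
  obtain ⟨x, hx, hx'⟩ := Set.not_disjoint_iff.1 hdis
  rcases le_total j j' with h | h
  · obtain ⟨k, rfl⟩ := Nat.exists_eq_add_of_le h
    exact Or.inr (gridCube_subset_of_mem hℓ hm' hx hx')
  · obtain ⟨k, rfl⟩ := Nat.exists_eq_add_of_le h
    exact Or.inl (gridCube_subset_of_mem hℓ hm hx' hx)

theorem subset_cubes_of_isDyadicLattice {𝒟 : Set (Set (Fin d → ℝ))} (h𝒟 : IsDyadicLattice 𝒟) :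
    𝒟 ⊆ cubes d := fun Q hQ => by
  obtain ⟨a, k, rfl⟩ := h𝒟.side_length Q hQ
  exact ⟨a, _, by positivity, rfl⟩

theorem isLaminar_of_isDyadicLattice (hd : 0 < d) {𝒟 : Set (Set (Fin d → ℝ))}
    (h𝒟 : IsDyadicLattice 𝒟) : IsLaminar volume 𝒟 := by
  refine isLaminar_of_subset_cubes (subset_cubes_of_isDyadicLattice h𝒟) fun S hS S' hS' => ?_
  obtain ⟨_, -, ⟨a, ℓ, j, m, hℓ, rfl, hm, rfl⟩, ⟨a', ℓ', j', m', hℓ', hQ, hm', rfl⟩⟩ :=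
    h𝒟.common_ancestor S hS S' hS'
  obtain ⟨rfl, rfl⟩ := cube_inj hd hℓ hℓ' hQ
  exact gridCube_nested hℓ hm hm'

theorem gridCube_mem_of_isDyadicLattice {𝒟 : Set (Set (Fin d → ℝ))} (h𝒟 : IsDyadicLattice 𝒟)
    {a : Fin d → ℝ} {ℓ : ℝ} (hℓ : 0 < ℓ) (hQ : cube a ℓ ∈ 𝒟) {j : ℕ} {m : Fin d → ℕ}
    (hm : ∀ i, m i < 2 ^ j) : gridCube a ℓ j m ∈ 𝒟 :=
  h𝒟.subcube_mem _ hQ _ ⟨a, ℓ, j, m, hℓ, rfl, hm, rfl⟩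

open Classical in
/-- The dyadic subcubes of `cube a ℓ` of generation at most `k`. -/
def gridFamily (a : Fin d → ℝ) (ℓ : ℝ) (k : ℕ) : Finset (Set (Fin d → ℝ)) :=
  (Finset.range (k + 1)).biUnion fun j =>
    (Fintype.piFinset fun _ : Fin d => Finset.range (2 ^ j)).image (gridCube a ℓ j)

theorem mem_gridFamily {a : Fin d → ℝ} {ℓ : ℝ} {k : ℕ} {R : Set (Fin d → ℝ)} :
    R ∈ gridFamily a ℓ k ↔ ∃ j ≤ k, ∃ m : Fin d → ℕ, (∀ i, m i < 2 ^ j) ∧ R = gridCube a ℓ j m := by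
  simp only [gridFamily, Finset.mem_biUnion, Finset.mem_range, Finset.mem_image,
    Fintype.mem_piFinset, Nat.lt_succ_iff]
  refine exists_congr fun j => and_congr_right fun _ => exists_congr fun m => ?_
  rw [eq_comm]

theorem gridFamily_subset_cubes (a : Fin d → ℝ) {ℓ : ℝ} (hℓ : 0 < ℓ) (k : ℕ) :
    (gridFamily a ℓ k : Set (Set (Fin d → ℝ))) ⊆ cubes d := fun R hR => by
  obtain ⟨j, -, m, -, rfl⟩ := mem_gridFamily.1 hR
  exact gridCube_mem_cubes a hℓ j m

theorem subset_cube_of_mem_gridFamily {a : Fin d → ℝ} {ℓ : ℝ} (hℓ : 0 < ℓ) {k : ℕ}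
    {R : Set (Fin d → ℝ)} (hR : R ∈ gridFamily a ℓ k) : R ⊆ cube a ℓ := by
  obtain ⟨j, -, m, hm, rfl⟩ := mem_gridFamily.1 hR
  exact gridCube_subset hℓ hm

theorem isLaminar_gridFamily (a : Fin d → ℝ) {ℓ : ℝ} (hℓ : 0 < ℓ) (k : ℕ) :
    IsLaminar volume (gridFamily a ℓ k : Set (Set (Fin d → ℝ))) := by
  refine isLaminar_of_subset_cubes (gridFamily_subset_cubes a hℓ k) fun S hS S' hS' => ?_
  obtain ⟨j, -, m, hm, rfl⟩ := mem_gridFamily.1 hS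
  obtain ⟨j', -, m', hm', rfl⟩ := mem_gridFamily.1 hS'
  exact gridCube_nested hℓ hm hm'

theorem gridCube_zero (a : Fin d → ℝ) (ℓ : ℝ) : gridCube a ℓ 0 0 = cube a ℓ := by
  simp [gridCube]

theorem gridCube_succ_subset_parent {a : Fin d → ℝ} {ℓ : ℝ} (hℓ : 0 < ℓ) {j : ℕ} {m : Fin d → ℕ}
    (hm : ∀ i, m i < 2 ^ (j + 1)) :
    gridCube a ℓ (j + 1) m ⊆ gridCube a ℓ j fun i => m i / 2 := by
  intro x hx
  have hxQ := gridCube_subset hℓ hm hx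
  rw [mem_gridCube_iff hℓ hxQ] at hx ⊢
  funext i
  rw [gridIndex_div a ℓ j 1, hx, pow_one]

theorem volume_gridCube_eq_volume_succ (a : Fin d → ℝ) (ℓ : ℝ) (j : ℕ) (m m' : Fin d → ℕ) :
    volume (gridCube a ℓ j m) = 2 ^ d * volume (gridCube a ℓ (j + 1) m') := by
  rw [gridCube, gridCube, volume_cube, volume_cube, ← mul_pow, ← ENNReal.ofReal_ofNat 2,
    ← ENNReal.ofReal_mul zero_le_two]
  congr 2
  rw [pow_succ]
  field_simp

theorem exists_parent_mem_gridFamily (hd : 0 < d) {a : Fin d → ℝ} {ℓ : ℝ} (hℓ : 0 < ℓ) {k : ℕ}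
    {R : Set (Fin d → ℝ)} (hR : R ∈ gridFamily a ℓ k) (hne : R ≠ cube a ℓ) :
    ∃ R' ∈ gridFamily a ℓ k, R ⊂ R' ∧ volume R' = 2 ^ d * volume R := by
  obtain ⟨_ | j, hj, m, hm, rfl⟩ := mem_gridFamily.1 hR
  · obtain rfl : m = 0 := funext fun i => by simpa using hm i
    exact absurd (gridCube_zero a ℓ) hne
  have half_lt (i : Fin d) : m i / 2 < 2 ^ j := by
    have := hm i
    rw [pow_succ] at this
    omega
  have volume_parent := volume_gridCube_eq_volume_succ a ℓ j (fun i => m i / 2) m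
  refine ⟨gridCube a ℓ j fun i => m i / 2, mem_gridFamily.2 ⟨j, by omega, _, half_lt, rfl⟩,
    (gridCube_succ_subset_parent hℓ hm).ssubset_of_ne fun heq => ?_, volume_parent⟩
  have hR_cubes := gridCube_mem_cubes a hℓ (j + 1) m
  have one_lt_two_pow : (1 : ℝ≥0∞) < 2 ^ d := one_lt_pow₀ ENNReal.one_lt_two hd.ne'
  have := ENNReal.mul_lt_mul_left (volume_ne_zero_of_mem_cubes hR_cubes)
    (volume_ne_top_of_mem_cubes hR_cubes) one_lt_two_pow
  rw [one_mul, ← volume_parent, ← heq] at this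
  exact this.false

/-- The centre of a grid cube. For the sup distance of `Fin d → ℝ` a cube is, up to a null set, a
closed ball, so that Lebesgue differentiation along balls applies to grid cubes. -/
def gridCenter (a : Fin d → ℝ) (ℓ : ℝ) (j : ℕ) (m : Fin d → ℕ) : Fin d → ℝ :=
  fun i => a i + (m i : ℝ) * (ℓ / 2 ^ j) + ℓ / 2 ^ j / 2

theorem closedBall_gridCenter (a : Fin d → ℝ) {ℓ : ℝ} (hℓ : 0 < ℓ) (j : ℕ) (m : Fin d → ℕ) :
    Metric.closedBall (gridCenter a ℓ j m) (ℓ / 2 ^ j / 2) =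
      Set.Icc (fun i => a i + (m i : ℝ) * (ℓ / 2 ^ j))
        (fun i => a i + (m i : ℝ) * (ℓ / 2 ^ j) + ℓ / 2 ^ j) := by
  rw [closedBall_pi _ (by positivity), ← Set.pi_univ_Icc]
  congr 1
  funext i
  rw [Real.closedBall_eq_Icc, gridCenter]
  congr 1 <;> ring

theorem gridCube_ae_eq_closedBall (a : Fin d → ℝ) {ℓ : ℝ} (hℓ : 0 < ℓ) (j : ℕ) (m : Fin d → ℕ) :
    gridCube a ℓ j m =ᵐ[volume] Metric.closedBall (gridCenter a ℓ j m) (ℓ / 2 ^ j / 2) := by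
  rw [closedBall_gridCenter a hℓ]
  exact Measure.univ_pi_Ico_ae_eq_Icc

theorem gridCube_subset_closedBall (a : Fin d → ℝ) {ℓ : ℝ} (hℓ : 0 < ℓ) (j : ℕ) (m : Fin d → ℕ) :
    gridCube a ℓ j m ⊆ Metric.closedBall (gridCenter a ℓ j m) (ℓ / 2 ^ j / 2) := by
  rw [closedBall_gridCenter a hℓ]
  intro x hx
  rw [gridCube, mem_cube] at hx
  exact ⟨fun i => (hx i).1, fun i => (hx i).2.le⟩

theorem tendsto_gridSide {ℓ : ℝ} (hℓ : 0 < ℓ) :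
    Tendsto (fun j : ℕ => ℓ / 2 ^ j / 2) atTop (𝓝[>] 0) := by
  refine tendsto_nhdsWithin_iff.2 ⟨?_, .of_forall fun j => Set.mem_Ioi.2 (by positivity)⟩
  simpa only [zero_div] using
    ((tendsto_pow_atTop_atTop_of_one_lt one_lt_two).const_div_atTop ℓ).div_const 2

theorem ae_tendsto_laverage_gridCube (a : Fin d → ℝ) {ℓ : ℝ} (hℓ : 0 < ℓ)
    {f : (Fin d → ℝ) → ℝ≥0∞} (hf : AEMeasurable f volume) (hfin : ∫⁻ x in cube a ℓ, f x ≠ ∞) :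
    ∀ᵐ x, x ∈ cube a ℓ → Tendsto
      (fun j => ⨍⁻ y in gridCube a ℓ j (gridIndex a ℓ j x), f y ∂volume) atTop (𝓝 (f x)) := by
  have hQ := measurableSet_cube a ℓ
  have h := (IsUnifLocDoublingMeasure.vitaliFamily (volume : Measure (Fin d → ℝ)) 1
    ).ae_tendsto_lintegral_div (f := (cube a ℓ).indicator f) (hf.indicator hQ)
    (by rwa [lintegral_indicator hQ])
  filter_upwards [h] with x hx hxQ
  rw [Set.indicator_of_mem hxQ] at hx
  refine (hx.comp (IsUnifLocDoublingMeasure.tendsto_closedBall_filterAt volume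
    (fun j => gridCenter a ℓ j (gridIndex a ℓ j x)) _ (tendsto_gridSide hℓ)
    (.of_forall fun j => ?_))).congr fun j => ?_
  · rw [one_mul]
    exact gridCube_subset_closedBall a hℓ _ _ (mem_gridCube_gridIndex hℓ j hxQ)
  · simp only [Function.comp_apply]
    have hae := gridCube_ae_eq_closedBall a hℓ j (gridIndex a ℓ j x)
    rw [← setLIntegral_congr hae, ← measure_congr hae, setLAverage_eq]
    congr 1
    refine setLIntegral_congr_fun (measurableSet_cube _ _) fun y hy => ?_
    exact Set.indicator_of_mem (gridCube_subset hℓ (gridIndex_lt hℓ j hxQ) hy) f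

theorem ae_tendsto_average_gridCube (a : Fin d → ℝ) {ℓ : ℝ} (hℓ : 0 < ℓ)
    {f : (Fin d → ℝ) → ℝ} (hf : LocallyIntegrable f volume) :
    ∀ᵐ x, x ∈ cube a ℓ → Tendsto
      (fun j => ⨍ y in gridCube a ℓ j (gridIndex a ℓ j x), f y) atTop (𝓝 (f x)) := by
  filter_upwards [IsUnifLocDoublingMeasure.ae_tendsto_average volume hf 1] with x hx hxQ
  refine (hx (fun j => gridCenter a ℓ j (gridIndex a ℓ j x)) _ (tendsto_gridSide hℓ)
    (.of_forall fun j => ?_)).congr fun j => ?_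
  · rw [one_mul]
    exact gridCube_subset_closedBall a hℓ _ _ (mem_gridCube_gridIndex hℓ j hxQ)
  · exact (setAverage_congr (gridCube_ae_eq_closedBall a hℓ j (gridIndex a ℓ j x))).symm

end Cubes

/-! ### A reverse Hölder inequality with explicit exponent -/

section ReverseHolder

open Filter Topology

section Maximal

variable {X : Type*} [MeasurableSpace X] {μ : Measure X} {𝒮 : Finset (Set X)} {w : X → ℝ≥0∞}

theorem lintegral_maxFn_rpow_ne_top {R : Set X} (hR : MeasurableSet R) (hR_top : μ R ≠ ∞)
    (hsub : ∀ S ∈ 𝒮, S ⊆ R) (hfin : ∫⁻ x in R, w x ∂μ ≠ ∞) {p : ℝ} (hp : 0 < p) :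
    ∫⁻ x, maxFn μ 𝒮 w x ^ p ∂μ ≠ ∞ := by
  set B := 𝒮.sup fun S => ⨍⁻ y in S, w y ∂μ
  have hB_top : B ≠ ∞ := by
    refine ((Finset.sup_lt_iff ENNReal.zero_lt_top).2 fun S hS => ?_).ne
    have hSfin : ∫⁻ y in S, w y ∂μ ≠ ∞ := ne_top_of_le_ne_top hfin (lintegral_mono_set (hsub S hS))
    exact setLAverage_lt_top hSfin
  have le_indicator : ∀ x, maxFn μ 𝒮 w x ≤ R.indicator (fun _ => B) x := fun x =>
    maxFn_le_iff.2 fun S hS hx => by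
      rw [Set.indicator_of_mem (hsub S hS hx)]
      exact Finset.le_sup (f := fun S => ⨍⁻ y in S, w y ∂μ) hS
  refine ne_top_of_le_ne_top (b := ∫⁻ x, R.indicator (fun _ => B ^ p) x ∂μ) ?_
    (lintegral_mono fun x => ?_)
  · rw [lintegral_indicator hR, setLIntegral_const]
    exact ENNReal.mul_ne_top (ENNReal.rpow_ne_top_of_nonneg hp.le hB_top) hR_top
  · calc maxFn μ 𝒮 w x ^ p ≤ R.indicator (fun _ => B) x ^ p :=
          ENNReal.rpow_le_rpow (le_indicator x) hp.le
      _ = R.indicator (fun _ => B ^ p) x := by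
          by_cases hx : x ∈ R <;> simp [hx, hp]

open Classical in
theorem IsLaminar.maxFn_le_maxFn_filter_subset (h : IsLaminar μ (𝒮 : Set (Set X))) {t : ℝ≥0∞}
    {R : Set X} (hR : Maximal (fun S => S ∈ 𝒮 ∧ t < ⨍⁻ y in S, w y ∂μ) R) {x : X} (hx : x ∈ R) :
    maxFn μ 𝒮 w x ≤ maxFn μ {S ∈ 𝒮 | S ⊆ R} w x := by
  have hRx : ⨍⁻ y in R, w y ∂μ ≤ maxFn μ {S ∈ 𝒮 | S ⊆ R} w x :=
    laverage_le_maxFn w (by simp [hR.prop.1]) hx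
  refine maxFn_le_iff.2 fun S hS hxS => ?_
  rcases h.nested S hS R hR.prop.1 with hSR | hRS | hdisj
  · exact laverage_le_maxFn w (Finset.mem_filter.2 ⟨hS, hSR⟩) hxS
  · by_cases hSt : t < ⨍⁻ y in S, w y ∂μ
    · exact laverage_le_maxFn w (Finset.mem_filter.2 ⟨hS, hR.le_of_ge ⟨hS, hSt⟩ hRS⟩) hxS
    · exact (not_lt.1 hSt).trans (hR.prop.2.le.trans hRx)
  · exact absurd hx (Set.disjoint_left.1 hdisj hxS)

end Maximal

variable {d : ℕ} {w : (Fin d → ℝ) → ℝ≥0∞} {K : ℝ≥0} {a : Fin d → ℝ} {ℓ : ℝ}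

/-- The reverse Hölder inequality between the exponents `1 / 2` and `1` on all cubes, with constant
`K`. Every function of the form `|W^{1/t} y| ^ t` satisfies it if `W` is an `A_t` weight. -/
def SqrtReverseHolder (w : (Fin d → ℝ) → ℝ≥0∞) (K : ℝ≥0) : Prop :=
  ∀ R ∈ cubes d, ⨍⁻ x in R, w x ∂volume ≤ K * (⨍⁻ x in R, w x ^ (1 / 2 : ℝ) ∂volume) ^ 2

-- The hypothesis bounds `M w` by `K (M √w)²`, and `M` is bounded on `L²`.
theorem SqrtReverseHolder.lintegral_maxFn_le (hK : SqrtReverseHolder w K)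
    (hw : AEMeasurable w volume) {𝒮 : Finset (Set (Fin d → ℝ))}
    (h𝒮 : IsLaminar volume (𝒮 : Set (Set (Fin d → ℝ)))) (hcubes : ∀ S ∈ 𝒮, S ∈ cubes d)
    {R : Set (Fin d → ℝ)} (hR : MeasurableSet R) (hsub : ∀ S ∈ 𝒮, S ⊆ R) :
    ∫⁻ x, maxFn volume 𝒮 w x ≤ 8 * K * ∫⁻ x in R, w x := by
  set g : (Fin d → ℝ) → ℝ≥0∞ := R.indicator fun x => w x ^ (1 / 2 : ℝ) with hg
  have average_sqrt_eq : ∀ S ∈ 𝒮,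
      ⨍⁻ x in S, w x ^ (1 / 2 : ℝ) ∂volume = ⨍⁻ x in S, g x ∂volume := fun S hS => by
    rw [setLAverage_eq, setLAverage_eq,
      setLIntegral_congr_fun (h𝒮.measurableSet S hS) fun y hy =>
        (Set.indicator_of_mem (hsub S hS hy) fun x => w x ^ (1 / 2 : ℝ)).symm]
  have maxFn_le : ∀ x, maxFn volume 𝒮 w x ≤ K * maxFn volume 𝒮 g x ^ (2 : ℝ) := by
    refine fun x => maxFn_le_iff.2 fun S hS hx => (hK S (hcubes S hS)).trans ?_
    rw [ENNReal.rpow_two, average_sqrt_eq S hS]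
    gcongr
    exact laverage_le_maxFn g hS hx
  have g_sq : ∀ x, g x ^ (2 : ℝ) = R.indicator w x := fun x => by
    by_cases hx : x ∈ R <;> simp [hg, hx, ← ENNReal.rpow_mul, -ENNReal.rpow_ofNat]
  calc ∫⁻ x, maxFn volume 𝒮 w x ≤ ∫⁻ x, K * maxFn volume 𝒮 g x ^ (2 : ℝ) := lintegral_mono maxFn_le
    _ = K * ∫⁻ x, maxFn volume 𝒮 g x ^ (2 : ℝ) := lintegral_const_mul' _ _ ENNReal.coe_ne_top
    _ ≤ K * (ENNReal.ofReal (2 ^ (2 : ℝ) * (2 / (2 - 1))) * ∫⁻ x, g x ^ (2 : ℝ)) := by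
        gcongr
        exact h𝒮.lintegral_maxFn_rpow_le ((hw.pow_const _).indicator hR) (by norm_num)
    _ = K * (8 * ∫⁻ x in R, w x) := by
        simp_rw [g_sq, lintegral_indicator hR]
        norm_num
    _ = 8 * K * ∫⁻ x in R, w x := by ring

-- The parent of a maximal cube with average above `t` has average at most `t`.
theorem meas_lt_maxFn_gridFamily_le (hd : 0 < d) (hℓ : 0 < ℓ) (k : ℕ) {c t : ℝ≥0∞}
    (ht : ⨍⁻ x in cube a ℓ, w x ∂volume ≤ t) {ν : Measure (Fin d → ℝ)}
    (hν : ∀ R, Maximal (fun S => S ∈ gridFamily a ℓ k ∧ t < ⨍⁻ x in S, w x ∂volume) R →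
      ν R ≤ c * ∫⁻ x in R, w x) :
    ν {x | t < maxFn volume (gridFamily a ℓ k) w x} ≤
      c * 2 ^ d * t * volume {x | t < maxFn volume (gridFamily a ℓ k) w x} := by
  classical
  have hlam := isLaminar_gridFamily a hℓ k
  set 𝒯 := {S ∈ gridFamily a ℓ k | t < ⨍⁻ y in S, w y ∂volume} with h𝒯
  have hsub : (𝒯 : Set (Set (Fin d → ℝ))) ⊆ gridFamily a ℓ k := fun S hS =>
    (Finset.mem_filter.1 hS).1
  have superlevel_eq : {x | t < maxFn volume (gridFamily a ℓ k) w x} = ⋃ S ∈ 𝒯, S := by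
    ext x
    simp only [Set.mem_ofPred_eq, lt_maxFn_iff, h𝒯, Set.mem_iUnion, Finset.mem_filter, exists_prop]
    grind
  have le_of_maximal : ∀ R, Maximal (· ∈ 𝒯) R → ν R ≤ ((c * 2 ^ d * t) • volume) R := by
    intro R hR
    obtain ⟨hR_mem, hR_lt⟩ := Finset.mem_filter.1 hR.prop
    have hR_ne : R ≠ cube a ℓ := by
      rintro rfl
      exact hR_lt.not_ge ht
    obtain ⟨R', hR', hRR', hvol⟩ := exists_parent_mem_gridFamily hd hℓ hR_mem hR_ne
    have average_parent_le : ⨍⁻ x in R', w x ∂volume ≤ t :=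
      not_lt.1 fun hlt => hRR'.not_ge (hR.le_of_ge (Finset.mem_filter.2 ⟨hR', hlt⟩) hRR'.le)
    calc ν R ≤ c * ∫⁻ x in R, w x := hν R (by simpa only [h𝒯, Finset.mem_filter] using hR)
      _ ≤ c * ∫⁻ x in R', w x := by
          gcongr
      _ = c * ((⨍⁻ x in R', w x ∂volume) * volume R') := by
          rw [laverage_mul_measure (hlam.ne_zero R' hR') (hlam.ne_top R' hR')]
      _ ≤ c * (t * (2 ^ d * volume R)) := by
          rw [hvol]
          gcongr
      _ = ((c * 2 ^ d * t) • volume) R := by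
          rw [Measure.smul_apply, smul_eq_mul]
          ring
  rw [superlevel_eq]
  exact (hlam.mono hsub).measure_biUnion_le le_of_maximal

theorem SqrtReverseHolder.setLIntegral_maxFn_gridFamily_le (hK : SqrtReverseHolder w K)
    (hw : AEMeasurable w volume) (hℓ : 0 < ℓ) (k : ℕ) {t : ℝ≥0∞} {R : Set (Fin d → ℝ)}
    (hR : Maximal (fun S => S ∈ gridFamily a ℓ k ∧ t < ⨍⁻ x in S, w x ∂volume) R) :
    ∫⁻ x in R, maxFn volume (gridFamily a ℓ k) w x ≤ 8 * K * ∫⁻ x in R, w x := by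
  classical
  have hlam := isLaminar_gridFamily a hℓ k
  have hRm := hlam.measurableSet R hR.prop.1
  set 𝒮 := {S ∈ gridFamily a ℓ k | S ⊆ R}
  have h𝒮 : (𝒮 : Set (Set (Fin d → ℝ))) ⊆ gridFamily a ℓ k := fun S hS =>
    (Finset.mem_filter.1 hS).1
  calc ∫⁻ x in R, maxFn volume (gridFamily a ℓ k) w x
      ≤ ∫⁻ x in R, maxFn volume 𝒮 w x :=
        setLIntegral_mono' hRm fun x hx => hlam.maxFn_le_maxFn_filter_subset hR hx
    _ ≤ ∫⁻ x, maxFn volume 𝒮 w x := setLIntegral_le_lintegral R _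
    _ ≤ 8 * K * ∫⁻ x in R, w x :=
        hK.lintegral_maxFn_le hw (hlam.mono h𝒮)
          (fun S hS => gridFamily_subset_cubes a hℓ k (h𝒮 hS)) hRm
          fun S hS => (Finset.mem_filter.1 hS).2

theorem measurable_maxFn_gridFamily (hℓ : 0 < ℓ) (k : ℕ) :
    Measurable (maxFn volume (gridFamily a ℓ k) w) :=
  measurable_maxFn (isLaminar_gridFamily a hℓ k).measurableSet w

theorem lintegral_maxFn_gridFamily_rpow_le_of_maximal (hd : 0 < d) (hℓ : 0 < ℓ)
    (hfin : ∫⁻ x in cube a ℓ, w x ≠ ∞) {ε : ℝ} (hε : 0 < ε) (k : ℕ) {c : ℝ≥0∞}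
    {ν : Measure (Fin d → ℝ)}
    (hν : ∀ t R, Maximal (fun S => S ∈ gridFamily a ℓ k ∧ t < ⨍⁻ x in S, w x ∂volume) R →
      ν R ≤ c * ∫⁻ x in R, w x) :
    ∫⁻ x, maxFn volume (gridFamily a ℓ k) w x ^ ε ∂ν ≤
      (⨍⁻ x in cube a ℓ, w x ∂volume) ^ ε * ν Set.univ +
        c * 2 ^ d * ENNReal.ofReal ε * ∫⁻ x, maxFn volume (gridFamily a ℓ k) w x ^ (1 + ε) := by
  have maxFn_fin : ∀ x, maxFn volume (gridFamily a ℓ k) w x ≠ ∞ := maxFn_ne_top fun S hS =>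
    ne_top_of_le_ne_top hfin (lintegral_mono_set (subset_cube_of_mem_gridFamily hℓ hS))
  have average_eq : ENNReal.ofReal (⨍⁻ x in cube a ℓ, w x ∂volume).toReal =
      ⨍⁻ x in cube a ℓ, w x ∂volume := ENNReal.ofReal_toReal (setLAverage_lt_top hfin).ne
  rw [← average_eq]
  refine lintegral_rpow_le_of_meas_lt_le ν volume (measurable_maxFn_gridFamily hℓ k)
    (Eventually.of_forall maxFn_fin) (Eventually.of_forall maxFn_fin) hε fun t _ ht => ?_
  exact meas_lt_maxFn_gridFamily_le hd hℓ k (average_eq ▸ ENNReal.ofReal_le_ofReal ht) (hν _)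

theorem mul_ofReal_le_inv_two {ε : ℝ} (hε : 16 * 2 ^ d * K * ε ≤ 1) :
    8 * K * 2 ^ d * ENNReal.ofReal ε ≤ 2⁻¹ := by
  have h : (8 * K * 2 ^ d : ℝ≥0∞) = ENNReal.ofReal (8 * K * 2 ^ d) := by
    rw [ENNReal.ofReal_mul (by positivity), ENNReal.ofReal_mul (by positivity),
      ENNReal.ofReal_pow (by positivity)]
    simp
  rw [h, ← ENNReal.ofReal_mul (by positivity),
    show (2⁻¹ : ℝ≥0∞) = ENNReal.ofReal 2⁻¹ by simp [ENNReal.ofReal_inv_of_pos]]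
  exact ENNReal.ofReal_le_ofReal (by linarith)

theorem SqrtReverseHolder.lintegral_maxFn_gridFamily_rpow_le (hK : SqrtReverseHolder w K)
    (hw : AEMeasurable w volume) (hd : 0 < d) (hℓ : 0 < ℓ) (hfin : ∫⁻ x in cube a ℓ, w x ≠ ∞)
    {ε : ℝ} (hε : 0 < ε) (hεK : 16 * 2 ^ d * K * ε ≤ 1) (k : ℕ) :
    ∫⁻ x, maxFn volume (gridFamily a ℓ k) w x ^ (1 + ε) ≤
      2 * (8 * K * ((⨍⁻ x in cube a ℓ, w x ∂volume) ^ ε * ∫⁻ x in cube a ℓ, w x)) := by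
  have hlam := isLaminar_gridFamily a hℓ k
  set M := maxFn volume (gridFamily a ℓ k) w
  set A := ⨍⁻ x in cube a ℓ, w x ∂volume
  set I := ∫⁻ x, M x ^ (1 + ε)
  have hM : Measurable M := measurable_maxFn_gridFamily hℓ k
  have hI_top : I ≠ ∞ :=
    lintegral_maxFn_rpow_ne_top (measurableSet_cube a ℓ) (volume_cube_ne_top a ℓ)
      (fun S hS => subset_cube_of_mem_gridFamily hℓ hS) hfin (by linarith)
  have lintegral_M_le : ∫⁻ x, M x ≤ 8 * K * ∫⁻ x in cube a ℓ, w x :=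
    hK.lintegral_maxFn_le hw hlam (gridFamily_subset_cubes a hℓ k) (measurableSet_cube a ℓ)
      fun S hS => subset_cube_of_mem_gridFamily hℓ hS
  have self_bound : I ≤ (A ^ ε * ∫⁻ x, M x) + 8 * K * 2 ^ d * ENNReal.ofReal ε * I := by
    have := lintegral_maxFn_gridFamily_rpow_le_of_maximal (a := a) (w := w) hd hℓ hfin hε k
      (ν := volume.withDensity M) (c := 8 * K) fun t R hR => by
        rw [withDensity_apply _ (hlam.measurableSet R hR.prop.1)]
        exact hK.setLIntegral_maxFn_gridFamily_le hw hℓ k hR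
    rw [withDensity_apply _ MeasurableSet.univ, Measure.restrict_univ,
      lintegral_withDensity_eq_lintegral_mul _ hM (hM.pow_const _)] at this
    refine (lintegral_congr fun x => ?_).trans_le this
    rw [Pi.mul_apply, ENNReal.rpow_add_of_nonneg _ _ zero_le_one hε.le, ENNReal.rpow_one]
  have absorbed : 2⁻¹ * I ≤ A ^ ε * (8 * K * ∫⁻ x in cube a ℓ, w x) := by
    suffices 2⁻¹ * I + 2⁻¹ * I ≤ A ^ ε * (8 * K * ∫⁻ x in cube a ℓ, w x) + 2⁻¹ * I from
      (ENNReal.add_le_add_iff_right (ENNReal.mul_ne_top (by simp) hI_top)).1 this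
    rw [← add_mul, ENNReal.inv_two_add_inv_two, one_mul]
    refine self_bound.trans ?_
    gcongr
    exact mul_ofReal_le_inv_two hεK
  calc I = 2 * (2⁻¹ * I) := by
        rw [← mul_assoc, ENNReal.mul_inv_cancel two_ne_zero ENNReal.ofNat_ne_top, one_mul]
    _ ≤ 2 * (A ^ ε * (8 * K * ∫⁻ x in cube a ℓ, w x)) := by gcongr
    _ = 2 * (8 * K * (A ^ ε * ∫⁻ x in cube a ℓ, w x)) := by ring

theorem SqrtReverseHolder.setLIntegral_mul_maxFn_gridFamily_rpow_le (hK : SqrtReverseHolder w K)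
    (hw : AEMeasurable w volume) (hd : 0 < d) (hℓ : 0 < ℓ) (hfin : ∫⁻ x in cube a ℓ, w x ≠ ∞)
    {ε : ℝ} (hε : 0 < ε) (hεK : 16 * 2 ^ d * K * ε ≤ 1) (k : ℕ) :
    ∫⁻ x in cube a ℓ, w x * maxFn volume (gridFamily a ℓ k) w x ^ ε ≤
      2 * ((⨍⁻ x in cube a ℓ, w x ∂volume) ^ ε * ∫⁻ x in cube a ℓ, w x) := by
  have hlam := isLaminar_gridFamily a hℓ k
  set M := maxFn volume (gridFamily a ℓ k) w
  set J := (⨍⁻ x in cube a ℓ, w x ∂volume) ^ ε * ∫⁻ x in cube a ℓ, w x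
  have hM : Measurable M := measurable_maxFn_gridFamily hℓ k
  have bound := lintegral_maxFn_gridFamily_rpow_le_of_maximal (a := a) (w := w) hd hℓ hfin hε k
    (ν := (volume.restrict (cube a ℓ)).withDensity w) (c := 1) fun t R hR => by
      rw [withDensity_apply _ (hlam.measurableSet R hR.prop.1), one_mul]
      exact lintegral_mono' (Measure.restrict_mono subset_rfl Measure.restrict_le_self) le_rfl
  rw [withDensity_apply _ MeasurableSet.univ, Measure.restrict_univ, one_mul,
    lintegral_withDensity_eq_lintegral_mul₀ hw.restrict (hM.pow_const _).aemeasurable] at bound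
  calc ∫⁻ x in cube a ℓ, w x * M x ^ ε
      ≤ J + 2 ^ d * ENNReal.ofReal ε * ∫⁻ x, M x ^ (1 + ε) := bound
    _ ≤ J + 2 ^ d * ENNReal.ofReal ε * (2 * (8 * K * J)) := by
        gcongr
        exact hK.lintegral_maxFn_gridFamily_rpow_le hw hd hℓ hfin hε hεK k
    _ = J + 2 * (8 * K * 2 ^ d * ENNReal.ofReal ε) * J := by ring
    _ ≤ J + 2 * 2⁻¹ * J := by
        gcongr
        exact mul_ofReal_le_inv_two hεK
    _ = 2 * J := by rw [ENNReal.mul_inv_cancel two_ne_zero ENNReal.ofNat_ne_top, one_mul, two_mul]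

theorem monotone_maxFn_gridFamily : Monotone fun k => maxFn volume (gridFamily a ℓ k) w := by
  refine fun k k' hk x => maxFn_le_iff.2 fun S hS hx => laverage_le_maxFn w ?_ hx
  obtain ⟨j, hj, m, hm, rfl⟩ := mem_gridFamily.1 hS
  exact mem_gridFamily.2 ⟨j, hj.trans hk, m, hm, rfl⟩

theorem ae_le_iSup_maxFn_gridFamily (hℓ : 0 < ℓ) (hw : AEMeasurable w volume)
    (hfin : ∫⁻ x in cube a ℓ, w x ≠ ∞) :
    ∀ᵐ x ∂volume.restrict (cube a ℓ), w x ≤ ⨆ k, maxFn volume (gridFamily a ℓ k) w x := by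
  rw [ae_restrict_iff' (measurableSet_cube a ℓ)]
  filter_upwards [ae_tendsto_laverage_gridCube a hℓ hw hfin] with x hx hxQ
  refine le_of_tendsto (hx hxQ) (Eventually.of_forall fun j => ?_)
  have hmem : gridCube a ℓ j (gridIndex a ℓ j x) ∈ gridFamily a ℓ j :=
    mem_gridFamily.2 ⟨j, le_rfl, _, gridIndex_lt hℓ j hxQ, rfl⟩
  exact (laverage_le_maxFn w hmem (mem_gridCube_gridIndex hℓ j hxQ)).trans
    (le_iSup (fun k => maxFn volume (gridFamily a ℓ k) w x) j)

theorem SqrtReverseHolder.setLIntegral_rpow_le (hK : SqrtReverseHolder w K)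
    (hw : AEMeasurable w volume) (hd : 0 < d) (hℓ : 0 < ℓ) (hfin : ∫⁻ x in cube a ℓ, w x ≠ ∞)
    {ε : ℝ} (hε : 0 < ε) (hεK : 16 * 2 ^ d * K * ε ≤ 1) :
    ∫⁻ x in cube a ℓ, w x ^ (1 + ε) ≤
      2 * ((⨍⁻ x in cube a ℓ, w x ∂volume) ^ ε * ∫⁻ x in cube a ℓ, w x) := by
  calc ∫⁻ x in cube a ℓ, w x ^ (1 + ε)
      ≤ ∫⁻ x in cube a ℓ, ⨆ k, w x * maxFn volume (gridFamily a ℓ k) w x ^ ε := by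
        refine lintegral_mono_ae ?_
        filter_upwards [ae_le_iSup_maxFn_gridFamily hℓ hw hfin] with x hx
        rw [ENNReal.rpow_add_of_nonneg _ _ zero_le_one hε.le, ENNReal.rpow_one, ← ENNReal.mul_iSup]
        gcongr
        exact (ENNReal.rpow_le_rpow hx hε.le).trans
          ((ENNReal.orderIsoRpow ε hε).map_iSup _).le
    _ = ⨆ k, ∫⁻ x in cube a ℓ, w x * maxFn volume (gridFamily a ℓ k) w x ^ ε := by
        refine lintegral_iSup' (fun k => ?_) (Eventually.of_forall fun x k k' hk => ?_)
        · exact hw.restrict.mul ((measurable_maxFn_gridFamily hℓ k).pow_const _).aemeasurable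
        · exact mul_le_mul' le_rfl (ENNReal.rpow_le_rpow (monotone_maxFn_gridFamily hk x) hε.le)
    _ ≤ 2 * ((⨍⁻ x in cube a ℓ, w x ∂volume) ^ ε * ∫⁻ x in cube a ℓ, w x) :=
        iSup_le fun k => hK.setLIntegral_mul_maxFn_gridFamily_rpow_le hw hd hℓ hfin hε hεK k

theorem SqrtReverseHolder.laverage_rpow_le (hK : SqrtReverseHolder w K)
    (hw : AEMeasurable w volume) (hd : 0 < d) {Q : Set (Fin d → ℝ)} (hQ : Q ∈ cubes d)
    (hfin : ∫⁻ x in Q, w x ≠ ∞) {ε : ℝ} (hε : 0 < ε) (hεK : 16 * 2 ^ d * K * ε ≤ 1) :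
    ⨍⁻ x in Q, w x ^ (1 + ε) ∂volume ≤ 2 * (⨍⁻ x in Q, w x ∂volume) ^ (1 + ε) := by
  obtain ⟨a, ℓ, hℓ, rfl⟩ := hQ
  calc ⨍⁻ x in cube a ℓ, w x ^ (1 + ε) ∂volume
      ≤ (2 * ((⨍⁻ x in cube a ℓ, w x ∂volume) ^ ε * ∫⁻ x in cube a ℓ, w x)) /
          volume (cube a ℓ) := by
        rw [setLAverage_eq]
        gcongr
        exact hK.setLIntegral_rpow_le hw hd hℓ hfin hε hεK
    _ = 2 * ((⨍⁻ x in cube a ℓ, w x ∂volume) ^ ε * ⨍⁻ x in cube a ℓ, w x ∂volume) := by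
        rw [setLAverage_eq volume w, mul_div_assoc, mul_div_assoc]
    _ = 2 * (⨍⁻ x in cube a ℓ, w x ∂volume) ^ (1 + ε) := by
        rw [ENNReal.rpow_add_of_nonneg _ _ zero_le_one hε.le, ENNReal.rpow_one, mul_comm (_ ^ ε)]

end ReverseHolder

section Bump

variable {d : ℕ}

theorem laverage_mul_rpow_le {Q : Set (Fin d → ℝ)} {a u v : ℝ} (h : u.HolderTriple v a)
    {f g : (Fin d → ℝ) → ℝ≥0∞} (hf : AEMeasurable f volume) (hg : AEMeasurable g volume) :
    (⨍⁻ x in Q, (f x * g x) ^ a ∂volume) ^ (1 / a) ≤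
      (⨍⁻ x in Q, f x ^ u ∂volume) ^ (1 / u) * (⨍⁻ x in Q, g x ^ v ∂volume) ^ (1 / v) :=
  ENNReal.lintegral_Lp_mul_le_Lq_mul_Lr h.pos' h.lt h.one_div_eq _
    (hf.restrict.smul_measure _) (hg.restrict.smul_measure _)

/-- The gain `ε` for which `SqrtReverseHolder.laverage_rpow_le` raises the integrability exponent
from `1` to `1 + ε`. -/
def reverseHolderGain (d : ℕ) (K : ℝ≥0) : ℝ :=
  1 / (16 * 2 ^ d * K)

theorem reverseHolderGain_pos {K : ℝ≥0} (hK : 1 ≤ K) : 0 < reverseHolderGain d K := by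
  have : (0 : ℝ) < K := zero_lt_one.trans_le hK
  unfold reverseHolderGain
  positivity

theorem mul_reverseHolderGain {K : ℝ≥0} (hK : 1 ≤ K) :
    16 * 2 ^ d * K * reverseHolderGain d K = 1 := by
  have : (0 : ℝ) < K := zero_lt_one.trans_le hK
  exact mul_one_div_cancel (by positivity)

theorem reverseHolderGain_le_one {K : ℝ≥0} (hK : 1 ≤ K) : reverseHolderGain d K ≤ 1 := by
  have hK' : (1 : ℝ) ≤ K := hK
  have hd : (1 : ℝ) ≤ 2 ^ d := one_le_pow₀ one_le_two
  rw [reverseHolderGain, div_le_one (by positivity)]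
  nlinarith [hK']

/-- The Hölder exponent that remains for the other factor when a weight in `L^m` is replaced by one
in `L^{m (1 + ε)}`: if `1 / a = 1 / m + 1 / b`, then it lies in `[a, b)`. -/
def bumpExponent (d : ℕ) (K : ℝ≥0) (a m : ℝ) : ℝ :=
  (a⁻¹ - (m * (1 + reverseHolderGain d K))⁻¹)⁻¹

variable {a b m : ℝ} {K : ℝ≥0}

theorem lt_mul_one_add_reverseHolderGain (hm : 0 < m) (hK : 1 ≤ K) :
    m < m * (1 + reverseHolderGain d K) :=
  lt_mul_of_one_lt_right hm (lt_add_of_pos_right 1 (reverseHolderGain_pos hK))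

theorem inv_lt_inv_bumpExponent (h : m.HolderTriple b a) (hK : 1 ≤ K) :
    b⁻¹ < (bumpExponent d K a m)⁻¹ := by
  rw [bumpExponent, inv_inv, ← h.symm.inv_sub_inv_eq_inv]
  exact sub_lt_sub_left (inv_strictAnti₀ h.pos (lt_mul_one_add_reverseHolderGain h.pos hK)) _

theorem bumpExponent_pos (h : m.HolderTriple b a) (hK : 1 ≤ K) : 0 < bumpExponent d K a m :=
  inv_pos.1 (h.symm.inv_pos.trans (inv_lt_inv_bumpExponent h hK))

theorem bumpExponent_lt (h : m.HolderTriple b a) (hK : 1 ≤ K) : bumpExponent d K a m < b :=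
  (inv_lt_inv₀ h.symm.pos (bumpExponent_pos h hK)).1 (inv_lt_inv_bumpExponent h hK)

theorem holderTriple_bumpExponent (h : m.HolderTriple b a) (hK : 1 ≤ K) :
    (m * (1 + reverseHolderGain d K)).HolderTriple (bumpExponent d K a m) a where
  inv_add_inv_eq_inv := by rw [bumpExponent, inv_inv, add_sub_cancel]
  left_pos := h.pos.trans (lt_mul_one_add_reverseHolderGain h.pos hK)
  right_pos := bumpExponent_pos h hK

theorem inv_one_sub_bumpExponent_div_le (ha : 1 ≤ a) (h : m.HolderTriple b a) (hK : 1 ≤ K) :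
    (1 - bumpExponent d K a m / b)⁻¹ ≤ 2 * m * (16 * 2 ^ d) * K := by
  have hm := h.pos
  have hb := h.symm.pos
  have : (0 : ℝ) < K := zero_lt_one.trans_le hK
  set ε := reverseHolderGain d K with hε
  set κ := bumpExponent d K a m
  have hε0 : 0 < ε := reverseHolderGain_pos hK
  have hκ0 : 0 < κ := bumpExponent_pos h hK
  have hκ1 : 1 ≤ κ := ha.trans (holderTriple_bumpExponent (d := d) h hK).symm.lt.le
  have gap_eq : 1 - κ / b = κ * (ε / (m * (1 + ε))) := by
    have hκ_inv : κ⁻¹ = m⁻¹ + b⁻¹ - (m * (1 + ε))⁻¹ := by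
      rw [h.inv_add_inv_eq_inv, ← (holderTriple_bumpExponent h hK).symm.inv_sub_inv_eq_inv]
    calc 1 - κ / b = κ * (κ⁻¹ - b⁻¹) := by field_simp
      _ = κ * (ε / (m * (1 + ε))) := by
          rw [hκ_inv]
          field_simp
          ring
  refine inv_le_of_inv_le₀ (by positivity) ?_
  calc (2 * m * (16 * 2 ^ d) * K)⁻¹ = 1 * (ε / (m * 2)) := by
        rw [hε, reverseHolderGain]
        field_simp
    _ ≤ κ * (ε / (m * (1 + ε))) := by
        gcongr
        linarith [reverseHolderGain_le_one (d := d) hK]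
    _ = 1 - κ / b := gap_eq.symm

theorem exists_lintegral_maxFn_bumpExponent_le (d : ℕ) (ha : 1 ≤ a) (h : m.HolderTriple b a) :
    ∃ C : ℝ≥0, ∀ K : ℝ≥0, 1 ≤ K →
      ∀ (𝒮 : Finset (Set (Fin d → ℝ))) (f : (Fin d → ℝ) → ℝ≥0∞),
        IsLaminar volume (𝒮 : Set (Set (Fin d → ℝ))) → AEMeasurable f volume →
        ∫⁻ x, maxFn volume 𝒮 (fun y => f y ^ bumpExponent d K a m) x ^ (b / bumpExponent d K a m) ≤
          C * K * ∫⁻ x, f x ^ b := by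
  refine ⟨Real.toNNReal (2 ^ b * (2 * m * (16 * 2 ^ d))), fun K hK 𝒮 f h𝒮 hf => ?_⟩
  set κ := bumpExponent d K a m
  have hm := h.pos
  have hb := h.symm.pos
  have hκ0 : 0 < κ := bumpExponent_pos h hK
  have hκb : κ < b := bumpExponent_lt h hK
  have rpow_eq : ∀ x, (f x ^ κ) ^ (b / κ) = f x ^ b := fun x => by
    rw [← ENNReal.rpow_mul, mul_div_cancel₀ b hκ0.ne']
  have const_le : (2 : ℝ) ^ (b / κ) * (b / κ / (b / κ - 1)) ≤
      2 ^ b * (2 * m * (16 * 2 ^ d)) * K := by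
    have hκ1 : 1 ≤ κ := ha.trans (holderTriple_bumpExponent (d := d) h hK).symm.lt.le
    have ratio_eq : b / κ / (b / κ - 1) = (1 - κ / b)⁻¹ := by
      field_simp
    rw [ratio_eq, mul_assoc (2 ^ b)]
    gcongr
    · exact inv_nonneg.2 (sub_nonneg.2 ((div_le_one hb).2 hκb.le))
    · exact one_le_two
    · exact div_le_self hb.le hκ1
    · exact inv_one_sub_bumpExponent_div_le ha h hK
  refine (h𝒮.lintegral_maxFn_rpow_le (hf.pow_const κ) ((one_lt_div hκ0).2 hκb)).trans ?_
  simp_rw [rpow_eq]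
  gcongr
  refine (ENNReal.ofReal_le_ofReal const_le).trans_eq ?_
  rw [ENNReal.ofReal_mul (by positivity), ENNReal.ofReal_coe_nnreal, ENNReal.ofReal]

theorem SqrtReverseHolder.laverage_mul_rpow_le_bumpExponent (hd : 0 < d)
    {ω : (Fin d → ℝ) → ℝ≥0∞} (hK : 1 ≤ K) (hω_rh : SqrtReverseHolder (fun x => ω x ^ m) K)
    (ha : 1 ≤ a) (h : m.HolderTriple b a) (hω : AEMeasurable ω volume)
    {Q : Set (Fin d → ℝ)} (hQ : Q ∈ cubes d)
    (hfin : ∫⁻ x in Q, ω x ^ m ≠ ∞) {f : (Fin d → ℝ) → ℝ≥0∞} (hf : AEMeasurable f volume) :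
    (⨍⁻ x in Q, (ω x * f x) ^ a ∂volume) ^ (1 / a) ≤
      2 * (⨍⁻ x in Q, ω x ^ m ∂volume) ^ (1 / m) *
        (⨍⁻ x in Q, f x ^ bumpExponent d K a m ∂volume) ^ (1 / bumpExponent d K a m) := by
  set ε := reverseHolderGain d K
  have hm := h.pos
  have hε : 0 < ε := reverseHolderGain_pos hK
  have hmε : 0 < m * (1 + ε) := by positivity
  have gain := hω_rh.laverage_rpow_le (hω.pow_const m) hd hQ hfin hε (mul_reverseHolderGain hK).le
  simp only [← ENNReal.rpow_mul] at gain
  refine (laverage_mul_rpow_le (holderTriple_bumpExponent (d := d) h hK) hω hf).trans ?_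
  gcongr
  calc (⨍⁻ x in Q, ω x ^ (m * (1 + ε)) ∂volume) ^ (1 / (m * (1 + ε)))
      ≤ (2 * (⨍⁻ x in Q, ω x ^ m ∂volume) ^ (1 + ε)) ^ (1 / (m * (1 + ε))) := by gcongr
    _ = 2 ^ (1 / (m * (1 + ε))) * (⨍⁻ x in Q, ω x ^ m ∂volume) ^ (1 / m) := by
        rw [ENNReal.mul_rpow_of_nonneg _ _ (by positivity), ← ENNReal.rpow_mul]
        congr 2
        field_simp
    _ ≤ 2 ^ (1 : ℝ) * (⨍⁻ x in Q, ω x ^ m ∂volume) ^ (1 / m) := by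
        gcongr
        · exact one_le_two
        · rw [div_le_one hmε]
          exact ha.trans (h.lt.le.trans (lt_mul_one_add_reverseHolderGain hm hK).le)
    _ = 2 * (⨍⁻ x in Q, ω x ^ m ∂volume) ^ (1 / m) := by rw [ENNReal.rpow_one]

end Bump

/-! ### Powers of positive definite matrices -/

section MatPow

open Filter Topology Matrix

variable {n : ℕ} {A : Matrix (Fin n) (Fin n) ℝ}

theorem cfc_apply_eq_sum (hA : A.IsHermitian) (f : ℝ → ℝ) (i j : Fin n) :
    cfc f A i j =
      ∑ k, f (hA.eigenvalues k) * (hA.eigenvectorBasis k i * hA.eigenvectorBasis k j) := by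
  rw [hA.cfc_eq, IsHermitian.cfc, Unitary.conjStarAlgAut_apply, Matrix.mul_apply]
  refine Finset.sum_congr rfl fun k _ => ?_
  rw [Matrix.mul_diagonal, Matrix.star_apply, IsHermitian.eigenvectorUnitary_apply,
    IsHermitian.eigenvectorUnitary_apply, RCLike.ofReal_real_eq_id, Function.id_comp,
    Function.comp_apply, star_trivial]
  ring

theorem matPow_mul_matPow (hA : A.PosDef) (α β : ℝ) :
    matPow A α * matPow A β = matPow A (α + β) := by
  rw [matPow, matPow, ← cfc_mul _ _ A (A.finite_real_spectrum.continuousOn _)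
    (A.finite_real_spectrum.continuousOn _)]
  refine cfc_congr fun x hx => (Real.rpow_add ?_ α β).symm
  rw [hA.1.spectrum_real_eq_range_eigenvalues] at hx
  obtain ⟨k, rfl⟩ := hx
  exact hA.eigenvalues_pos k

theorem matPow_zero (hA : A.IsHermitian) : matPow A 0 = 1 := by
  simp only [matPow, Real.rpow_zero]
  exact cfc_const_one ℝ A hA

theorem matPow_neg_mul_matPow (hA : A.PosDef) (α : ℝ) : matPow A (-α) * matPow A α = 1 := by
  rw [matPow_mul_matPow hA, neg_add_cancel, matPow_zero hA.1]

theorem matPow_symm (A : Matrix (Fin n) (Fin n) ℝ) (α : ℝ) (i j : Fin n) :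
    matPow A α i j = matPow A α j i :=
  IsHermitian.apply (cfc_predicate (fun x : ℝ => x ^ α) A) j i

theorem toEuclideanCLM_apply_apply (M : Matrix (Fin n) (Fin n) ℝ) (e : EuclideanSpace ℝ (Fin n))
    (i : Fin n) : toEuclideanCLM (n := Fin n) (𝕜 := ℝ) M e i = ∑ j, M i j * e j := by
  rw [ofLp_toEuclideanCLM]
  rfl

theorem toEuclideanCLM_matPow (hA : A.IsHermitian) (α : ℝ) (e : EuclideanSpace ℝ (Fin n)) :
    toEuclideanCLM (n := Fin n) (𝕜 := ℝ) (matPow A α) e =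
      ∑ k, (hA.eigenvalues k ^ α * inner ℝ (hA.eigenvectorBasis k) e) •
        hA.eigenvectorBasis k := by
  ext i
  rw [toEuclideanCLM_apply_apply]
  simp only [matPow, cfc_apply_eq_sum hA, Finset.sum_mul, WithLp.ofLp_sum, WithLp.ofLp_smul,
    Finset.sum_apply, Pi.smul_apply, smul_eq_mul, PiLp.inner_apply, Finset.mul_sum,
    RCLike.inner_apply, conj_trivial]
  rw [Finset.sum_comm]
  refine Finset.sum_congr rfl fun k _ => Finset.sum_congr rfl fun j _ => ?_
  ring

theorem norm_toEuclideanCLM_matPow_sq (hA : A.IsHermitian) (α : ℝ)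
    (e : EuclideanSpace ℝ (Fin n)) :
    ‖toEuclideanCLM (n := Fin n) (𝕜 := ℝ) (matPow A α) e‖ ^ 2 =
      ∑ k, inner ℝ (hA.eigenvectorBasis k) e ^ 2 * (hA.eigenvalues k ^ α) ^ 2 := by
  rw [toEuclideanCLM_matPow hA, ← real_inner_self_eq_norm_sq,
    hA.eigenvectorBasis.orthonormal.inner_sum]
  refine Finset.sum_congr rfl fun k _ => ?_
  rw [conj_trivial]
  ring

theorem norm_toEuclideanCLM_matPow_mul_sq_le (hA : A.PosDef) (α : ℝ) {θ : ℝ} (hθ0 : 0 ≤ θ)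
    (hθ : θ ≤ 1) {e : EuclideanSpace ℝ (Fin n)} (he : ‖e‖ = 1) :
    ‖toEuclideanCLM (n := Fin n) (𝕜 := ℝ) (matPow A (α * θ)) e‖ ^ 2 ≤
      (‖toEuclideanCLM (n := Fin n) (𝕜 := ℝ) (matPow A α) e‖ ^ 2) ^ θ := by
  have sum_weights : ∑ k, inner ℝ (hA.1.eigenvectorBasis k) e ^ 2 = 1 := by
    rw [hA.1.eigenvectorBasis.sum_sq_inner_right, he, one_pow]
  have rpow_eq : ∀ k, (hA.1.eigenvalues k ^ (α * θ)) ^ 2 =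
      ((hA.1.eigenvalues k ^ α) ^ 2) ^ θ := fun k => by
    rw [Real.rpow_mul (hA.eigenvalues_pos k).le, Real.rpow_pow_comm]
    exact Real.rpow_nonneg (hA.eigenvalues_pos k).le _
  rw [norm_toEuclideanCLM_matPow_sq hA.1, norm_toEuclideanCLM_matPow_sq hA.1]
  simp only [rpow_eq]
  exact (Real.concaveOn_rpow hθ0 hθ).le_map_sum (fun _ _ => sq_nonneg _) sum_weights
    fun _ _ => Set.mem_Ici.2 (sq_nonneg _)

theorem normMulVec_matPow_mul_le (hA : A.PosDef) (α : ℝ) {θ : ℝ} (hθ0 : 0 ≤ θ) (hθ : θ ≤ 1)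
    {e : EuclideanSpace ℝ (Fin n)} (he : ‖e‖ = 1) :
    normMulVec (matPow A (α * θ)) e ≤ normMulVec (matPow A α) e ^ θ := by
  rw [normMulVec, normMulVec, ← ofReal_norm, ← ofReal_norm,
    ENNReal.ofReal_rpow_of_nonneg (norm_nonneg _) hθ0]
  refine ENNReal.ofReal_le_ofReal (abs_le_of_sq_le_sq' ?_ (by positivity)).2
  rw [Real.rpow_pow_comm (norm_nonneg _)]
  exact norm_toEuclideanCLM_matPow_mul_sq_le hA α hθ0 hθ he

theorem normMulVec_ne_top (M : Matrix (Fin n) (Fin n) ℝ) (e : EuclideanSpace ℝ (Fin n)) :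
    normMulVec M e ≠ ∞ :=
  enorm_ne_top

theorem normMulVec_mul_le (M N : Matrix (Fin n) (Fin n) ℝ) (e : EuclideanSpace ℝ (Fin n)) :
    normMulVec (M * N) e ≤ opNorm M * normMulVec N e := by
  rw [normMulVec, map_mul, mul_apply_eq_comp]
  exact ContinuousLinearMap.le_opENorm _ _

theorem normMulVec_le_opNorm_mul (hA : A.PosDef) (α : ℝ) (M : Matrix (Fin n) (Fin n) ℝ)
    (e : EuclideanSpace ℝ (Fin n)) :
    normMulVec M e ≤ opNorm (M * matPow A (-α)) * normMulVec (matPow A α) e := by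
  calc normMulVec M e = normMulVec (M * matPow A (-α) * matPow A α) e := by
        rw [mul_assoc, matPow_neg_mul_matPow hA, mul_one]
    _ ≤ opNorm (M * matPow A (-α)) * normMulVec (matPow A α) e := normMulVec_mul_le _ _ _

theorem normMulVec_one (e : EuclideanSpace ℝ (Fin n)) : normMulVec 1 e = ‖e‖ₑ := by
  rw [normMulVec, map_one, one_apply_eq_self]

theorem normMulVec_matPow_ne_zero (hA : A.PosDef) (α : ℝ) {e : EuclideanSpace ℝ (Fin n)}
    (he : e ≠ 0) : normMulVec (matPow A α) e ≠ 0 := by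
  intro h
  have e_le := normMulVec_le_opNorm_mul hA α 1 e
  rw [h, mul_zero, normMulVec_one, nonpos_iff_eq_zero, enorm_eq_zero] at e_le
  exact he e_le

theorem exists_polynomial_seq_tendsto_rpow (α : ℝ) : ∃ P : ℕ → Polynomial ℝ, ∀ x : ℝ, 0 < x →
    Tendsto (fun m => (P m).eval x) atTop (𝓝 (x ^ α)) := by
  have exists_near : ∀ m : ℕ, ∃ P : Polynomial ℝ,
      ∀ x ∈ Set.Icc (1 / ((m : ℝ) + 1)) (m + 1), |P.eval x - x ^ α| < 1 / ((m : ℝ) + 1) := by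
    refine fun m => exists_polynomial_near_of_continuousOn _ _ (fun x => x ^ α) ?_ _ (by positivity)
    refine fun x hx => (Real.continuousAt_rpow_const x α (Or.inl ?_)).continuousWithinAt
    have : 0 < 1 / ((m : ℝ) + 1) := by positivity
    exact (this.trans_le hx.1).ne'
  choose P hP using exists_near
  refine ⟨P, fun x hx => tendsto_iff_dist_tendsto_zero.2 ?_⟩
  have inv_tendsto := tendsto_one_div_add_atTop_nhds_zero_nat (𝕜 := ℝ)
  refine squeeze_zero' (Eventually.of_forall fun _ => dist_nonneg) ?_ inv_tendsto
  filter_upwards [inv_tendsto.eventually (gt_mem_nhds hx), eventually_ge_atTop ⌈x⌉₊] with m hm hxm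
  exact (hP m x ⟨hm.le, (Nat.le_of_ceil_le hxm).trans (lt_add_one _).le⟩).le

section Measurability

variable {X : Type*} [MeasurableSpace X] {μ : Measure X}

theorem aemeasurable_aeval {W : X → Matrix (Fin n) (Fin n) ℝ}
    (hW : ∀ i j, AEMeasurable (fun x => W x i j) μ) (P : Polynomial ℝ) (i j : Fin n) :
    AEMeasurable (fun x => Polynomial.aeval (W x) P i j) μ := by
  have eval_continuous : Continuous fun M : Fin n → Fin n → ℝ =>
      Polynomial.aeval (Matrix.of M) P i j :=
    Continuous.matrix_elem (Polynomial.continuous_aeval (A := Matrix (Fin n) (Fin n) ℝ) P) i j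
  exact eval_continuous.measurable.comp_aemeasurable
    (aemeasurable_pi_lambda _ fun i => aemeasurable_pi_lambda _ fun j => hW i j)

theorem aemeasurable_matPow {W : X → Matrix (Fin n) (Fin n) ℝ}
    (hW : ∀ i j, AEMeasurable (fun x => W x i j) μ) (hpos : ∀ᵐ x ∂μ, (W x).PosDef) (α : ℝ)
    (i j : Fin n) : AEMeasurable (fun x => matPow (W x) α i j) μ := by
  obtain ⟨P, hP⟩ := exists_polynomial_seq_tendsto_rpow α
  refine aemeasurable_of_tendsto_metrizable_ae atTop
    (fun m => aemeasurable_aeval hW (P m) i j) ?_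
  filter_upwards [hpos] with x hx
  have aeval_eq : ∀ m, Polynomial.aeval (W x) (P m) i j =
      ∑ k, (P m).eval (hx.1.eigenvalues k) *
        (hx.1.eigenvectorBasis k i * hx.1.eigenvectorBasis k j) := fun m => by
    rw [← cfc_apply_eq_sum hx.1 fun y => (P m).eval y]
    exact congrFun₂ (cfc_polynomial (P m) (W x) hx.1).symm i j
  simp only [aeval_eq, matPow, cfc_apply_eq_sum hx.1]
  exact tendsto_finsetSum _ fun k _ => (hP _ (hx.eigenvalues_pos k)).mul_const _

theorem aemeasurable_normMulVec {M : X → Matrix (Fin n) (Fin n) ℝ}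
    (hM : ∀ i j, AEMeasurable (fun x => M x i j) μ) (e : EuclideanSpace ℝ (Fin n)) :
    AEMeasurable (fun x => normMulVec (M x) e) μ := by
  have normMulVec_eq : ∀ x, normMulVec (M x) e =
      ENNReal.ofReal √(∑ i, (∑ j, M x i j * e j) ^ 2) := fun x => by
    rw [normMulVec, ← ofReal_norm, EuclideanSpace.norm_eq]
    simp only [toEuclideanCLM_apply_apply, Real.norm_eq_abs, sq_abs]
  simp only [normMulVec_eq]
  refine ENNReal.measurable_ofReal.comp_aemeasurable (AEMeasurable.sqrt ?_)
  exact Finset.aemeasurable_fun_sum _ fun i _ =>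
    (Finset.aemeasurable_fun_sum _ fun j _ => (hM i j).mul_const _).pow_const 2

end Measurability

section Vector

variable {B : Type*} [NormedAddCommGroup B] [NormedSpace ℝ B]

theorem norm_sum_smul_le (c : EuclideanSpace ℝ (Fin n)) (v : PiLp 2 fun _ : Fin n => B) :
    ‖∑ j, c j • v j‖ ≤ ‖c‖ * ‖v‖ := by
  calc ‖∑ j, c j • v j‖ ≤ ∑ j, ‖c j • v j‖ := norm_sum_le _ _
    _ = ∑ j, ‖c j‖ * ‖v j‖ := by simp only [norm_smul]
    _ ≤ √(∑ j, ‖c j‖ ^ 2) * √(∑ j, ‖v j‖ ^ 2) := Real.sum_mul_le_sqrt_mul_sqrt _ _ _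
    _ = ‖c‖ * ‖v‖ := by rw [EuclideanSpace.norm_eq, PiLp.norm_eq_of_L2]

theorem sum_toEuclideanCLM_smul_matAct (M N : Matrix (Fin n) (Fin n) ℝ)
    (e : EuclideanSpace ℝ (Fin n)) (v : Fin n → B) :
    ∑ j, toEuclideanCLM (n := Fin n) (𝕜 := ℝ) M e j • matAct N v j =
      ∑ k, ∑ l, ((Mᵀ * N) l k * e l) • v k := by
  simp only [toEuclideanCLM_apply_apply, matAct, Finset.smul_sum, Matrix.mul_apply,
    Matrix.transpose_apply, Finset.sum_mul, Finset.sum_smul]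
  rw [Finset.sum_comm]
  refine Finset.sum_congr rfl fun k _ => ?_
  rw [Finset.sum_comm]
  refine Finset.sum_congr rfl fun l _ => Finset.sum_congr rfl fun j _ => ?_
  rw [smul_smul, mul_right_comm]

theorem sum_smul_eq_sum_matPow_smul (hA : A.PosDef) (α : ℝ) (e : EuclideanSpace ℝ (Fin n))
    (v : Fin n → B) :
    ∑ j, e j • v j =
      ∑ j, toEuclideanCLM (n := Fin n) (𝕜 := ℝ) (matPow A (-α)) e j •
        matAct (matPow A α) v j := by
  have transpose_eq : (matPow A (-α))ᵀ = matPow A (-α) := by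
    ext i j
    exact matPow_symm A (-α) j i
  rw [sum_toEuclideanCLM_smul_matAct, transpose_eq, matPow_neg_mul_matPow hA]
  refine Finset.sum_congr rfl fun k _ => ?_
  simp only [Matrix.one_apply, ite_mul, one_mul, zero_mul, ite_smul, zero_smul,
    Finset.sum_ite_eq', Finset.mem_univ, if_true]

theorem enorm_sum_smul_le (hA : A.PosDef) (α : ℝ) (e : EuclideanSpace ℝ (Fin n))
    (v : Fin n → B) :
    ‖∑ j, e j • v j‖ₑ ≤ normMulVec (matPow A (-α)) e * ‖matAct (matPow A α) v‖ₑ := by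
  rw [sum_smul_eq_sum_matPow_smul hA α, normMulVec, ← ofReal_norm, ← ofReal_norm, ← ofReal_norm,
    ← ENNReal.ofReal_mul (norm_nonneg _)]
  exact ENNReal.ofReal_le_ofReal (norm_sum_smul_le _ _)

end Vector

end MatPow

/-! ### Orthonormal bases adapted to a seminorm -/

section Basis

theorem exists_norm_eq_one_forall_mul_norm_le {E : Type*} [NormedAddCommGroup E]
    [NormedSpace ℝ E] [FiniteDimensional ℝ E] [Nontrivial E] (ρ : Seminorm ℝ E) :
    ∃ e : E, ‖e‖ = 1 ∧ ∀ z, ρ e * ‖z‖ ≤ ρ z := by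
  have := FiniteDimensional.proper_real E
  have continuous : ContinuousOn ρ Set.univ := ρ.convexOn.continuousOn isOpen_univ
  obtain ⟨e, he, isMin⟩ := (isCompact_sphere (0 : E) 1).exists_isMinOn
    (NormedSpace.sphere_nonempty.2 zero_le_one) (continuous.mono (Set.subset_univ _))
  refine ⟨e, mem_sphere_zero_iff_norm.1 he, fun z => ?_⟩
  rcases eq_or_ne z 0 with rfl | hz
  · rw [norm_zero, mul_zero, map_zero]
  have hz' : 0 < ‖z‖ := norm_pos_iff.2 hz
  have normalized_mem : ‖z‖⁻¹ • z ∈ Metric.sphere (0 : E) 1 := by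
    rw [mem_sphere_zero_iff_norm, norm_smul, norm_inv, norm_norm, inv_mul_cancel₀ hz'.ne']
  have min_le : ρ e ≤ ρ (‖z‖⁻¹ • z) := isMin normalized_mem
  rwa [map_smul_eq_mul, norm_inv, norm_norm, ← div_eq_inv_mul, le_div_iff₀ hz'] at min_le

variable {E : Type*} [NormedAddCommGroup E] [InnerProductSpace ℝ E]

theorem orthonormal_cons_of_mem_orthogonal {n : ℕ} {e : E} (he : ‖e‖ = 1)
    {v : Fin n → (ℝ ∙ e)ᗮ} (hv : Orthonormal ℝ v) :
    Orthonormal ℝ (Fin.cons e fun i => (v i : E) : Fin (n + 1) → E) := by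
  refine orthonormal_vecCons_iff.2 ⟨he, fun i => ?_, ?_⟩
  · exact Submodule.mem_orthogonal_singleton_iff_inner_right.1 (v i).2
  · exact hv.comp_linearIsometry (ℝ ∙ e)ᗮ.subtypeₗᵢ

theorem abs_inner_mul_seminorm_le {ρ : Seminorm ℝ E} {e : E} (he : ‖e‖ = 1)
    (hρ : ∀ z, ρ e * ‖z‖ ≤ ρ z) (z : E) : |inner ℝ e z| * ρ e ≤ ρ z := by
  calc |inner ℝ e z| * ρ e ≤ ‖e‖ * ‖z‖ * ρ e := by
        gcongr
        exact abs_real_inner_le_norm e z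
    _ = ρ e * ‖z‖ := by rw [he, one_mul, mul_comm]
    _ ≤ ρ z := hρ z

theorem seminorm_sub_inner_smul_le {ρ : Seminorm ℝ E} {e : E} (he : ‖e‖ = 1)
    (hρ : ∀ z, ρ e * ‖z‖ ≤ ρ z) (z : E) : ρ (z - inner ℝ e z • e) ≤ 2 * ρ z := by
  calc ρ (z - inner ℝ e z • e) ≤ ρ z + ρ (inner ℝ e z • e) := map_sub_le_add ρ _ _
    _ = ρ z + |inner ℝ e z| * ρ e := by rw [map_smul_eq_mul, Real.norm_eq_abs]
    _ ≤ 2 * ρ z := by linarith [abs_inner_mul_seminorm_le he hρ z]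

/- The first vector minimizes `ρ` on the unit sphere, the others come from its orthogonal
complement; projecting to the complement costs a factor `2`. -/
theorem exists_orthonormal_abs_inner_mul_le (n : ℕ) : ∀ {E : Type*} [NormedAddCommGroup E]
    [InnerProductSpace ℝ E] [FiniteDimensional ℝ E], Module.finrank ℝ E = n →
    ∀ ρ : Seminorm ℝ E, ∃ v : Fin n → E, Orthonormal ℝ v ∧
      ∀ i z, |inner ℝ (v i) z| * ρ (v i) ≤ 2 ^ n * ρ z := by
  induction n with
  | zero =>
    intro E _ _ _ _ ρ
    exact ⟨Fin.elim0, ⟨fun i => i.elim0, fun i => i.elim0⟩, fun i => i.elim0⟩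
  | succ n ih =>
    intro E _ _ _ hE ρ
    have : Nontrivial E := Module.nontrivial_of_finrank_pos (R := ℝ) (hE ▸ n.succ_pos)
    obtain ⟨e, he, hρe⟩ := exists_norm_eq_one_forall_mul_norm_le ρ
    have finrank_complement : Module.finrank ℝ (ℝ ∙ e)ᗮ = n := by
      have := Fact.mk hE
      exact Submodule.finrank_orthogonal_span_singleton (norm_ne_zero_iff.1 (he ▸ one_ne_zero))
    obtain ⟨v, hv, hvρ⟩ := ih finrank_complement (ρ.comp (ℝ ∙ e)ᗮ.subtype)
    refine ⟨Fin.cons e fun i => (v i : E), orthonormal_cons_of_mem_orthogonal he hv,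
      Fin.cases (fun z => ?_) fun i z => ?_⟩
    · exact (abs_inner_mul_seminorm_le he hρe z).trans
        (le_mul_of_one_le_left (apply_nonneg ρ z) (one_le_pow₀ one_le_two))
    · rw [Fin.cons_succ]
      have projection_mem : z - inner ℝ e z • e ∈ (ℝ ∙ e)ᗮ := by
        rw [Submodule.mem_orthogonal_singleton_iff_inner_right, inner_sub_right, inner_smul_right,
          real_inner_self_eq_norm_sq, he, one_pow, mul_one, sub_self]
      have inner_projection :
          inner ℝ (v i) ⟨z - inner ℝ e z • e, projection_mem⟩ = inner ℝ (v i : E) z := by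
        rw [Submodule.coe_inner, inner_sub_right, inner_smul_right,
          Submodule.mem_orthogonal_singleton_iff_inner_left.1 (v i).2, mul_zero, sub_zero]
      calc |inner ℝ (v i : E) z| * ρ (v i) ≤ 2 ^ n * ρ (z - inner ℝ e z • e) := by
            rw [← inner_projection]
            exact hvρ i ⟨z - inner ℝ e z • e, projection_mem⟩
        _ ≤ 2 ^ n * (2 * ρ z) := by
            gcongr
            exact seminorm_sub_inner_smul_le he hρe z
        _ = 2 ^ (n + 1) * ρ z := by ring

theorem exists_orthonormalBasis_enorm_inner_mul_le {n : ℕ}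
    (N : EuclideanSpace ℝ (Fin n) → ℝ≥0∞) (htop : ∀ z, N z ≠ ∞)
    (hadd : ∀ z z', N (z + z') ≤ N z + N z') (hsmul : ∀ (c : ℝ) z, N (c • z) = ‖c‖ₑ * N z) :
    ∃ e : OrthonormalBasis (Fin n) ℝ (EuclideanSpace ℝ (Fin n)),
      ∀ i z, ‖inner ℝ (e i) z‖ₑ * N (e i) ≤ 2 ^ n * N z := by
  let ρ : Seminorm ℝ (EuclideanSpace ℝ (Fin n)) := Seminorm.of (fun z => (N z).toReal)
    (fun z z' => by
      rw [← ENNReal.toReal_add (htop _) (htop _)]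
      exact ENNReal.toReal_mono (ENNReal.add_ne_top.2 ⟨htop _, htop _⟩) (hadd z z'))
    (fun c z => by rw [hsmul, ENNReal.toReal_mul, toReal_enorm])
  have ofReal_ρ : ∀ z, ENNReal.ofReal (ρ z) = N z := fun z => ENNReal.ofReal_toReal (htop z)
  obtain ⟨v, hv, hvρ⟩ := exists_orthonormal_abs_inner_mul_le n finrank_euclideanSpace_fin ρ
  have span_eq : Submodule.span ℝ (Set.range v) = ⊤ :=
    hv.linearIndependent.span_eq_top_of_card_eq_finrank'
      ((Fintype.card_fin n).trans finrank_euclideanSpace_fin.symm)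
  refine ⟨OrthonormalBasis.mk hv span_eq.ge, fun i z => ?_⟩
  have two_pow_eq : (2 : ℝ≥0∞) ^ n = ENNReal.ofReal (2 ^ n) := by
    rw [ENNReal.ofReal_pow zero_le_two, ENNReal.ofReal_ofNat]
  rw [OrthonormalBasis.coe_mk, ← ofReal_ρ, ← ofReal_ρ, ← ofReal_norm, Real.norm_eq_abs,
    ← ENNReal.ofReal_mul (abs_nonneg _), two_pow_eq, ← ENNReal.ofReal_mul (by positivity)]
  exact ENNReal.ofReal_le_ofReal (hvρ i z)

end Basis

/-! ### Averages -/

section Average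

variable {X : Type*} [MeasurableSpace X] {μ : Measure X}

theorem lintegral_rpow_mul_lintegral_rpow_le {u v : X → ℝ≥0∞} {κ : X → X → ℝ≥0∞}
    (h : ∀ᵐ x ∂μ, ∀ᵐ y ∂μ, u x * v y ≤ κ x y) {a b : ℝ} (ha : 0 < a) (hb : 0 < b) :
    (∫⁻ x, u x ^ a ∂μ) * (∫⁻ y, v y ^ b ∂μ) ^ (a / b) ≤
      ∫⁻ x, (∫⁻ y, κ x y ^ b ∂μ) ^ (a / b) ∂μ := by
  refine (lintegral_mul_const_le _ _).trans (lintegral_mono_ae (h.mono fun x hx => ?_))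
  calc u x ^ a * (∫⁻ y, v y ^ b ∂μ) ^ (a / b)
      = (u x ^ b * ∫⁻ y, v y ^ b ∂μ) ^ (a / b) := by
        rw [ENNReal.mul_rpow_of_nonneg _ _ (by positivity), ← ENNReal.rpow_mul,
          mul_div_cancel₀ _ hb.ne']
    _ ≤ (∫⁻ y, κ x y ^ b ∂μ) ^ (a / b) := by
        refine ENNReal.rpow_le_rpow ?_ (by positivity)
        refine (lintegral_const_mul_le _ _).trans (lintegral_mono_ae (hx.mono fun y hy => ?_))
        rw [← ENNReal.mul_rpow_of_nonneg _ _ hb.le]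
        exact ENNReal.rpow_le_rpow hy hb.le

theorem lintegral_ne_zero_of_ae [NeZero μ] {f : X → ℝ≥0∞} (hf : AEMeasurable f μ)
    (h : ∀ᵐ x ∂μ, f x ≠ 0) : ∫⁻ x, f x ∂μ ≠ 0 := by
  rw [Ne, lintegral_eq_zero_iff' hf]
  intro h0
  obtain ⟨x, hx, hx0⟩ := (h.and h0).exists
  exact hx hx0

variable [IsProbabilityMeasure μ]

theorem one_le_lintegral_rpow_neg_mul {v : X → ℝ≥0∞} (hv : AEMeasurable v μ)
    (h0 : ∀ᵐ x ∂μ, v x ≠ 0) (htop : ∀ᵐ x ∂μ, v x ≠ ∞) {α δ : ℝ} (hα : 0 < α) (hδ : 0 < δ) :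
    1 ≤ (∫⁻ x, v x ^ (-α) ∂μ) ^ (1 / α) * (∫⁻ x, v x ^ δ ∂μ) ^ (1 / δ) := by
  have p_lt : 1 / (1 / α + 1 / δ) < α := by
    rw [one_div_lt (by positivity) hα]
    exact lt_add_of_pos_right _ (by positivity)
  have holder := ENNReal.lintegral_Lp_mul_le_Lq_mul_Lr (p := 1 / (1 / α + 1 / δ)) (by positivity)
    p_lt (one_div_one_div _) μ hv.inv hv
  have inv_mul_eq_one : ∀ᵐ x ∂μ, (v⁻¹ * v) x ^ (1 / (1 / α + 1 / δ)) = 1 := by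
    filter_upwards [h0, htop] with x hx hx'
    rw [Pi.mul_apply, Pi.inv_apply, ENNReal.inv_mul_cancel hx hx', ENNReal.one_rpow]
  rw [lintegral_congr_ae inv_mul_eq_one, lintegral_one, measure_univ, ENNReal.one_rpow] at holder
  simpa only [Pi.inv_apply, ENNReal.inv_rpow, ← ENNReal.rpow_neg] using holder

theorem lintegral_rpow_half_sq_le {w : X → ℝ≥0∞} (hw : AEMeasurable w μ) :
    (∫⁻ x, w x ^ (1 / 2 : ℝ) ∂μ) ^ 2 ≤ ∫⁻ x, w x ∂μ := by
  have jensen := eLpNorm_le_eLpNorm_of_exponent_le (p := 1) (q := 2) one_le_two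
    (hw.pow_const (1 / 2 : ℝ)).aestronglyMeasurable
  rw [eLpNorm_one_eq_lintegral_enorm, eLpNorm_eq_lintegral_rpow_enorm_toReal two_ne_zero
    ENNReal.ofNat_ne_top, ENNReal.toReal_ofNat] at jensen
  simp only [enorm_eq_self, ← ENNReal.rpow_mul] at jensen
  norm_num at jensen
  calc (∫⁻ x, w x ^ (1 / 2 : ℝ) ∂μ) ^ 2 ≤ ((∫⁻ x, w x ∂μ) ^ (1 / 2 : ℝ)) ^ 2 := by
        gcongr
    _ = ∫⁻ x, w x ∂μ := by
        rw [← ENNReal.rpow_two, ← ENNReal.rpow_mul, one_div_mul_cancel two_ne_zero,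
          ENNReal.rpow_one]

variable {d : ℕ}

theorem laverage_eq_lintegral_avgMeasure (Q : Set (Fin d → ℝ)) (f : (Fin d → ℝ) → ℝ≥0∞) :
    ⨍⁻ x in Q, f x ∂volume = ∫⁻ x, f x ∂avgMeasure Q := by
  rw [laverage, avgMeasure, ProbabilityTheory.cond, Measure.restrict_apply_univ]

theorem isProbabilityMeasure_avgMeasure {Q : Set (Fin d → ℝ)} (hQ : Q ∈ cubes d) :
    IsProbabilityMeasure (avgMeasure Q) :=
  ProbabilityTheory.cond_isProbabilityMeasure_of_finite (volume_ne_zero_of_mem_cubes hQ)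
    (volume_ne_top_of_mem_cubes hQ)

theorem avgMeasure_absolutelyContinuous (Q : Set (Fin d → ℝ)) : avgMeasure Q ≪ volume :=
  ProbabilityTheory.cond_absolutelyContinuous

theorem setLIntegral_ne_top_of_lintegral_avgMeasure {Q : Set (Fin d → ℝ)} (hQ : Q ∈ cubes d)
    {f : (Fin d → ℝ) → ℝ≥0∞} (h : ∫⁻ x, f x ∂avgMeasure Q ≠ ∞) : ∫⁻ x in Q, f x ≠ ∞ := by
  rw [← laverage_eq_lintegral_avgMeasure] at h
  rw [← laverage_mul_measure (volume_ne_zero_of_mem_cubes hQ) (volume_ne_top_of_mem_cubes hQ)]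
  exact ENNReal.mul_ne_top h (volume_ne_top_of_mem_cubes hQ)

theorem SqrtReverseHolder.one_le {w : (Fin d → ℝ) → ℝ≥0∞} {K : ℝ≥0} (h : SqrtReverseHolder w K)
    {Q : Set (Fin d → ℝ)} (hQ : Q ∈ cubes d) (hw : AEMeasurable w (avgMeasure Q))
    (h0 : ∫⁻ x, w x ∂avgMeasure Q ≠ 0) (htop : ∫⁻ x, w x ∂avgMeasure Q ≠ ∞) : 1 ≤ K := by
  have := isProbabilityMeasure_avgMeasure hQ
  have le_mul : 1 * ∫⁻ x, w x ∂avgMeasure Q ≤ K * ∫⁻ x, w x ∂avgMeasure Q := by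
    calc 1 * ∫⁻ x, w x ∂avgMeasure Q ≤ K * (∫⁻ x, w x ^ (1 / 2 : ℝ) ∂avgMeasure Q) ^ 2 := by
          rw [one_mul]
          simpa only [laverage_eq_lintegral_avgMeasure] using h Q hQ
      _ ≤ K * ∫⁻ x, w x ∂avgMeasure Q := by
          gcongr
          exact lintegral_rpow_half_sq_le hw
  exact_mod_cast (ENNReal.mul_le_mul_iff_left h0 htop).1 le_mul

end Average

/-! ### Scalar consequences of the matrix weight conditions -/

section Weights

open Filter Matrix

variable {d n : ℕ}

theorem inner_toEuclideanCLM_matPow (A : Matrix (Fin n) (Fin n) ℝ) (α : ℝ)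
    (u v : EuclideanSpace ℝ (Fin n)) :
    inner ℝ u (toEuclideanCLM (n := Fin n) (𝕜 := ℝ) (matPow A α) v) =
      inner ℝ (toEuclideanCLM (n := Fin n) (𝕜 := ℝ) (matPow A α) u) v := by
  have selfAdjoint : IsSelfAdjoint (matPow A α) := cfc_predicate (fun x : ℝ => x ^ α) A
  rw [← ContinuousLinearMap.adjoint_inner_left, ← ContinuousLinearMap.star_eq_adjoint,
    (selfAdjoint.map (toEuclideanCLM (n := Fin n) (𝕜 := ℝ))).star_eq]

theorem opNorm_matPow_mul_matPow_comm (A B : Matrix (Fin n) (Fin n) ℝ) (α β : ℝ) :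
    opNorm (matPow A α * matPow B β) = opNorm (matPow B β * matPow A α) := by
  have star_matPow (A : Matrix (Fin n) (Fin n) ℝ) (α : ℝ) : star (matPow A α) = matPow A α :=
    (cfc_predicate (fun x : ℝ => x ^ α) A : IsSelfAdjoint _).star_eq
  have star_mul_eq : star (matPow A α * matPow B β) = matPow B β * matPow A α := by
    rw [star_mul, star_matPow, star_matPow]
  rw [← star_mul_eq, opNorm, opNorm, map_star, ← ofReal_norm, ← ofReal_norm,
    ContinuousLinearMap.star_eq_adjoint, LinearIsometryEquiv.norm_map]

/-- The moment `⨍_Q |W^α(x) e| ^ β dx` of a matrix weight in the direction `e`, where `β` may be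
negative. -/
def dirMoment (W : (Fin d → ℝ) → Matrix (Fin n) (Fin n) ℝ) (Q : Set (Fin d → ℝ)) (α β : ℝ)
    (e : EuclideanSpace ℝ (Fin n)) : ℝ≥0∞ :=
  ∫⁻ x, normMulVec (matPow (W x) α) e ^ β ∂avgMeasure Q

variable {W : (Fin d → ℝ) → Matrix (Fin n) (Fin n) ℝ} {Q : Set (Fin d → ℝ)}
  {e : EuclideanSpace ℝ (Fin n)}

theorem ae_posDef_avgMeasure (hW : IsMatrixWeight W) (Q : Set (Fin d → ℝ)) :
    ∀ᵐ x ∂avgMeasure Q, (W x).PosDef :=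
  (avgMeasure_absolutelyContinuous Q).ae_le hW.posDef

theorem aemeasurable_matPow_of_isMatrixWeight (hW : IsMatrixWeight W) (α : ℝ) (i j : Fin n) :
    AEMeasurable (fun x => matPow (W x) α i j) volume :=
  aemeasurable_matPow
    (fun i j => (hW.locallyIntegrable i j).aestronglyMeasurable.aemeasurable) hW.posDef α i j

theorem aemeasurable_normMulVec_matPow (hW : IsMatrixWeight W) (α : ℝ)
    (e : EuclideanSpace ℝ (Fin n)) :
    AEMeasurable (fun x => normMulVec (matPow (W x) α) e) volume :=
  aemeasurable_normMulVec (aemeasurable_matPow_of_isMatrixWeight hW α) e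

theorem dirMoment_ne_zero (hW : IsMatrixWeight W) (hQ : Q ∈ cubes d) (he : e ≠ 0) (α β : ℝ) :
    dirMoment W Q α β e ≠ 0 := by
  have := isProbabilityMeasure_avgMeasure hQ
  refine lintegral_ne_zero_of_ae (((aemeasurable_normMulVec_matPow hW α e).mono_ac
    (avgMeasure_absolutelyContinuous Q)).pow_const β) ?_
  filter_upwards [ae_posDef_avgMeasure hW Q] with x hx
  exact (ENNReal.rpow_pos (pos_iff_ne_zero.2 (normMulVec_matPow_ne_zero hx α he))
    (normMulVec_ne_top _ _)).ne'

theorem one_le_dirMoment_neg_mul (hW : IsMatrixWeight W) (hQ : Q ∈ cubes d) (he : e ≠ 0) (α : ℝ)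
    {β δ : ℝ} (hβ : 0 < β) (hδ : 0 < δ) :
    1 ≤ dirMoment W Q α (-β) e ^ (1 / β) * dirMoment W Q α δ e ^ (1 / δ) := by
  have := isProbabilityMeasure_avgMeasure hQ
  exact one_le_lintegral_rpow_neg_mul
    ((aemeasurable_normMulVec_matPow hW α e).mono_ac (avgMeasure_absolutelyContinuous Q))
    ((ae_posDef_avgMeasure hW Q).mono fun x hx => normMulVec_matPow_ne_zero hx α he)
    (Eventually.of_forall fun x => normMulVec_ne_top _ _) hβ hδ

theorem dirMoment_rpow_add_le (hW : IsMatrixWeight W) (α : ℝ) {β : ℝ} (hβ : 1 ≤ β)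
    (z z' : EuclideanSpace ℝ (Fin n)) :
    dirMoment W Q α β (z + z') ^ (1 / β) ≤
      dirMoment W Q α β z ^ (1 / β) + dirMoment W Q α β z' ^ (1 / β) := by
  have aemeasurable (z : EuclideanSpace ℝ (Fin n)) :=
    (aemeasurable_normMulVec_matPow hW α z).mono_ac (avgMeasure_absolutelyContinuous Q)
  refine le_trans (ENNReal.rpow_le_rpow (lintegral_mono fun y => ?_) (by positivity))
    (ENNReal.lintegral_Lp_add_le (aemeasurable z) (aemeasurable z') hβ)
  refine ENNReal.rpow_le_rpow ?_ (by positivity)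
  rw [normMulVec, map_add]
  exact enorm_add_le _ _

theorem dirMoment_rpow_smul (α : ℝ) {β : ℝ} (hβ : 0 < β) (c : ℝ)
    (z : EuclideanSpace ℝ (Fin n)) :
    dirMoment W Q α β (c • z) ^ (1 / β) = ‖c‖ₑ * dirMoment W Q α β z ^ (1 / β) := by
  have c_ne_top : ‖c‖ₑ ^ β ≠ ∞ := ENNReal.rpow_ne_top_of_nonneg hβ.le enorm_ne_top
  simp only [dirMoment, normMulVec, map_smul, enorm_smul, ENNReal.mul_rpow_of_nonneg _ _ hβ.le]
  rw [lintegral_const_mul' _ _ c_ne_top, ENNReal.mul_rpow_of_nonneg _ _ (by positivity), one_div,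
    ENNReal.rpow_rpow_inv hβ.ne']

theorem dirMoment_toEuclideanCLM_rpow_le (A : Matrix (Fin n) (Fin n) ℝ) (α α' : ℝ) {β : ℝ}
    (hβ : 0 < β) (z : EuclideanSpace ℝ (Fin n)) :
    dirMoment W Q α' β (toEuclideanCLM (n := Fin n) (𝕜 := ℝ) (matPow A α) z) ^ (1 / β) ≤
      (∫⁻ y, opNorm (matPow A α * matPow (W y) α') ^ β ∂avgMeasure Q) ^ (1 / β) * ‖z‖ₑ := by
  have z_ne_top : ‖z‖ₑ ^ β ≠ ∞ := ENNReal.rpow_ne_top_of_nonneg hβ.le enorm_ne_top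
  rw [one_div, ← ENNReal.rpow_rpow_inv hβ.ne' ‖z‖ₑ,
    ← ENNReal.mul_rpow_of_nonneg _ _ (by positivity), ← lintegral_mul_const' _ _ z_ne_top]
  refine ENNReal.rpow_le_rpow (lintegral_mono fun y => ?_) (by positivity)
  rw [← ENNReal.mul_rpow_of_nonneg _ _ hβ.le, opNorm_matPow_mul_matPow_comm]
  refine ENNReal.rpow_le_rpow ?_ hβ.le
  rw [normMulVec, ← mul_apply_eq_comp, ← map_mul]
  exact ContinuousLinearMap.le_opENorm _ z

theorem normMulVec_matPow_mul_dirMoment_le {α α' β : ℝ} (hβ : 0 < β) {C : ℝ≥0∞}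
    (he : ∀ z, ‖inner ℝ e z‖ₑ * dirMoment W Q α' β e ^ (1 / β) ≤
      C * dirMoment W Q α' β z ^ (1 / β)) (A : Matrix (Fin n) (Fin n) ℝ) :
    normMulVec (matPow A α) e * dirMoment W Q α' β e ^ (1 / β) ≤
      C * (∫⁻ y, opNorm (matPow A α * matPow (W y) α') ^ β ∂avgMeasure Q) ^ (1 / β) := by
  set z := toEuclideanCLM (n := Fin n) (𝕜 := ℝ) (matPow A α) e with hz
  have normMulVec_eq : normMulVec (matPow A α) e = ‖z‖ₑ := rfl
  rw [normMulVec_eq]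
  rcases eq_or_ne z 0 with hz0 | hz0
  · rw [hz0, enorm_zero, zero_mul]
    exact zero_le
  have inner_eq : ‖inner ℝ e (toEuclideanCLM (n := Fin n) (𝕜 := ℝ) (matPow A α) z)‖ₑ =
      ‖z‖ₑ * ‖z‖ₑ := by
    rw [inner_toEuclideanCLM_matPow, ← hz, real_inner_self_eq_norm_sq, enorm_pow, enorm_norm, sq]
  refine (ENNReal.mul_le_mul_iff_left (enorm_ne_zero.2 hz0) (enorm_ne_top (x := z))).1 ?_
  calc ‖z‖ₑ * dirMoment W Q α' β e ^ (1 / β) * ‖z‖ₑ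
      = ‖z‖ₑ * ‖z‖ₑ * dirMoment W Q α' β e ^ (1 / β) := mul_right_comm _ _ _
    _ ≤ C * dirMoment W Q α' β (toEuclideanCLM (n := Fin n) (𝕜 := ℝ) (matPow A α) z) ^
          (1 / β) := inner_eq ▸ he _
    _ ≤ C * ((∫⁻ y, opNorm (matPow A α * matPow (W y) α') ^ β ∂avgMeasure Q) ^ (1 / β) * ‖z‖ₑ) :=
        mul_le_mul_right (dirMoment_toEuclideanCLM_rpow_le A α α' hβ z) C
    _ = C * (∫⁻ y, opNorm (matPow A α * matPow (W y) α') ^ β ∂avgMeasure Q) ^ (1 / β) * ‖z‖ₑ :=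
        (mul_assoc _ _ _).symm

variable {t s : ℝ}

theorem lintegral_opNorm_le_ApConst (W : (Fin d → ℝ) → Matrix (Fin n) (Fin n) ℝ) (t : ℝ)
    (hQ : Q ∈ cubes d) :
    ∫⁻ x, (∫⁻ y, opNorm (matPow (W x) (1 / t) * matPow (W y) (-(1 / t))) ^ t.conjExponent
      ∂avgMeasure Q) ^ (t / t.conjExponent) ∂avgMeasure Q ≤ ApConst W t := by
  simp only [← laverage_eq_lintegral_avgMeasure]
  exact le_iSup₂ (f := fun Q (_ : Q ∈ cubes d) => ⨍⁻ x in Q, (⨍⁻ y in Q,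
    opNorm (matPow (W x) (1 / t) * matPow (W y) (-(1 / t))) ^ t.conjExponent ∂volume)
      ^ (t / t.conjExponent) ∂volume) Q hQ

theorem dirMoment_mul_dirMoment_neg_le_ApConst (hW : IsMatrixWeight W) (ht : 1 < t)
    (hQ : Q ∈ cubes d) (e : EuclideanSpace ℝ (Fin n)) :
    dirMoment W Q (1 / t) t e *
      dirMoment W Q (1 / t) (-t.conjExponent) e ^ (t / t.conjExponent) ≤ ApConst W t := by
  have conj := Real.HolderConjugate.conjExponent ht
  have pointwise : ∀ᵐ x ∂avgMeasure Q, ∀ᵐ y ∂avgMeasure Q,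
      normMulVec (matPow (W x) (1 / t)) e * (normMulVec (matPow (W y) (1 / t)) e)⁻¹ ≤
        opNorm (matPow (W x) (1 / t) * matPow (W y) (-(1 / t))) := by
    refine Eventually.of_forall fun x => (ae_posDef_avgMeasure hW Q).mono fun y hy => ?_
    exact ENNReal.div_le_of_le_mul (normMulVec_le_opNorm_mul hy _ _ e)
  simpa only [dirMoment, ENNReal.inv_rpow, ← ENNReal.rpow_neg] using
    (lintegral_rpow_mul_lintegral_rpow_le pointwise conj.pos conj.symm.pos).trans
      (lintegral_opNorm_le_ApConst W t hQ)

theorem dirMoment_neg_mul_dirMoment_le_ApConst (hW : IsMatrixWeight W) (ht : 1 < t)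
    (hQ : Q ∈ cubes d) (e : EuclideanSpace ℝ (Fin n)) :
    dirMoment W Q (-(1 / t)) (-t) e *
      dirMoment W Q (-(1 / t)) t.conjExponent e ^ (t / t.conjExponent) ≤ ApConst W t := by
  have conj := Real.HolderConjugate.conjExponent ht
  have pointwise : ∀ᵐ x ∂avgMeasure Q, ∀ᵐ y ∂avgMeasure Q,
      (normMulVec (matPow (W x) (-(1 / t))) e)⁻¹ * normMulVec (matPow (W y) (-(1 / t))) e ≤
        opNorm (matPow (W x) (1 / t) * matPow (W y) (-(1 / t))) := by
    refine (ae_posDef_avgMeasure hW Q).mono fun x hx => Eventually.of_forall fun y => ?_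
    rw [opNorm_matPow_mul_matPow_comm, mul_comm]
    refine ENNReal.div_le_of_le_mul ?_
    simpa only [neg_neg] using
      normMulVec_le_opNorm_mul hx (-(1 / t)) (matPow (W y) (-(1 / t))) e
  simpa only [dirMoment, ENNReal.inv_rpow, ← ENNReal.rpow_neg] using
    (lintegral_rpow_mul_lintegral_rpow_le pointwise conj.pos conj.symm.pos).trans
      (lintegral_opNorm_le_ApConst W t hQ)

theorem dirMoment_zero {α β : ℝ} (hβ : 0 < β) : dirMoment W Q α β 0 = 0 := by
  simp only [dirMoment, normMulVec, map_zero, enorm_zero, ENNReal.zero_rpow_of_pos hβ,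
    lintegral_zero]

theorem dirMoment_ne_top (hW : IsMatrixWeight W) (ht : 1 < t) (hA : ApConst W t < ∞)
    (hQ : Q ∈ cubes d) (e : EuclideanSpace ℝ (Fin n)) : dirMoment W Q (1 / t) t e ≠ ∞ := by
  have conj := Real.HolderConjugate.conjExponent ht
  rcases eq_or_ne e 0 with rfl | he
  · rw [dirMoment_zero conj.pos]
    exact ENNReal.zero_ne_top
  have exponent_pos : 0 < t / t.conjExponent := div_pos conj.pos conj.symm.pos
  have mul_ne_top := ((dirMoment_mul_dirMoment_neg_le_ApConst hW ht hQ e).trans_lt hA).ne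
  refine (ENNReal.lt_top_of_mul_ne_top_left mul_ne_top ?_).ne
  rw [Ne, ENNReal.rpow_eq_zero_iff_of_pos exponent_pos]
  exact dirMoment_ne_zero hW hQ he _ _

theorem dirMoment_conjExponent_ne_top (hW : IsMatrixWeight W) (ht : 1 < t) (hA : ApConst W t < ∞)
    (hQ : Q ∈ cubes d) (e : EuclideanSpace ℝ (Fin n)) :
    dirMoment W Q (-(1 / t)) t.conjExponent e ≠ ∞ := by
  have conj := Real.HolderConjugate.conjExponent ht
  rcases eq_or_ne e 0 with rfl | he
  · rw [dirMoment_zero conj.symm.pos]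
    exact ENNReal.zero_ne_top
  have exponent_pos : 0 < t / t.conjExponent := div_pos conj.pos conj.symm.pos
  have mul_ne_top := ((dirMoment_neg_mul_dirMoment_le_ApConst hW ht hQ e).trans_lt hA).ne
  have rpow_lt_top :=
    ENNReal.lt_top_of_mul_ne_top_right mul_ne_top (dirMoment_ne_zero hW hQ he _ _)
  exact ((ENNReal.rpow_lt_top_iff_of_pos exponent_pos).1 rpow_lt_top).ne

theorem dirMoment_le (hW : IsMatrixWeight W) (ht : 1 < t) (hQ : Q ∈ cubes d) (he : e ≠ 0) {δ : ℝ}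
    (hδ : 0 < δ) :
    dirMoment W Q (1 / t) t e ≤ ApConst W t * dirMoment W Q (1 / t) δ e ^ (t / δ) := by
  have conj := Real.HolderConjugate.conjExponent ht
  have one_le := ENNReal.rpow_le_rpow
    (one_le_dirMoment_neg_mul hW hQ he (1 / t) conj.symm.pos hδ) conj.nonneg
  rw [ENNReal.one_rpow, ENNReal.mul_rpow_of_nonneg _ _ conj.nonneg, ← ENNReal.rpow_mul,
    ← ENNReal.rpow_mul, one_div_mul_eq_div, one_div_mul_eq_div] at one_le
  refine (le_mul_of_one_le_right zero_le one_le).trans ?_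
  rw [← mul_assoc]
  exact mul_le_mul_left (dirMoment_mul_dirMoment_neg_le_ApConst hW ht hQ e) _

theorem dirMoment_conjExponent_le (hW : IsMatrixWeight W) (ht : 1 < t) (hQ : Q ∈ cubes d)
    (he : e ≠ 0) {δ : ℝ} (hδ : 0 < δ) :
    dirMoment W Q (-(1 / t)) t.conjExponent e ≤ ApConst W t ^ (t.conjExponent - 1) *
      dirMoment W Q (-(1 / t)) δ e ^ (t.conjExponent / δ) := by
  have conj := Real.HolderConjugate.conjExponent ht
  have ht0 := conj.pos
  have ht'0 := conj.symm.pos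
  set t' := t.conjExponent
  have one_le := ENNReal.rpow_le_rpow
    (one_le_dirMoment_neg_mul hW hQ he (-(1 / t)) ht0 hδ) conj.nonneg
  rw [ENNReal.one_rpow, ENNReal.mul_rpow_of_nonneg _ _ conj.nonneg, ← ENNReal.rpow_mul,
    ← ENNReal.rpow_mul, one_div_mul_eq_div, one_div_mul_eq_div, div_self ht0.ne',
    ENNReal.rpow_one] at one_le
  have rpow_le : dirMoment W Q (-(1 / t)) t' e ^ (t / t') ≤
      ApConst W t * dirMoment W Q (-(1 / t)) δ e ^ (t / δ) := by
    refine (le_mul_of_one_le_left zero_le one_le).trans ?_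
    rw [mul_right_comm]
    exact mul_le_mul_left (dirMoment_neg_mul_dirMoment_le_ApConst hW ht hQ e) _
  rw [← ENNReal.le_rpow_inv_iff (by positivity), ENNReal.mul_rpow_of_nonneg _ _ (by positivity),
    ← ENNReal.rpow_mul, inv_div] at rpow_le
  have exponent_eq : t / δ * (t' - 1) = t' / δ := by
    rw [← conj.symm.div_conj_eq_sub_one]
    field_simp
  rwa [conj.symm.div_conj_eq_sub_one, exponent_eq] at rpow_le

theorem dirMoment_mul_le_RHConst (hW : IsMatrixWeight W) (ht : 1 < t) (hs : 0 < s)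
    (hA : ApConst W t < ∞) (hQ : Q ∈ cubes d) (he : e ≠ 0) :
    dirMoment W Q (1 / t) (t * s) e ≤ (RHConst W t s * dirMoment W Q (1 / t) t e) ^ s := by
  have le_RHConst : dirMoment W Q (1 / t) (t * s) e ^ (1 / s) * (dirMoment W Q (1 / t) t e)⁻¹ ≤
      RHConst W t s := by
    simp only [dirMoment, ← laverage_eq_lintegral_avgMeasure]
    refine le_trans ?_ (le_iSup _ e)
    exact le_iSup₂ (f := fun Q (_ : Q ∈ cubes d) =>
      (⨍⁻ x in Q, normMulVec (matPow (W x) (1 / t)) e ^ (t * s) ∂volume) ^ (1 / s) *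
        (⨍⁻ x in Q, normMulVec (matPow (W x) (1 / t)) e ^ t ∂volume)⁻¹) Q hQ
  rwa [← div_eq_mul_inv, ENNReal.div_le_iff (dirMoment_ne_zero hW hQ he _ _)
    (dirMoment_ne_top hW ht hA hQ e), one_div s, ENNReal.rpow_inv_le_iff hs] at le_RHConst

theorem sqrtReverseHolder_conjExponent (hW : IsMatrixWeight W) (ht : 1 < t)
    (hA : ApConst W t < ∞) (he : e ≠ 0) :
    SqrtReverseHolder (fun x => normMulVec (matPow (W x) (-(1 / t))) e ^ t.conjExponent)
      (ApConst W t ^ (t.conjExponent - 1)).toNNReal := by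
  have conj := Real.HolderConjugate.conjExponent ht
  have ht'0 := conj.symm.pos
  intro Q hQ
  have moment_le := dirMoment_conjExponent_le hW ht hQ he (δ := t.conjExponent * (1 / 2))
    (by positivity)
  rw [div_mul_cancel_left₀ ht'0.ne', inv_div, div_one, ENNReal.rpow_two] at moment_le
  rw [ENNReal.coe_toNNReal (ENNReal.rpow_ne_top_of_nonneg conj.symm.sub_one_pos.le hA.ne)]
  simpa only [dirMoment, ENNReal.rpow_mul, laverage_eq_lintegral_avgMeasure] using moment_le

theorem sqrtReverseHolder_mul (hW : IsMatrixWeight W) (ht : 1 < t) (hs : 0 < s)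
    (hA : ApConst W t < ∞) (hR : RHConst W t s < ∞) (he : e ≠ 0) :
    SqrtReverseHolder (fun x => normMulVec (matPow (W x) (1 / t)) e ^ (t * s))
      ((ApConst W t * RHConst W t s) ^ s).toNNReal := by
  have : 0 < t := zero_lt_one.trans ht
  intro Q hQ
  rw [ENNReal.coe_toNNReal (ENNReal.rpow_ne_top_of_nonneg hs.le (ENNReal.mul_lt_top hA hR).ne)]
  have moment_le : dirMoment W Q (1 / t) (t * s) e ≤
      (ApConst W t * RHConst W t s) ^ s * dirMoment W Q (1 / t) (t * s * (1 / 2)) e ^ 2 := by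
    calc dirMoment W Q (1 / t) (t * s) e
        ≤ (RHConst W t s * dirMoment W Q (1 / t) t e) ^ s :=
          dirMoment_mul_le_RHConst hW ht hs hA hQ he
      _ ≤ (RHConst W t s * (ApConst W t *
            dirMoment W Q (1 / t) (t * s * (1 / 2)) e ^ (t / (t * s * (1 / 2))))) ^ s := by
          gcongr
          exact dirMoment_le hW ht hQ he (by positivity)
      _ = (ApConst W t * RHConst W t s) ^ s * dirMoment W Q (1 / t) (t * s * (1 / 2)) e ^ 2 := by
          have exponent_eq : t / (t * s * (1 / 2)) * s = 2 := by field_simp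
          rw [← mul_assoc, mul_comm (RHConst W t s), ENNReal.mul_rpow_of_nonneg _ _ hs.le,
            ← ENNReal.rpow_mul, exponent_eq, ENNReal.rpow_two]
  simpa only [dirMoment, ENNReal.rpow_mul, laverage_eq_lintegral_avgMeasure] using moment_le

/- The basis is adapted to the seminorm `z ↦ (⨍_Q |W^{-1/t} z|^{t'})^{1/t'}`. -/
theorem exists_orthonormalBasis_dirMoment_mul_le (hW : IsMatrixWeight W) (ht : 1 < t)
    (hA : ApConst W t < ∞) (hQ : Q ∈ cubes d) :
    ∃ e : OrthonormalBasis (Fin n) ℝ (EuclideanSpace ℝ (Fin n)), ∀ i,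
      dirMoment W Q (-(1 / t)) t.conjExponent (e i) ^ (t / t.conjExponent) *
        dirMoment W Q (1 / t) t (e i) ≤ ((2 : ℝ≥0∞) ^ n) ^ t * ApConst W t := by
  have conj := Real.HolderConjugate.conjExponent ht
  have ht0 := conj.pos
  have ht'0 := conj.symm.pos
  set t' := t.conjExponent
  obtain ⟨e, he⟩ := exists_orthonormalBasis_enorm_inner_mul_le
    (fun z => dirMoment W Q (-(1 / t)) t' z ^ (1 / t'))
    (fun z => ENNReal.rpow_ne_top_of_nonneg (by positivity)
      (dirMoment_conjExponent_ne_top hW ht hA hQ z))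
    (dirMoment_rpow_add_le hW _ conj.symm.lt.le) (dirMoment_rpow_smul _ ht'0)
  refine ⟨e, fun i => ?_⟩
  have two_pow_ne_top : ((2 : ℝ≥0∞) ^ n) ^ t ≠ ∞ :=
    ENNReal.rpow_ne_top_of_nonneg ht0.le (ENNReal.pow_ne_top ENNReal.ofNat_ne_top)
  refine (lintegral_const_mul_le _ _).trans ?_
  refine le_trans (lintegral_mono fun x => ?_) ((lintegral_const_mul' _ _ two_pow_ne_top).le.trans
    (mul_le_mul_right (lintegral_opNorm_le_ApConst W t hQ) _))
  have rpow_le := ENNReal.rpow_le_rpow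
    (normMulVec_matPow_mul_dirMoment_le (α := 1 / t) ht'0 (he i) (W x)) ht0.le
  rwa [ENNReal.mul_rpow_of_nonneg _ _ ht0.le, ENNReal.mul_rpow_of_nonneg _ _ ht0.le,
    ← ENNReal.rpow_mul, ← ENNReal.rpow_mul, one_div_mul_eq_div, mul_comm] at rpow_le

end Weights

/-! ### Convex bodies of weighted functions -/

section Bodies

open Filter Matrix

variable {d n : ℕ}

theorem aestronglyMeasurable_toLp {X : Type*} [MeasurableSpace X] {μ : Measure X} {B : Type*}
    [NormedAddCommGroup B] {v : Fin n → X → B} (hv : ∀ i, AEStronglyMeasurable (v i) μ) :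
    AEStronglyMeasurable
      (fun x => (WithLp.toLp 2 fun i => v i x : PiLp 2 fun _ : Fin n => B)) μ := by
  have continuous_toLp_single (i : Fin n) : Continuous fun b : B =>
      (WithLp.toLp 2 (Pi.single i b) : PiLp 2 fun _ : Fin n => B) :=
    (PiLp.continuous_toLp 2 fun _ : Fin n => B).comp (continuous_single (A := fun _ => B) i)
  have toLp_eq_sum : (fun x => (WithLp.toLp 2 fun i => v i x : PiLp 2 fun _ : Fin n => B)) =
      fun x => ∑ i, (WithLp.toLp 2 (Pi.single i (v i x)) : PiLp 2 fun _ : Fin n => B) := by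
    funext x
    rw [← WithLp.toLp_sum, Finset.univ_sum_single]
  rw [toLp_eq_sum]
  exact Finset.aestronglyMeasurable_fun_sum _ fun i _ =>
    (continuous_toLp_single i).comp_aestronglyMeasurable (hv i)

theorem aestronglyMeasurable_matAct {W : (Fin d → ℝ) → Matrix (Fin n) (Fin n) ℝ}
    (hW : IsMatrixWeight W) (α : ℝ) {B : Type*} [NormedAddCommGroup B] [NormedSpace ℝ B]
    {f : Fin n → (Fin d → ℝ) → B} (hf : ∀ i, AEStronglyMeasurable (f i) volume) :
    AEStronglyMeasurable (fun x => matAct (matPow (W x) α) fun i => f i x) volume :=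
  aestronglyMeasurable_toLp fun i => Finset.aestronglyMeasurable_fun_sum _ fun j _ =>
    (aemeasurable_matPow_of_isMatrixWeight hW α i j).aestronglyMeasurable.smul (hf j)

theorem bodyDot_convexBody_le {X Y : Type*} [NormedAddCommGroup X] [NormedSpace ℝ X]
    [NormedAddCommGroup Y] [NormedSpace ℝ Y] (x : Fin n → X) (y : Fin n → Y)
    (e : OrthonormalBasis (Fin n) ℝ (EuclideanSpace ℝ (Fin n))) :
    bodyDot (convexBody x) (convexBody y) ≤
      ∑ i, ‖∑ j, e i j • x j‖ * ‖∑ j, e i j • y j‖ := by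
  refine Real.sSup_le ?_ (by positivity)
  rintro c ⟨a, ⟨φ, hφ, rfl⟩, b, ⟨ψ, hψ, rfl⟩, rfl⟩
  have parseval : (fun i => φ (x i)) ⬝ᵥ (fun i => ψ (y i)) =
      ∑ i, φ (∑ j, e i j • x j) * ψ (∑ j, e i j • y j) := by
    simpa [PiLp.inner_apply, dotProduct, mul_comm] using
      (e.sum_inner_mul_inner (WithLp.toLp 2 fun i => φ (x i)) (WithLp.toLp 2 fun i => ψ (y i))).symm
  rw [parseval]
  refine Finset.sum_le_sum fun i _ => (le_abs_self _).trans ?_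
  rw [abs_mul]
  gcongr
  · simpa only [one_mul, Real.norm_eq_abs] using φ.le_of_opNorm_le hφ (∑ j, e i j • x j)
  · simpa only [one_mul, Real.norm_eq_abs] using ψ.le_of_opNorm_le hψ (∑ j, e i j • y j)

section Lp

variable {X : Type*} [MeasurableSpace X] {μ : Measure X} {B : Type*} [NormedAddCommGroup B]
  [NormedSpace ℝ B] {p : ℝ≥0∞}

theorem coeFn_sum_smul_toLp {ι : Type*} {f : ι → X → B} (hf : ∀ i, MemLp (f i) p μ) (c : ι → ℝ)
    (s : Finset ι) :
    (∑ j ∈ s, c j • (hf j).toLp (f j) : Lp B p μ) =ᵐ[μ] fun x => ∑ j ∈ s, c j • f j x := by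
  classical
  induction s using Finset.induction_on with
  | empty =>
    simp only [Finset.sum_empty]
    exact Lp.coeFn_zero B p μ
  | insert a s ha ih =>
    rw [Finset.sum_insert ha]
    filter_upwards [Lp.coeFn_add (c a • (hf a).toLp (f a)) (∑ j ∈ s, c j • (hf j).toLp (f j)),
      Lp.coeFn_smul (c a) ((hf a).toLp (f a)), (hf a).coeFn_toLp, ih]
      with x h_add h_smul h_toLp h_sum
    rw [h_add, Pi.add_apply, h_smul, Pi.smul_apply, h_toLp, h_sum, Finset.sum_insert ha]

theorem ofReal_norm_sum_smul_toLp [Fact (1 ≤ p)] {f : Fin n → X → B} (hf : ∀ i, MemLp (f i) p μ)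
    (c : Fin n → ℝ) :
    ENNReal.ofReal ‖∑ j, c j • (hf j).toLp (f j)‖ = eLpNorm (fun x => ∑ j, c j • f j x) p μ := by
  rw [ofReal_norm, Lp.enorm_def]
  exact eLpNorm_congr_ae (coeFn_sum_smul_toLp hf c _)

end Lp

theorem ofReal_bodyDot_convexBody_toLp_le {X : Type*} [MeasurableSpace X] {μ : Measure X}
    {B₁ B₂ : Type*} [NormedAddCommGroup B₁] [NormedSpace ℝ B₁] [NormedAddCommGroup B₂]
    [NormedSpace ℝ B₂] {p q : ℝ≥0∞} [Fact (1 ≤ p)] [Fact (1 ≤ q)] {f : Fin n → X → B₁}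
    {g : Fin n → X → B₂} (hf : ∀ i, MemLp (f i) p μ) (hg : ∀ i, MemLp (g i) q μ)
    (e : OrthonormalBasis (Fin n) ℝ (EuclideanSpace ℝ (Fin n))) :
    ENNReal.ofReal (bodyDot (convexBody fun i => (hf i).toLp (f i))
      (convexBody fun i => (hg i).toLp (g i))) ≤
      ∑ i, eLpNorm (fun x => ∑ j, e i j • f j x) p μ *
        eLpNorm (fun x => ∑ j, e i j • g j x) q μ := by
  refine (ENNReal.ofReal_le_ofReal (bodyDot_convexBody_le _ _ e)).trans_eq ?_
  rw [ENNReal.ofReal_sum_of_nonneg fun i _ => by positivity]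
  simp only [ENNReal.ofReal_mul (norm_nonneg _), ofReal_norm_sum_smul_toLp hf,
    ofReal_norm_sum_smul_toLp hg]

variable {W : (Fin d → ℝ) → Matrix (Fin n) (Fin n) ℝ} {B : Type*} [NormedAddCommGroup B]
  [NormedSpace ℝ B] {p : ℝ≥0∞} {e : EuclideanSpace ℝ (Fin n)} {θ : ℝ}

theorem eLpNorm_sum_smul_le_lintegral (hW : IsMatrixWeight W) (hp0 : p ≠ 0) (hp : p ≠ ∞) (α : ℝ)
    (hθ0 : 0 ≤ θ) (hθ : θ ≤ 1) (f : Fin n → (Fin d → ℝ) → B) (he : ‖e‖ = 1)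
    (Q : Set (Fin d → ℝ)) :
    eLpNorm (fun x => ∑ j, e j • f j x) p (avgMeasure Q) ≤
      (∫⁻ x, (normMulVec (matPow (W x) (-α)) e ^ θ *
        ‖matAct (matPow (W x) (α * θ)) fun i => f i x‖ₑ) ^ p.toReal ∂avgMeasure Q) ^
          (1 / p.toReal) := by
  rw [eLpNorm_eq_lintegral_rpow_enorm_toReal hp0 hp]
  gcongr 1
  refine lintegral_mono_ae ?_
  filter_upwards [ae_posDef_avgMeasure hW Q] with x hx
  gcongr 1
  refine (enorm_sum_smul_le hx (α * θ) e fun i => f i x).trans ?_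
  gcongr
  rw [← neg_mul]
  exact normMulVec_matPow_mul_le hx (-α) hθ0 hθ he

theorem eLpNorm_sum_smul_le_bumpExponent {b m : ℝ} {K : ℝ≥0} [Fact (1 ≤ p)] (hd : 0 < d)
    (hW : IsMatrixWeight W) (h : m.HolderTriple b p.toReal) (hK : 1 ≤ K) (α : ℝ)
    (hθ0 : 0 ≤ θ) (hθ : θ ≤ 1)
    (hrh : SqrtReverseHolder (fun x => normMulVec (matPow (W x) (-α)) e ^ (θ * m)) K)
    {f : Fin n → (Fin d → ℝ) → B} (hf : ∀ i, AEStronglyMeasurable (f i) volume) (he : ‖e‖ = 1)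
    {Q : Set (Fin d → ℝ)} (hQ : Q ∈ cubes d) (hfin : dirMoment W Q (-α) (θ * m) e ≠ ∞) :
    eLpNorm (fun x => ∑ j, e j • f j x) p (avgMeasure Q) ≤
      2 * dirMoment W Q (-α) (θ * m) e ^ (1 / m) *
        (⨍⁻ x in Q, ‖matAct (matPow (W x) (α * θ)) fun i => f i x‖ₑ ^
          bumpExponent d K p.toReal m ∂volume) ^ (1 / bumpExponent d K p.toReal m) := by
  obtain ⟨p_pos, p_lt_top⟩ := ENNReal.toReal_pos_iff.1 h.pos'
  refine (eLpNorm_sum_smul_le_lintegral hW p_pos.ne' p_lt_top.ne α hθ0 hθ f he Q).trans ?_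
  simp only [dirMoment, ← laverage_eq_lintegral_avgMeasure, ENNReal.rpow_mul] at hrh ⊢
  refine hrh.laverage_mul_rpow_le_bumpExponent hd hK
    ((ENNReal.dichotomy p).resolve_left p_lt_top.ne) h
    ((aemeasurable_normMulVec_matPow hW (-α) e).pow_const θ) hQ ?_
    (aestronglyMeasurable_matAct hW (α * θ) hf).enorm
  simp only [← ENNReal.rpow_mul]
  exact setLIntegral_ne_top_of_lintegral_avgMeasure hQ hfin

end Bodies

/-! ### The weighted bound for the sparse form -/

section Sparse

variable {d : ℕ} {γ : ℝ}

theorem sum_sparse_le (hγ : 0 < γ) {𝒮 : Finset (Set (Fin d → ℝ))}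
    {E : Set (Fin d → ℝ) → Set (Fin d → ℝ)}
    (hE : ∀ Q ∈ 𝒮, E Q ⊆ Q ∧ MeasurableSet (E Q) ∧ ENNReal.ofReal γ * volume Q ≤ volume (E Q))
    (hdis : (𝒮 : Set (Set (Fin d → ℝ))).PairwiseDisjoint E)
    {c : Set (Fin d → ℝ) → ℝ≥0∞} {Φ : (Fin d → ℝ) → ℝ≥0∞}
    (hc : ∀ Q ∈ 𝒮, ∀ x ∈ Q, c Q ≤ Φ x) :
    ∑ Q ∈ 𝒮, volume Q * c Q ≤ (ENNReal.ofReal γ)⁻¹ * ∫⁻ x, Φ x := by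
  have hγ0 : ENNReal.ofReal γ ≠ 0 := (ENNReal.ofReal_pos.2 hγ).ne'
  have term_le : ∀ Q ∈ 𝒮, volume Q * c Q ≤ (ENNReal.ofReal γ)⁻¹ * ∫⁻ x in E Q, Φ x := by
    intro Q hQ
    obtain ⟨subset, measurable, volume_le⟩ := hE Q hQ
    calc volume Q * c Q = (ENNReal.ofReal γ)⁻¹ * (ENNReal.ofReal γ * volume Q * c Q) := by
          rw [← mul_assoc, ← mul_assoc, ENNReal.inv_mul_cancel hγ0 ENNReal.ofReal_ne_top, one_mul]
      _ ≤ (ENNReal.ofReal γ)⁻¹ * (c Q * volume (E Q)) := by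
          rw [mul_comm (c Q)]
          gcongr
      _ ≤ (ENNReal.ofReal γ)⁻¹ * ∫⁻ x in E Q, Φ x := by
          gcongr
          rw [← setLIntegral_const]
          exact setLIntegral_mono' measurable fun x hx => hc Q hQ x (subset hx)
  calc ∑ Q ∈ 𝒮, volume Q * c Q
      ≤ ∑ Q ∈ 𝒮, (ENNReal.ofReal γ)⁻¹ * ∫⁻ x in E Q, Φ x := Finset.sum_le_sum term_le
    _ = (ENNReal.ofReal γ)⁻¹ * ∫⁻ x in ⋃ Q ∈ 𝒮, E Q, Φ x := by
        rw [← Finset.mul_sum, lintegral_biUnion_finset hdis fun Q hQ => (hE Q hQ).2.1]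
    _ ≤ (ENNReal.ofReal γ)⁻¹ * ∫⁻ x, Φ x := by
        gcongr
        exact Measure.restrict_le_self

theorem tsum_sparse_le (hγ : 0 < γ) {𝒬 : Set (Set (Fin d → ℝ))} (hsp : IsSparse γ 𝒬)
    (hlam : IsLaminar volume 𝒬) {r r' κ κ' : ℝ} (hr : r.HolderConjugate r') (hκ : 0 < κ)
    (hκ' : 0 < κ') {h k : (Fin d → ℝ) → ℝ≥0∞} {M N : ℝ≥0∞}
    (hM : ∀ 𝒮 : Finset (Set (Fin d → ℝ)), IsLaminar volume (𝒮 : Set (Set (Fin d → ℝ))) →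
      ∫⁻ x, maxFn volume 𝒮 (fun y => h y ^ κ) x ^ (r / κ) ≤ M)
    (hN : ∀ 𝒮 : Finset (Set (Fin d → ℝ)), IsLaminar volume (𝒮 : Set (Set (Fin d → ℝ))) →
      ∫⁻ x, maxFn volume 𝒮 (fun y => k y ^ κ') x ^ (r' / κ') ≤ N) :
    ∑' Q : 𝒬, volume (Q : Set (Fin d → ℝ)) * ((⨍⁻ x in Q, h x ^ κ ∂volume) ^ (1 / κ) *
        (⨍⁻ x in Q, k x ^ κ' ∂volume) ^ (1 / κ')) ≤
      (ENNReal.ofReal γ)⁻¹ * (M ^ (1 / r) * N ^ (1 / r')) := by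
  obtain ⟨E, hE, hE_disj⟩ := hsp
  rw [ENNReal.tsum_eq_iSup_sum]
  refine iSup_le fun 𝒯 => ?_
  set 𝒮 : Finset (Set (Fin d → ℝ)) := 𝒯.map (Function.Embedding.subtype _)
  have h𝒮 : (𝒮 : Set (Set (Fin d → ℝ))) ⊆ 𝒬 := fun Q hQ => by
    obtain ⟨Q, -, rfl⟩ := Finset.mem_map.1 (Finset.mem_coe.1 hQ)
    exact Q.2
  have hlam𝒮 := hlam.mono h𝒮
  set F := maxFn volume 𝒮 fun y => h y ^ κ
  set G := maxFn volume 𝒮 fun y => k y ^ κ'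
  have hF : Measurable F := measurable_maxFn (fun S hS => hlam𝒮.measurableSet S hS) _
  have hG : Measurable G := measurable_maxFn (fun S hS => hlam𝒮.measurableSet S hS) _
  calc ∑ Q ∈ 𝒯, volume (Q : Set (Fin d → ℝ)) * ((⨍⁻ x in Q, h x ^ κ ∂volume) ^ (1 / κ) *
        (⨍⁻ x in Q, k x ^ κ' ∂volume) ^ (1 / κ'))
      = ∑ Q ∈ 𝒮, volume Q * ((⨍⁻ x in Q, h x ^ κ ∂volume) ^ (1 / κ) *
        (⨍⁻ x in Q, k x ^ κ' ∂volume) ^ (1 / κ')) := by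
        rw [Finset.sum_map]
        rfl
    _ ≤ (ENNReal.ofReal γ)⁻¹ * ∫⁻ x, F x ^ (1 / κ) * G x ^ (1 / κ') := by
        refine sum_sparse_le hγ (fun Q hQ => hE Q (h𝒮 hQ)) (hE_disj.subset h𝒮) fun Q hQ x hx => ?_
        gcongr
        · exact laverage_le_maxFn (fun y => h y ^ κ) hQ hx
        · exact laverage_le_maxFn (fun y => k y ^ κ') hQ hx
    _ ≤ (ENNReal.ofReal γ)⁻¹ * ((∫⁻ x, F x ^ (r / κ)) ^ (1 / r) *
          (∫⁻ x, G x ^ (r' / κ')) ^ (1 / r')) := by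
        gcongr
        simpa only [Pi.mul_apply, ← ENNReal.rpow_mul, one_div_mul_eq_div] using
          ENNReal.lintegral_mul_le_Lp_mul_Lq volume hr (hF.pow_const (1 / κ)).aemeasurable
            (hG.pow_const (1 / κ')).aemeasurable
    _ ≤ (ENNReal.ofReal γ)⁻¹ * (M ^ (1 / r) * N ^ (1 / r')) := by
        have := hr.one_div_nonneg
        have := hr.symm.one_div_nonneg
        gcongr
        · exact hM 𝒮 hlam𝒮
        · exact hN 𝒮 hlam𝒮

end Sparse

section Form

open Filter Matrix

variable {d n : ℕ} {r r' t s : ℝ}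

theorem holderTriple_mul_conjExponent (ht : 1 < t) {p : ℝ} (hp : 0 < p) :
    (p * t.conjExponent).HolderTriple (t * p) p := by
  have conj := Real.HolderConjugate.conjExponent ht
  refine ⟨?_, mul_pos hp conj.symm.pos, mul_pos conj.pos hp⟩
  rw [mul_comm t, mul_inv, mul_inv, ← mul_add, conj.symm.inv_add_inv_eq_one, mul_one]

variable {W : (Fin d → ℝ) → Matrix (Fin n) (Fin n) ℝ} {Q : Set (Fin d → ℝ)}

theorem dirMoment_mul_ne_top (hW : IsMatrixWeight W) (ht : 1 < t) (hs : 0 < s)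
    (hA : ApConst W t < ∞) (hR : RHConst W t s < ∞) (hQ : Q ∈ cubes d)
    {e : EuclideanSpace ℝ (Fin n)} (he : e ≠ 0) : dirMoment W Q (1 / t) (t * s) e ≠ ∞ :=
  ne_top_of_le_ne_top (ENNReal.rpow_ne_top_of_nonneg hs.le
    (ENNReal.mul_ne_top hR.ne (dirMoment_ne_top hW ht hA hQ e)))
    (dirMoment_mul_le_RHConst hW ht hs hA hQ he)

theorem one_le_ApConst_rpow (hn : 0 < n) (hW : IsMatrixWeight W) (ht : 1 < t)
    (hA : ApConst W t < ∞) : 1 ≤ (ApConst W t ^ (t.conjExponent - 1)).toNNReal := by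
  have he : (EuclideanSpace.single ⟨0, hn⟩ 1 : EuclideanSpace ℝ (Fin n)) ≠ 0 := by simp
  have hQ : cube (0 : Fin d → ℝ) 1 ∈ cubes d := ⟨0, 1, one_pos, rfl⟩
  exact (sqrtReverseHolder_conjExponent hW ht hA he).one_le hQ
    (((aemeasurable_normMulVec_matPow hW _ _).mono_ac
      (avgMeasure_absolutelyContinuous _)).pow_const _)
    (dirMoment_ne_zero hW hQ he _ _) (dirMoment_conjExponent_ne_top hW ht hA hQ _)

theorem one_le_ApConst_mul_RHConst_rpow (hn : 0 < n) (hW : IsMatrixWeight W) (ht : 1 < t)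
    (hs : 0 < s) (hA : ApConst W t < ∞) (hR : RHConst W t s < ∞) :
    1 ≤ ((ApConst W t * RHConst W t s) ^ s).toNNReal := by
  have he : (EuclideanSpace.single ⟨0, hn⟩ 1 : EuclideanSpace ℝ (Fin n)) ≠ 0 := by simp
  have hQ : cube (0 : Fin d → ℝ) 1 ∈ cubes d := ⟨0, 1, one_pos, rfl⟩
  exact (sqrtReverseHolder_mul hW ht hs hA hR he).one_le hQ
    (((aemeasurable_normMulVec_matPow hW _ _).mono_ac
      (avgMeasure_absolutelyContinuous _)).pow_const _)
    (dirMoment_ne_zero hW hQ he _ _) (dirMoment_mul_ne_top hW ht hs hA hR hQ he)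

section Component

variable {B : Type*} [NormedAddCommGroup B] [NormedSpace ℝ B] {f : Fin n → (Fin d → ℝ) → B}
  {p : ℝ≥0∞} [Fact (1 ≤ p)] {e : EuclideanSpace ℝ (Fin n)} {K : ℝ≥0}

theorem eLpNorm_sum_smul_le_dirMoment_conjExponent (hd : 0 < d) (hW : IsMatrixWeight W)
    (ht : 1 < t) (hp : 1 ≤ p.toReal) (hA : ApConst W t < ∞)
    (hf : ∀ i, AEStronglyMeasurable (f i) volume) (he : ‖e‖ = 1) (hQ : Q ∈ cubes d) (hK : 1 ≤ K)
    (hrh : SqrtReverseHolder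
      (fun x => normMulVec (matPow (W x) (-(1 / t))) e ^ t.conjExponent) K) :
    eLpNorm (fun x => ∑ j, e j • f j x) p (avgMeasure Q) ≤
      2 * dirMoment W Q (-(1 / t)) t.conjExponent e ^ (1 / (p.toReal * t.conjExponent)) *
        (⨍⁻ x in Q, ‖matAct (matPow (W x) (1 / (t * p.toReal))) fun i => f i x‖ₑ ^
          bumpExponent d K p.toReal (p.toReal * t.conjExponent) ∂volume) ^
            (1 / bumpExponent d K p.toReal (p.toReal * t.conjExponent)) := by
  have hp0 : 0 < p.toReal := zero_lt_one.trans_le hp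
  have moment_exponent : 1 / p.toReal * (p.toReal * t.conjExponent) = t.conjExponent := by
    field_simp
  have weight_exponent : 1 / t * (1 / p.toReal) = 1 / (t * p.toReal) := one_div_mul_one_div _ _
  have bound := eLpNorm_sum_smul_le_bumpExponent (f := f) (θ := 1 / p.toReal) hd hW
    (holderTriple_mul_conjExponent ht hp0) hK (1 / t) (by positivity) ((div_le_one hp0).2 hp)
    (by rwa [moment_exponent]) hf he hQ
    (by rw [moment_exponent]; exact dirMoment_conjExponent_ne_top hW ht hA hQ e)
  rwa [moment_exponent, weight_exponent] at bound

theorem eLpNorm_sum_smul_le_dirMoment (hd : 0 < d) (hW : IsMatrixWeight W) (ht : 1 < t)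
    (hs : 0 < s) {a : ℝ} (ha : 1 ≤ a) (hq : (t * a * s).HolderTriple r' p.toReal)
    (hA : ApConst W t < ∞) (hR : RHConst W t s < ∞)
    (hf : ∀ i, AEStronglyMeasurable (f i) volume) (he : ‖e‖ = 1) (hQ : Q ∈ cubes d) (hK : 1 ≤ K)
    (hrh : SqrtReverseHolder (fun x => normMulVec (matPow (W x) (1 / t)) e ^ (t * s)) K) :
    eLpNorm (fun x => ∑ j, e j • f j x) p (avgMeasure Q) ≤
      2 * (RHConst W t s * dirMoment W Q (1 / t) t e) ^ (1 / (t * a)) *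
        (⨍⁻ x in Q, ‖matAct (matPow (W x) (-(1 / (t * a)))) fun i => f i x‖ₑ ^
          bumpExponent d K p.toReal (t * a * s) ∂volume) ^
            (1 / bumpExponent d K p.toReal (t * a * s)) := by
  have : 0 < t := zero_lt_one.trans ht
  have ha0 : 0 < a := zero_lt_one.trans_le ha
  have he0 : e ≠ 0 := norm_ne_zero_iff.1 (he ▸ one_ne_zero)
  have moment_exponent : 1 / a * (t * a * s) = t * s := by
    field_simp
  have weight_exponent : -(1 / t) * (1 / a) = -(1 / (t * a)) := by
    rw [neg_mul, one_div_mul_one_div]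
  have bound := eLpNorm_sum_smul_le_bumpExponent (f := f) (θ := 1 / a) hd hW hq hK
    (-(1 / t)) (by positivity) ((div_le_one ha0).2 ha) (by rwa [moment_exponent, neg_neg]) hf he hQ
    (by rw [moment_exponent, neg_neg]; exact dirMoment_mul_ne_top hW ht hs hA hR hQ he0)
  rw [moment_exponent, weight_exponent, neg_neg] at bound
  refine bound.trans ?_
  gcongr
  calc dirMoment W Q (1 / t) (t * s) e ^ (1 / (t * a * s))
      ≤ ((RHConst W t s * dirMoment W Q (1 / t) t e) ^ s) ^ (1 / (t * a * s)) := by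
        gcongr
        exact dirMoment_mul_le_RHConst hW ht hs hA hQ he0
    _ = (RHConst W t s * dirMoment W Q (1 / t) t e) ^ (1 / (t * a)) := by
        rw [← ENNReal.rpow_mul]
        congr 1
        field_simp

end Component

theorem dirMoment_rpow_mul_rpow_le {p : ℝ} (ht : 1 < t) (hp : 0 < p)
    {e : EuclideanSpace ℝ (Fin n)} {A R c : ℝ≥0∞}
    (he : dirMoment W Q (-(1 / t)) t.conjExponent e ^ (t / t.conjExponent) *
      dirMoment W Q (1 / t) t e ≤ c * A) :
    dirMoment W Q (-(1 / t)) t.conjExponent e ^ (1 / (p * t.conjExponent)) *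
      (R * dirMoment W Q (1 / t) t e) ^ (1 / (t * p)) ≤ (c * (A * R)) ^ (1 / (t * p)) := by
  have : 0 < t := zero_lt_one.trans ht
  have exponent_eq : 1 / (p * t.conjExponent) = t / t.conjExponent * (1 / (t * p)) := by
    field_simp
  rw [exponent_eq, ENNReal.rpow_mul, ← ENNReal.mul_rpow_of_nonneg _ _ (by positivity)]
  gcongr 1
  rw [mul_left_comm, ← mul_assoc c, mul_comm (c * A)]
  gcongr

theorem sparse_form_const_eq {A R F G γ : ℝ≥0∞} {C₁ C₂ : ℝ≥0} (n : ℕ) (hr : r.HolderConjugate r')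
    (ht : 1 < t) (hs : 0 < s) :
    γ * (n * (4 * ((2 ^ n) ^ t * (A * R)) ^ (1 / r)) *
        ((C₁ * A ^ (t.conjExponent - 1) * F) ^ (1 / r) * (C₂ * (A * R) ^ s * G) ^ (1 / r'))) =
      γ * n * 4 * ((2 ^ n) ^ t) ^ (1 / r) * C₁ ^ (1 / r) * C₂ ^ (1 / r') *
        (A ^ (t.conjExponent / r + s / r') * R ^ (1 / r + s / r')) *
        (F ^ (1 / r) * G ^ (1 / r')) := by
  have h_inv := hr.one_div_nonneg
  have h_inv' := hr.symm.one_div_nonneg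
  have h_sub := (Real.HolderConjugate.conjExponent ht).symm.sub_one_pos.le
  have A_rpow : A ^ (t.conjExponent / r + s / r') =
      A ^ (1 / r) * A ^ ((t.conjExponent - 1) * (1 / r)) * A ^ (s * (1 / r')) := by
    rw [← ENNReal.rpow_add_of_nonneg _ _ h_inv (by positivity),
      ← ENNReal.rpow_add_of_nonneg _ _ (by positivity) (by positivity)]
    congr 1
    ring
  have R_rpow : R ^ (1 / r + s / r') = R ^ (1 / r) * R ^ (s * (1 / r')) := by
    rw [← ENNReal.rpow_add_of_nonneg _ _ h_inv (by positivity)]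
    congr 1
    ring
  rw [A_rpow, R_rpow]
  simp only [ENNReal.mul_rpow_of_nonneg _ _ h_inv, ENNReal.mul_rpow_of_nonneg _ _ h_inv',
    ENNReal.mul_rpow_of_nonneg _ _ hs.le, ← ENNReal.rpow_mul]
  ring

theorem bodyDot_fin_zero (A B : Set (Fin 0 → ℝ)) : bodyDot A B = 0 := by
  have subset_zero : {c | ∃ a ∈ A, ∃ b ∈ B, c = a ⬝ᵥ b} ⊆ {0} := by
    rintro _ ⟨a, -, b, -, rfl⟩
    simp
  rcases Set.subset_singleton_iff_eq.1 subset_zero with h | h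
  · rw [bodyDot, h, Real.sSup_empty]
  · rw [bodyDot, h, csSup_singleton]

section Body

variable {B₁ B₂ : Type*} [NormedAddCommGroup B₁] [NormedSpace ℝ B₁] [NormedAddCommGroup B₂]
  [NormedSpace ℝ B₂] {p q' : ℝ≥0∞} [Fact (1 ≤ p)] [Fact (1 ≤ q')]
  {f : Fin n → ((Fin d → ℝ) →ₘ[volume] B₁)} {g : Fin n → ((Fin d → ℝ) →ₘ[volume] B₂)}

theorem ofReal_bodyDot_localBody_le (hd : 0 < d) (hW : IsMatrixWeight W) (ht : 1 < t) (hs : 0 < s)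
    (hp : 1 ≤ p.toReal) (hq' : (t * p.toReal * s).HolderTriple r' q'.toReal)
    (hA : ApConst W t < ∞) (hR : RHConst W t s < ∞) {K₁ K₂ : ℝ≥0} (hK₁ : 1 ≤ K₁) (hK₂ : 1 ≤ K₂)
    (hrh₁ : ∀ e : EuclideanSpace ℝ (Fin n), e ≠ 0 → SqrtReverseHolder
      (fun x => normMulVec (matPow (W x) (-(1 / t))) e ^ t.conjExponent) K₁)
    (hrh₂ : ∀ e : EuclideanSpace ℝ (Fin n), e ≠ 0 → SqrtReverseHolder
      (fun x => normMulVec (matPow (W x) (1 / t)) e ^ (t * s)) K₂)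
    (hQ : Q ∈ cubes d) (hf : ∀ i, MemLp (f i) p (avgMeasure Q))
    (hg : ∀ i, MemLp (g i) q' (avgMeasure Q)) :
    ENNReal.ofReal (bodyDot (localBody p Q f hf) (localBody q' Q g hg)) ≤
      n * (4 * ((2 ^ n) ^ t * (ApConst W t * RHConst W t s)) ^ (1 / (t * p.toReal))) *
        ((⨍⁻ x in Q, ‖matAct (matPow (W x) (1 / (t * p.toReal))) fun i => f i x‖ₑ ^
            bumpExponent d K₁ p.toReal (p.toReal * t.conjExponent) ∂volume) ^
              (1 / bumpExponent d K₁ p.toReal (p.toReal * t.conjExponent)) *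
          (⨍⁻ x in Q, ‖matAct (matPow (W x) (-(1 / (t * p.toReal)))) fun i => g i x‖ₑ ^
            bumpExponent d K₂ q'.toReal (t * p.toReal * s) ∂volume) ^
              (1 / bumpExponent d K₂ q'.toReal (t * p.toReal * s))) := by
  obtain ⟨e, he⟩ := exists_orthonormalBasis_dirMoment_mul_le hW ht hA hQ
  refine (ofReal_bodyDot_convexBody_toLp_le hf hg e).trans ?_
  rw [mul_assoc, ← nsmul_eq_mul]
  refine (Finset.sum_le_card_nsmul _ _ _ fun i _ => ?_).trans_eq
    (by rw [Finset.card_univ, Fintype.card_fin])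
  have hei : ‖e i‖ = 1 := e.orthonormal.1 i
  have hei0 : e i ≠ 0 := e.orthonormal.ne_zero i
  refine (mul_le_mul'
    (eLpNorm_sum_smul_le_dirMoment_conjExponent hd hW ht hp hA
      (fun i => (f i).aestronglyMeasurable) hei hQ hK₁ (hrh₁ _ hei0))
    (eLpNorm_sum_smul_le_dirMoment hd hW ht hs hp hq' hA hR
      (fun i => (g i).aestronglyMeasurable) hei hQ hK₂ (hrh₂ _ hei0))).trans ?_
  rw [mul_mul_mul_comm, mul_mul_mul_comm (2 : ℝ≥0∞) _ 2, show (2 : ℝ≥0∞) * 2 = 4 by norm_num]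
  gcongr
  exact dirMoment_rpow_mul_rpow_le ht (zero_lt_one.trans_le hp) (he i)

end Body

theorem exists_tsum_bodyDot_le (hd : 0 < d) (n : ℕ) {p q' : ℝ≥0∞} [Fact (1 ≤ p)] [Fact (1 ≤ q')]
    {γ : ℝ} (hr : r.HolderConjugate r') (ht : 1 < t) (htr : t * p.toReal = r) (hs : 0 < s)
    (hq' : (r * s).HolderTriple r' q'.toReal) (hγ : 0 < γ) :
    ∃ C : ℝ≥0, ∀ {B₁ B₂ : Type*} [NormedAddCommGroup B₁] [NormedSpace ℝ B₁]
      [NormedAddCommGroup B₂] [NormedSpace ℝ B₂] {𝒟 : Set (Set (Fin d → ℝ))}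
      (_ : IsDyadicLattice 𝒟) {W : (Fin d → ℝ) → Matrix (Fin n) (Fin n) ℝ}
      (_ : IsMatrixWeight W) (_ : ApConst W t < ∞) (_ : RHConst W t s < ∞)
      {f : Fin n → ((Fin d → ℝ) →ₘ[volume] B₁)} {g : Fin n → ((Fin d → ℝ) →ₘ[volume] B₂)}
      {𝒬 : Set (Set (Fin d → ℝ))} (_ : 𝒬 ⊆ 𝒟) (_ : IsSparse γ 𝒬)
      (hf : ∀ Q : 𝒬, ∀ i, MemLp (f i) p (avgMeasure (Q : Set (Fin d → ℝ))))
      (hg : ∀ Q : 𝒬, ∀ i, MemLp (g i) q' (avgMeasure (Q : Set (Fin d → ℝ)))),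
      ∑' Q : 𝒬, volume (Q : Set (Fin d → ℝ)) * ENNReal.ofReal (bodyDot
        (localBody p (Q : Set (Fin d → ℝ)) f (hf Q)) (localBody q' (Q : Set (Fin d → ℝ)) g (hg Q)))
      ≤ C * (ApConst W t ^ (t.conjExponent / r + s / r') * RHConst W t s ^ (1 / r + s / r')) *
        ((∫⁻ x, ‖matAct (matPow (W x) (1 / r)) fun i => f i x‖ₑ ^ r) ^ (1 / r) *
          (∫⁻ x, ‖matAct (matPow (W x) (-(1 / r))) fun i => g i x‖ₑ ^ r') ^ (1 / r')) := by
  subst htr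
  have hp0 : 0 < p.toReal := pos_of_mul_pos_right hr.pos (zero_lt_one.trans ht).le
  have hp1 : 1 ≤ p.toReal := (ENNReal.dichotomy p).resolve_left (ENNReal.toReal_pos_iff.1 hp0).2.ne
  have hq'1 : 1 ≤ q'.toReal :=
    (ENNReal.dichotomy q').resolve_left (ENNReal.toReal_pos_iff.1 hq'.pos').2.ne
  have hm := holderTriple_mul_conjExponent ht hp0
  obtain ⟨C₁, hC₁⟩ := exists_lintegral_maxFn_bumpExponent_le d hp1 hm
  obtain ⟨C₂, hC₂⟩ := exists_lintegral_maxFn_bumpExponent_le d hq'1 hq'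
  set r := t * p.toReal
  refine ⟨(Real.toNNReal γ)⁻¹ * n * 4 * ((2 ^ n) ^ t) ^ (1 / r) * C₁ ^ (1 / r) * C₂ ^ (1 / r'), ?_⟩
  intro B₁ B₂ _ _ _ _ 𝒟 h𝒟 W hW hA hR f g 𝒬 h𝒬 hsp hf hg
  rcases Nat.eq_zero_or_pos n with rfl | hn
  · simp only [bodyDot_fin_zero, ENNReal.ofReal_zero, mul_zero, tsum_zero, zero_le]
  have hK₁ := one_le_ApConst_rpow hn hW ht hA
  have hK₂ := one_le_ApConst_mul_RHConst_rpow hn hW ht hs hA hR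
  set A := ApConst W t
  set R := RHConst W t s
  refine (ENNReal.tsum_le_tsum fun Q => mul_le_mul_right (ofReal_bodyDot_localBody_le hd hW ht hs
    hp1 hq' hA hR hK₁ hK₂ (fun e he => sqrtReverseHolder_conjExponent hW ht hA he)
    (fun e he => sqrtReverseHolder_mul hW ht hs hA hR he)
    (subset_cubes_of_isDyadicLattice h𝒟 (h𝒬 Q.2)) (hf Q) (hg Q)) _).trans ?_
  have hlam := (isLaminar_of_isDyadicLattice hd h𝒟).mono h𝒬
  have sparse_le := tsum_sparse_le hγ hsp hlam hr (bumpExponent_pos hm hK₁)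
    (bumpExponent_pos hq' hK₂) (fun 𝒮 h𝒮 => hC₁ _ hK₁ 𝒮 _ h𝒮
      (aestronglyMeasurable_matAct hW (1 / r) fun i => (f i).aestronglyMeasurable).enorm)
    (fun 𝒮 h𝒮 => hC₂ _ hK₂ 𝒮 _ h𝒮
      (aestronglyMeasurable_matAct hW (-(1 / r)) fun i => (g i).aestronglyMeasurable).enorm)
  simp only [mul_left_comm (volume _) (_ * (_ : ℝ≥0∞)), ENNReal.tsum_mul_left]
  refine (mul_le_mul_right sparse_le _).trans_eq ?_
  have hγ0 : Real.toNNReal γ ≠ 0 := (Real.toNNReal_pos.2 hγ).ne'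
  have hA_top := ENNReal.rpow_ne_top_of_nonneg
    (Real.HolderConjugate.conjExponent ht).symm.sub_one_pos.le hA.ne
  have hAR_top := ENNReal.rpow_ne_top_of_nonneg hs.le (ENNReal.mul_ne_top hA.ne hR.ne)
  rw [ENNReal.coe_toNNReal hA_top, ENNReal.coe_toNNReal hAR_top, mul_left_comm,
    sparse_form_const_eq n hr ht hs]
  congr 2
  push_cast [ENNReal.coe_inv hγ0, ENNReal.coe_rpow_of_nonneg _ hr.one_div_nonneg,
    ENNReal.coe_rpow_of_nonneg _ hr.symm.one_div_nonneg,
    ENNReal.coe_rpow_of_nonneg _ (zero_lt_one.trans ht).le]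
  rfl

end Form

/-! ### Testing against dyadic step functions -/

section StepAverage

open Filter Topology

variable {d : ℕ} {a x : Fin d → ℝ} {ℓ M : ℝ} {b : (Fin d → ℝ) → ℝ} {B : Type*}
  [NormedAddCommGroup B] [NormedSpace ℝ B]

open Classical in
/-- The conditional expectation of `b` on the cube with corner `a` and side length `ℓ`, given its
dyadic subcubes of generation `m`; it vanishes off the cube. -/
def stepAvg (a : Fin d → ℝ) (ℓ : ℝ) (m : ℕ) (b : (Fin d → ℝ) → ℝ) (x : Fin d → ℝ) : ℝ :=
  ∑ k ∈ Fintype.piFinset fun _ : Fin d => Finset.range (2 ^ m),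
    (gridCube a ℓ m k).indicator (fun _ => ⨍ y in gridCube a ℓ m k, b y) x

theorem stepAvg_of_mem (hℓ : 0 < ℓ) (m : ℕ) (b : (Fin d → ℝ) → ℝ) (hx : x ∈ cube a ℓ) :
    stepAvg a ℓ m b x = ⨍ y in gridCube a ℓ m (gridIndex a ℓ m x), b y := by
  classical
  rw [stepAvg, Finset.sum_eq_single (gridIndex a ℓ m x)]
  · rw [Set.indicator_of_mem (mem_gridCube_gridIndex hℓ m hx)]
  · intro k _ hk
    exact Set.indicator_of_notMem (fun h => hk ((mem_gridCube_iff hℓ hx).1 h).symm) _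
  · intro index_notMem
    exact absurd (by simpa [Fintype.mem_piFinset] using gridIndex_lt hℓ m hx) index_notMem

theorem stepAvg_of_notMem (hℓ : 0 < ℓ) (m : ℕ) (b : (Fin d → ℝ) → ℝ) (hx : x ∉ cube a ℓ) :
    stepAvg a ℓ m b x = 0 := by
  refine Finset.sum_eq_zero fun k hk => Set.indicator_of_notMem (fun h => hx ?_) _
  exact gridCube_subset hℓ (by simpa [Fintype.mem_piFinset] using hk) h

theorem measurable_stepAvg (a : Fin d → ℝ) (ℓ : ℝ) (m : ℕ) (b : (Fin d → ℝ) → ℝ) :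
    Measurable (stepAvg a ℓ m b) :=
  Finset.measurable_fun_sum _ fun _ _ => measurable_const.indicator (measurableSet_cube _ _)

theorem abs_stepAvg_le (hℓ : 0 < ℓ) (m : ℕ) (hb : ∀ x, |b x| ≤ M) (x : Fin d → ℝ) :
    |stepAvg a ℓ m b x| ≤ M := by
  by_cases hx : x ∈ cube a ℓ
  · rw [stepAvg_of_mem hℓ m b hx, setAverage_eq, smul_eq_mul, abs_mul]
    set R := gridCube a ℓ m (gridIndex a ℓ m x)
    have volume_ne_top : volume R ≠ ∞ := volume_cube_ne_top _ _
    have volume_pos : 0 < volume.real R :=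
      ENNReal.toReal_pos (volume_cube_ne_zero _ (by positivity)) volume_ne_top
    rw [abs_of_pos (inv_pos.2 volume_pos), inv_mul_le_iff₀ volume_pos, mul_comm]
    exact norm_setIntegral_le_of_norm_le_const (f := b) volume_ne_top.lt_top fun y _ => hb y
  · rw [stepAvg_of_notMem hℓ m b hx, abs_zero]
    exact (abs_nonneg _).trans (hb x)

/-- The scalar functions against which a bound on step functions extends: bounded measurable
functions which vanish off the set `S`. -/
structure IsTestFunction {X : Type*} [MeasurableSpace X] (S : Set X) (b : X → ℝ) : Prop where
  measurable : Measurable b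
  exists_bound : ∃ M, ∀ x, |b x| ≤ M
  eq_zero : ∀ x ∉ S, b x = 0

theorem IsTestFunction.ae_tendsto_stepAvg (hb : IsTestFunction (cube a ℓ) b) (hℓ : 0 < ℓ) :
    ∀ᵐ x, Tendsto (fun m => stepAvg a ℓ m b x) atTop (𝓝 (b x)) := by
  obtain ⟨M, hM⟩ := hb.exists_bound
  have b_integrable : LocallyIntegrable b volume :=
    (locallyIntegrable_const M).mono hb.measurable.aestronglyMeasurable
      (Eventually.of_forall fun x => (hM x).trans (le_abs_self M))
  filter_upwards [ae_tendsto_average_gridCube a hℓ b_integrable] with x hx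
  by_cases hxQ : x ∈ cube a ℓ
  · simp only [stepAvg_of_mem hℓ _ b hxQ]
    exact hx hxQ
  · simp only [stepAvg_of_notMem hℓ _ b hxQ, hb.eq_zero x hxQ]
    exact tendsto_const_nhds

theorem exists_stepFunction {𝒟 : Set (Set (Fin d → ℝ))} (h𝒟 : ∀ Q ∈ 𝒟, MeasurableSet Q)
    {ι : Type*} (s : Finset ι) {R : ι → Set (Fin d → ℝ)} (hR : ∀ i ∈ s, R i ∈ 𝒟) (c : ι → B) :
    ∃ g ∈ stepFunctions 𝒟 B, ⇑g =ᵐ[volume] fun x => ∑ i ∈ s, (R i).indicator (fun _ => c i) x := by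
  classical
  induction s using Finset.induction_on with
  | empty => exact ⟨0, Submodule.zero_mem _, AEEqFun.coeFn_zero.trans (by simp; rfl)⟩
  | insert i s hi ih =>
    obtain ⟨g, hg, g_eq⟩ := ih fun i hi => hR i (Finset.mem_insert_of_mem hi)
    have Ri_mem := hR i (Finset.mem_insert_self i s)
    have indicator_meas : AEStronglyMeasurable ((R i).indicator fun _ => c i) volume :=
      (stronglyMeasurable_const.indicator (h𝒟 _ Ri_mem)).aestronglyMeasurable
    have indicator_mem : AEEqFun.mk _ indicator_meas ∈ stepFunctions 𝒟 B :=
      Submodule.subset_span ⟨R i, Ri_mem, c i, AEEqFun.coeFn_mk _ _⟩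
    refine ⟨AEEqFun.mk _ indicator_meas + g, Submodule.add_mem _ indicator_mem hg, ?_⟩
    filter_upwards [AEEqFun.coeFn_add (AEEqFun.mk _ indicator_meas) g,
      AEEqFun.coeFn_mk _ indicator_meas, g_eq] with x add_eq mk_eq g_eq
    rw [add_eq, Pi.add_apply, mk_eq, g_eq, Finset.sum_insert hi]

theorem exists_stepFunction_stepAvg {𝒟 : Set (Set (Fin d → ℝ))} (hd : 0 < d)
    (h𝒟 : IsDyadicLattice 𝒟) (hℓ : 0 < ℓ) (hQ : cube a ℓ ∈ 𝒟) {ι : Type*} (s : Finset ι)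
    (c : ι → B) (b : ι → (Fin d → ℝ) → ℝ) (m : ℕ) :
    ∃ g ∈ stepFunctions 𝒟 B, ⇑g =ᵐ[volume] fun x => ∑ j ∈ s, stepAvg a ℓ m (b j) x • c j := by
  classical
  obtain ⟨g, hg, g_eq⟩ := exists_stepFunction (isLaminar_of_isDyadicLattice hd h𝒟).measurableSet
    (s ×ˢ Fintype.piFinset fun _ : Fin d => Finset.range (2 ^ m))
    (R := fun z => gridCube a ℓ m z.2)
    (fun z hz => gridCube_mem_of_isDyadicLattice h𝒟 hℓ hQ
      (by simpa [Fintype.mem_piFinset] using (Finset.mem_product.1 hz).2))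
    (fun z => (⨍ y in gridCube a ℓ m z.2, b z.1 y) • c z.1)
  refine ⟨g, hg, g_eq.trans (Eventually.of_forall fun x => ?_)⟩
  simp only [Finset.sum_product, stepAvg, Finset.sum_smul]
  refine Finset.sum_congr rfl fun j _ => Finset.sum_congr rfl fun k _ => ?_
  by_cases hx : x ∈ gridCube a ℓ m k <;> simp [hx]

end StepAverage

section Extension

open Filter Topology

variable {d n : ℕ} {B : Type*} [NormedAddCommGroup B] [NormedSpace ℝ B]
  {𝒟 : Set (Set (Fin d → ℝ))} {A : (Fin d → ℝ) → Matrix (Fin n) (Fin n) ℝ} {q : ℝ}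
  {u : Fin n → ((Fin d → ℝ) →ₘ[volume] B)} {N : ℝ≥0∞} {a : Fin d → ℝ} {ℓ : ℝ}

theorem norm_matAct_le (A : Matrix (Fin n) (Fin n) ℝ) {v : Fin n → B} {M : Fin n → ℝ}
    (hv : ∀ j, ‖v j‖ ≤ M j) : ‖matAct A v‖ ≤ ∑ i, ∑ j, ‖A i j‖ * M j := by
  have matAct_eq : matAct A v = ∑ i, PiLp.single 2 i (∑ j, A i j • v j) := by
    simp only [PiLp.single, matAct, ← WithLp.toLp_sum, Finset.univ_sum_single]
  rw [matAct_eq]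
  refine (norm_sum_le _ _).trans (Finset.sum_le_sum fun i _ => ?_)
  rw [PiLp.norm_single]
  refine (norm_sum_le _ _).trans (Finset.sum_le_sum fun j _ => ?_)
  rw [norm_smul]
  gcongr
  exact hv j

theorem continuous_matAct (A : Matrix (Fin n) (Fin n) ℝ) :
    Continuous fun v : Fin n → B => matAct A v :=
  (PiLp.continuous_toLp 2 fun _ : Fin n => B).comp <| continuous_pi fun _ =>
    continuous_finsetSum _ fun j _ => (continuous_apply j).const_smul _

theorem matAct_zero (A : Matrix (Fin n) (Fin n) ℝ) : matAct A (fun _ => (0 : B)) = 0 := by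
  ext i
  simp [matAct]

/-- The dual pairing with the vector of functions `u` is defined on dyadic step functions, and on
these it is bounded by `N` in the norm of `L^q` with weight `A`. -/
structure StepPairingBound (𝒟 : Set (Set (Fin d → ℝ)))
    (A : (Fin d → ℝ) → Matrix (Fin n) (Fin n) ℝ) (q : ℝ)
    (u : Fin n → ((Fin d → ℝ) →ₘ[volume] B)) (N : ℝ≥0∞) : Prop where
  integrable : ∀ i, ∀ g ∈ stepFunctions 𝒟 (StrongDual ℝ B), Integrable (pairing (u i) g) volume
  le : ∀ g : Fin n → ((Fin d → ℝ) →ₘ[volume] StrongDual ℝ B),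
    (∀ i, g i ∈ stepFunctions 𝒟 (StrongDual ℝ B)) →
    ENNReal.ofReal |∑ i, ∫ x, pairing (u i) (g i) x| ≤
      N * (∫⁻ x, ‖matAct (A x) fun i => g i x‖ₑ ^ q) ^ (1 / q)

theorem StepPairingBound.integrableOn (h : StepPairingBound 𝒟 A q u N)
    (h𝒟 : ∀ Q ∈ 𝒟, MeasurableSet Q) {Q : Set (Fin d → ℝ)} (hQ : Q ∈ 𝒟) (i : Fin n)
    (α : StrongDual ℝ B) : IntegrableOn (fun x => α (u i x)) Q := by
  obtain ⟨g, hg, g_eq⟩ := exists_stepFunction h𝒟 (Finset.univ : Finset Unit)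
    (R := fun _ => Q) (fun _ _ => hQ) fun _ => α
  rw [← integrable_indicator_iff (h𝒟 Q hQ)]
  refine (h.integrable i g hg).congr ?_
  filter_upwards [g_eq] with x hx
  rw [pairing, hx]
  by_cases hxQ : x ∈ Q <;> simp [hxQ]

theorem IsTestFunction.integrable_mul {X : Type*} [MeasurableSpace X] {μ : Measure X} {S : Set X}
    {b φ : X → ℝ} (hb : IsTestFunction S b) (hS : MeasurableSet S) (hφ : IntegrableOn φ S μ) :
    Integrable (fun x => b x * φ x) μ := by
  obtain ⟨M, hM⟩ := hb.exists_bound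
  have eq_indicator : (fun x => b x * φ x) = fun x => b x * S.indicator φ x := by
    funext x
    by_cases hx : x ∈ S <;> simp [hx, hb.eq_zero]
  rw [eq_indicator]
  exact ((integrable_indicator_iff hS).2 hφ).bdd_mul hb.measurable.aestronglyMeasurable
    (Eventually.of_forall hM)

theorem isTestFunction_stepAvg (hℓ : 0 < ℓ) (m : ℕ) {b : (Fin d → ℝ) → ℝ}
    (hb : ∃ M, ∀ x, |b x| ≤ M) : IsTestFunction (cube a ℓ) (stepAvg a ℓ m b) where
  measurable := measurable_stepAvg a ℓ m b
  exists_bound := hb.imp fun _ hM => abs_stepAvg_le hℓ m hM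
  eq_zero _ hx := stepAvg_of_notMem hℓ m b hx

theorem IsTestFunction.tendsto_integral_stepAvg_mul {b φ : (Fin d → ℝ) → ℝ}
    (hb : IsTestFunction (cube a ℓ) b) (hℓ : 0 < ℓ) (hφ : IntegrableOn φ (cube a ℓ)) :
    Tendsto (fun m => ∫ x, stepAvg a ℓ m b x * φ x) atTop (𝓝 (∫ x, b x * φ x)) := by
  obtain ⟨M, hM⟩ := hb.exists_bound
  refine tendsto_integral_of_dominated_convergence
    (fun x => M * ‖(cube a ℓ).indicator φ x‖)
    (fun m => ((isTestFunction_stepAvg hℓ m ⟨M, hM⟩).integrable_mul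
      (measurableSet_cube a ℓ) hφ).aestronglyMeasurable)
    (((integrable_indicator_iff (measurableSet_cube a ℓ)).2 hφ).norm.const_mul M)
    (fun m => Eventually.of_forall fun x => ?_) ?_
  · by_cases hx : x ∈ cube a ℓ
    · rw [Set.indicator_of_mem hx, norm_mul]
      gcongr
      exact abs_stepAvg_le hℓ m hM x
    · simp [stepAvg_of_notMem hℓ m b hx, hx]
  · filter_upwards [hb.ae_tendsto_stepAvg hℓ] with x hx
    exact hx.mul_const _

theorem aestronglyMeasurable_matAct_sum_smul (hA : ∀ i j, AEMeasurable (fun x => A x i j) volume)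
    {ι : Type*} {s : Finset ι} (α : ι → B) {b : Fin n → ι → (Fin d → ℝ) → ℝ}
    (hb : ∀ i j, Measurable (b i j)) :
    AEStronglyMeasurable (fun x => matAct (A x) fun i => ∑ j ∈ s, b i j x • α j) volume :=
  aestronglyMeasurable_toLp fun i => Finset.aestronglyMeasurable_fun_sum _ fun k _ =>
    (hA i k).aestronglyMeasurable.smul <| Finset.aestronglyMeasurable_fun_sum _ fun j _ =>
      (hb k j).aestronglyMeasurable.smul_const (α j)

theorem norm_sum_smul_le_sum_mul_norm {ι : Type*} (s : Finset ι) (α : ι → B) {c M : ι → ℝ}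
    (hc : ∀ j, |c j| ≤ M j) : ‖∑ j ∈ s, c j • α j‖ ≤ ∑ j ∈ s, M j * ‖α j‖ := by
  refine (norm_sum_le _ _).trans (Finset.sum_le_sum fun j _ => ?_)
  rw [norm_smul]
  gcongr
  exact hc j

theorem tendsto_lintegral_matAct_stepAvg (hq : 0 < q)
    (hA : ∀ i j, AEMeasurable (fun x => A x i j) volume) (hℓ : 0 < ℓ)
    (hAQ : ∀ i j, MemLp (fun x => A x i j) (ENNReal.ofReal q) (volume.restrict (cube a ℓ)))
    {ι : Type*} (s : Finset ι) (α : ι → B) {b : Fin n → ι → (Fin d → ℝ) → ℝ}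
    (hb : ∀ i j, IsTestFunction (cube a ℓ) (b i j)) :
    Tendsto (fun m => ∫⁻ x, ‖matAct (A x) fun i => ∑ j ∈ s, stepAvg a ℓ m (b i j) x • α j‖ₑ ^ q)
      atTop (𝓝 (∫⁻ x, ‖matAct (A x) fun i => ∑ j ∈ s, b i j x • α j‖ₑ ^ q)) := by
  choose M hM using fun i j => (hb i j).exists_bound
  let D x := ∑ i, ∑ k, ‖A x i k‖ * ∑ j ∈ s, M k j * ‖α j‖
  have D_memLp : MemLp D (ENNReal.ofReal q) (volume.restrict (cube a ℓ)) :=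
    memLp_finsetSum _ fun i _ => memLp_finsetSum _ fun k _ => (hAQ i k).norm.mul_const _
  have D_lintegral : ∫⁻ x, (cube a ℓ).indicator (fun x => ‖D x‖ₑ ^ q) x ≠ ∞ := by
    rw [lintegral_indicator (measurableSet_cube a ℓ)]
    simpa [hq.le] using (lintegral_rpow_enorm_lt_top_of_eLpNorm_lt_top (by simpa using hq)
      ENNReal.ofReal_ne_top D_memLp.2).ne
  refine tendsto_lintegral_of_dominated_convergence' _ (fun m => ?_)
    (fun m => Eventually.of_forall fun x => ?_) D_lintegral ?_
  · exact (aestronglyMeasurable_matAct_sum_smul hA α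
      fun i j => measurable_stepAvg a ℓ m (b i j)).enorm.pow_const q
  · by_cases hx : x ∈ cube a ℓ
    · rw [Set.indicator_of_mem hx]
      have norm_le := norm_matAct_le (A x) fun i =>
        norm_sum_smul_le_sum_mul_norm s α fun j => abs_stepAvg_le (a := a) hℓ m (hM i j) x
      exact ENNReal.rpow_le_rpow (enorm_le_iff_norm_le.2 (norm_le.trans (le_abs_self _))) hq.le
    · simp [stepAvg_of_notMem hℓ m _ hx, matAct_zero, hq]
  · filter_upwards [ae_all_iff.2 fun i => (Finset.eventually_all s).2 fun j _ =>
      (hb i j).ae_tendsto_stepAvg hℓ] with x hx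
    exact (ENNReal.continuous_rpow_const.tendsto _).comp <| (continuous_enorm.tendsto _).comp <|
      ((continuous_matAct (A x)).tendsto _).comp <|
        tendsto_pi_nhds.2 fun i => tendsto_finsetSum _ fun j hj => (hx i j hj).smul_const _

theorem StepPairingBound.le_of_isTestFunction (h : StepPairingBound 𝒟 A q u N) (hd : 0 < d)
    (h𝒟 : IsDyadicLattice 𝒟) (hq : 0 < q) (hN : N ≠ ∞)
    (hA : ∀ i j, AEMeasurable (fun x => A x i j) volume) (hℓ : 0 < ℓ) (hQ : cube a ℓ ∈ 𝒟)
    (hAQ : ∀ i j, MemLp (fun x => A x i j) (ENNReal.ofReal q) (volume.restrict (cube a ℓ)))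
    {ι : Type*} (s : Finset ι) (α : ι → StrongDual ℝ B) {b : Fin n → ι → (Fin d → ℝ) → ℝ}
    (hb : ∀ i j, IsTestFunction (cube a ℓ) (b i j)) :
    ENNReal.ofReal |∫ x, ∑ i, ∑ j ∈ s, b i j x * α j (u i x)| ≤
      N * (∫⁻ x, ‖matAct (A x) fun i => ∑ j ∈ s, b i j x • α j‖ₑ ^ q) ^ (1 / q) := by
  have u_integrable : ∀ i j, IntegrableOn (fun x => α j (u i x)) (cube a ℓ) := fun i j =>
    h.integrableOn (isLaminar_of_isDyadicLattice hd h𝒟).measurableSet hQ i (α j)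
  have integral_eq : ∫ x, ∑ i, ∑ j ∈ s, b i j x * α j (u i x) =
      ∑ i, ∑ j ∈ s, ∫ x, b i j x * α j (u i x) := by
    have b_integrable i j := (hb i j).integrable_mul (measurableSet_cube a ℓ) (u_integrable i j)
    rw [integral_finsetSum _ fun i _ => integrable_finsetSum _ fun j _ => b_integrable i j]
    exact Finset.sum_congr rfl fun i _ => integral_finsetSum _ fun j _ => b_integrable i j
  choose g hg g_eq using fun m i => exists_stepFunction_stepAvg hd h𝒟 hℓ hQ s α (b i) m
  have pairing_eq : ∀ m, ∑ i, ∫ x, pairing (u i) (g m i) x =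
      ∑ i, ∑ j ∈ s, ∫ x, stepAvg a ℓ m (b i j) x * α j (u i x) := by
    intro m
    refine Finset.sum_congr rfl fun i _ => ?_
    rw [← integral_finsetSum _ fun j _ => (isTestFunction_stepAvg hℓ m
      (hb i j).exists_bound).integrable_mul (measurableSet_cube a ℓ) (u_integrable i j)]
    refine integral_congr_ae ?_
    filter_upwards [g_eq m i] with x hx
    simp [pairing, hx]
  have lintegral_eq : ∀ m, ∫⁻ x, ‖matAct (A x) fun i => g m i x‖ₑ ^ q =
      ∫⁻ x, ‖matAct (A x) fun i => ∑ j ∈ s, stepAvg a ℓ m (b i j) x • α j‖ₑ ^ q := by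
    intro m
    refine lintegral_congr_ae ?_
    filter_upwards [ae_all_iff.2 (g_eq m)] with x hx
    simp only [hx]
  rw [integral_eq]
  refine le_of_tendsto_of_tendsto'
    (ENNReal.tendsto_ofReal (tendsto_finsetSum _ fun i _ => tendsto_finsetSum _ fun j _ =>
      (hb i j).tendsto_integral_stepAvg_mul hℓ (u_integrable i j)).abs)
    (ENNReal.Tendsto.const_mul ((ENNReal.continuous_rpow_const.tendsto _).comp
      (tendsto_lintegral_matAct_stepAvg hq hA hℓ hAQ s α hb)) (Or.inr hN)) fun m => ?_
  simpa only [pairing_eq, lintegral_eq, Function.comp_apply] using h.le (g m) (hg m)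

end Extension

/-! ### Duality -/

section Norming

open Filter Topology

theorem exists_norming_sequence {B : Type*} [NormedAddCommGroup B] [NormedSpace ℝ B] {S : Set B}
    (hS : TopologicalSpace.IsSeparable S) :
    ∃ α : ℕ → StrongDual ℝ B, (∀ j, ‖α j‖ ≤ 1) ∧ ∀ v ∈ S, ∀ c < ‖v‖, ∃ j, c < α j v := by
  obtain ⟨D, D_countable, S_subset⟩ := hS
  obtain ⟨z, z_range⟩ := (D_countable.insert 0).exists_eq_range (Set.insert_nonempty _ _)
  choose α norm_α α_apply using fun j => exists_dual_vector'' ℝ (z j)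
  refine ⟨α, norm_α, fun v hv c hc => ?_⟩
  obtain ⟨y, hy, dist_lt⟩ := Metric.mem_closure_iff.1 (S_subset hv) ((‖v‖ - c) / 2) (by linarith)
  obtain ⟨j, rfl⟩ : y ∈ Set.range z := z_range ▸ Set.mem_insert_of_mem _ hy
  refine ⟨j, ?_⟩
  rw [dist_eq_norm] at dist_lt
  have abs_le : |α j (v - z j)| ≤ ‖v - z j‖ := by
    simpa using (α j).le_of_opNorm_le (norm_α j) (v - z j)
  calc c < ‖v‖ - ‖v - z j‖ - ‖v - z j‖ := by linarith
    _ ≤ ‖z j‖ - ‖v - z j‖ := by linarith [norm_sub_norm_le v (z j)]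
    _ ≤ α j (z j) + α j (v - z j) := by
      rw [α_apply]
      exact add_le_add le_rfl (neg_le_of_abs_le abs_le)
    _ = α j v := by rw [← map_add, add_sub_cancel]

theorem exists_measurable_almost_norming {X B : Type*} [MeasurableSpace X] [NormedAddCommGroup B]
    [NormedSpace ℝ B] {v : X → B} (hv : StronglyMeasurable v) {c : ℝ} (hc : c < 1) :
    ∃ (α : ℕ → StrongDual ℝ B) (J : X → ℕ), (∀ j, ‖α j‖ ≤ 1) ∧ Measurable J ∧
      ∀ x, c * ‖v x‖ ≤ α (J x) (v x) := by
  classical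
  obtain ⟨α, norm_α, α_norming⟩ := exists_norming_sequence hv.isSeparable_range
  have exists_index : ∀ x, ∃ j, c * ‖v x‖ ≤ α j (v x) := by
    intro x
    rcases eq_or_ne (v x) 0 with v_zero | v_ne
    · exact ⟨0, by simp [v_zero]⟩
    · have lt_norm : c * ‖v x‖ < ‖v x‖ := mul_lt_of_lt_one_left (norm_pos_iff.2 v_ne) hc
      exact (α_norming _ (Set.mem_range_self x) _ lt_norm).imp fun _ => le_of_lt
  refine ⟨α, fun x => Nat.find (exists_index x), norm_α,
    measurable_find exists_index fun j => ?_, fun x => Nat.find_spec (exists_index x)⟩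
  exact measurableSet_le (hv.norm.measurable.const_mul c)
    ((α j).continuous.comp_stronglyMeasurable hv).measurable

theorem le_rpow_of_le_mul_rpow {r r' : ℝ} (hr : r.HolderConjugate r') {I N : ℝ≥0∞} (hI : I ≠ ∞)
    (h : I ≤ N * I ^ (1 / r')) : I ≤ N ^ r := by
  rcases eq_or_ne I 0 with rfl | hI0
  · exact zero_le
  have I_eq : I ^ (1 / r) * I ^ (1 / r') = I := by
    rw [← ENNReal.rpow_add _ _ hI0 hI, hr.one_div_add_one_div, one_div_one, ENNReal.rpow_one]
  have rpow_ne_zero : I ^ (1 / r') ≠ 0 := (ENNReal.rpow_pos (pos_iff_ne_zero.2 hI0) hI).ne'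
  have rpow_ne_top : I ^ (1 / r') ≠ ∞ := ENNReal.rpow_ne_top_of_nonneg hr.symm.one_div_nonneg hI
  rw [← ENNReal.rpow_inv_le_iff hr.pos, ← one_div]
  exact (ENNReal.mul_le_mul_iff_left rpow_ne_zero rpow_ne_top).1 (I_eq.le.trans h)

theorem sum_indicator_preimage_smul {X ι V : Type*} [AddCommMonoid V] [Module ℝ V]
    {J : X → ι} (s : Finset ι) (φ : X → ℝ) (α : ι → V) {x : X} (hx : φ x ≠ 0 → J x ∈ s) :
    ∑ j ∈ s, (J ⁻¹' {j}).indicator φ x • α j = φ x • α (J x) := by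
  classical
  rw [Finset.sum_eq_single (J x)]
  · rw [Set.indicator_of_mem (s := J ⁻¹' {J x}) rfl]
  · intro j _ hj
    rw [Set.indicator_of_notMem (fun h => hj h.symm), zero_smul]
  · intro J_notMem
    rw [Set.indicator_of_mem (s := J ⁻¹' {J x}) rfl, not_not.1 (mt hx J_notMem), zero_smul]

theorem IsTestFunction.indicator {X : Type*} [MeasurableSpace X] {S Z : Set X} {b : X → ℝ}
    (hb : IsTestFunction S b) (hZ : MeasurableSet Z) : IsTestFunction S (Z.indicator b) where
  measurable := hb.measurable.indicator hZ
  exists_bound := hb.exists_bound.imp fun _ hM x =>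
    (norm_indicator_le_norm_self b x).trans (hM x)
  eq_zero x hx := Set.indicator_apply_eq_zero.2 fun _ => hb.eq_zero x hx

theorem enorm_matAct_smul_le {n : ℕ} {B : Type*} [NormedAddCommGroup B] [NormedSpace ℝ B]
    {A w : Matrix (Fin n) (Fin n) ℝ} (hAw : A * w = 1) (k : Fin n) (c : ℝ) {β : B} (hβ : ‖β‖ ≤ 1) :
    ‖matAct A fun i => (c * w i k) • β‖ₑ ≤ ‖c‖ₑ := by
  have matAct_eq : (matAct A fun i => (c * w i k) • β) = PiLp.single 2 k (c • β) := by
    ext l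
    calc ∑ i, A l i • (c * w i k) • β = ((A * w) l k * c) • β := by
          simp only [Matrix.mul_apply, Finset.sum_mul, Finset.sum_smul, smul_smul]
          exact Finset.sum_congr rfl fun i _ => by ring_nf
      _ = (PiLp.single 2 k (c • β) : PiLp 2 fun _ : Fin n => B) l := by
          rcases eq_or_ne l k with rfl | hlk
          · simp [hAw]
          · simp [hAw, hlk]
  rw [matAct_eq, enorm_le_iff_norm_le, PiLp.norm_single, norm_smul]
  exact mul_le_of_le_one_right (norm_nonneg c) hβ

theorem isTestFunction_indicator_rpow_mul {X : Type*} [MeasurableSpace X] {S w : X → ℝ}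
    {Q Z : Set X} {p m : ℝ} (hp : 0 ≤ p) (hS : Measurable S) (hS0 : ∀ x, 0 ≤ S x)
    (hw : Measurable w) (hZ : MeasurableSet Z) (hZQ : Z ⊆ Q)
    (hZm : ∀ x ∈ Z, S x ≤ m ∧ |w x| ≤ m) :
    IsTestFunction Q fun x => Z.indicator (fun y => S y ^ p) x * w x where
  measurable := ((hS.pow_const _).indicator hZ).mul hw
  exists_bound := by
    refine ⟨|m ^ p * m|, fun x => ?_⟩
    by_cases hx : x ∈ Z
    · obtain ⟨S_le, w_le⟩ := hZm x hx
      rw [Set.indicator_of_mem hx, abs_mul, abs_of_nonneg (Real.rpow_nonneg (hS0 x) _)]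
      exact (mul_le_mul (Real.rpow_le_rpow (hS0 x) S_le hp) w_le (abs_nonneg _)
        (Real.rpow_nonneg ((hS0 x).trans S_le) _)).trans (le_abs_self _)
    · rw [Set.indicator_of_notMem hx, zero_mul, abs_zero]
      exact abs_nonneg _
  eq_zero x hx := by rw [Set.indicator_of_notMem fun hxZ => hx (hZQ hxZ), zero_mul]

theorem ofReal_abs_integral_indicator_rpow_mul {X : Type*} [MeasurableSpace X] {μ : Measure X}
    {r r' : ℝ} (hr : r.HolderConjugate r') {S : X → ℝ} (hS : Measurable S) (hS0 : ∀ x, 0 ≤ S x)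
    {Z : Set X} (hZ : MeasurableSet Z) (h : ∫⁻ x in Z, ENNReal.ofReal (S x) ^ r ∂μ ≠ ∞) :
    ENNReal.ofReal |∫ x, Z.indicator (fun y => S y ^ (r - 1)) x * S x ∂μ| =
      ∫⁻ x in Z, ENNReal.ofReal (S x) ^ r ∂μ := by
  have rpow_nonneg : ∀ x, 0 ≤ S x ^ r := fun x => Real.rpow_nonneg (hS0 x) r
  have indicator_mul : (fun x => Z.indicator (fun y => S y ^ (r - 1)) x * S x) =
      Z.indicator fun x => S x ^ r := by
    funext x
    rw [← Set.indicator_mul_left]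
    congr 1
    funext y
    rcases (hS0 y).eq_or_lt with S_zero | S_pos
    · rw [← S_zero, mul_zero, Real.zero_rpow hr.ne_zero]
    · rw [← Real.rpow_add_one S_pos.ne', sub_add_cancel]
  rw [indicator_mul, integral_indicator hZ, abs_of_nonneg (integral_nonneg rpow_nonneg),
    integral_eq_lintegral_of_nonneg_ae (Eventually.of_forall rpow_nonneg)
      (hS.pow_const _).aestronglyMeasurable]
  simp only [← ENNReal.ofReal_rpow_of_nonneg (hS0 _) hr.nonneg]
  exact ENNReal.ofReal_toReal h

theorem lintegral_enorm_indicator_rpow {X : Type*} [MeasurableSpace X] {μ : Measure X}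
    {r r' : ℝ} (hr : r.HolderConjugate r') {S : X → ℝ} (hS0 : ∀ x, 0 ≤ S x)
    {Z : Set X} (hZ : MeasurableSet Z) :
    ∫⁻ x, ‖Z.indicator (fun y => S y ^ (r - 1)) x‖ₑ ^ r' ∂μ =
      ∫⁻ x in Z, ENNReal.ofReal (S x) ^ r ∂μ := by
  rw [← lintegral_indicator hZ]
  refine lintegral_congr fun x => ?_
  by_cases hx : x ∈ Z
  · rw [Set.indicator_of_mem hx, Set.indicator_of_mem hx,
      Real.enorm_of_nonneg (Real.rpow_nonneg (hS0 x) _),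
      ← ENNReal.ofReal_rpow_of_nonneg (hS0 x) (sub_nonneg.2 hr.lt.le), ← ENNReal.rpow_mul,
      hr.sub_one_mul_conj]
  · rw [Set.indicator_of_notMem hx, Set.indicator_of_notMem hx, enorm_zero,
      ENNReal.zero_rpow_of_pos hr.symm.pos]

end Norming

section Duality

open Filter Topology

variable {d n : ℕ} {B : Type*} [NormedAddCommGroup B] [NormedSpace ℝ B]
  {𝒟 : Set (Set (Fin d → ℝ))} {r r' : ℝ} {A w : (Fin d → ℝ) → Matrix (Fin n) (Fin n) ℝ}
  {u : Fin n → ((Fin d → ℝ) →ₘ[volume] B)} {N : ℝ≥0∞}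

theorem StepPairingBound.ofReal_abs_integral_mul_le {q : ℝ} (h : StepPairingBound 𝒟 A q u N)
    (hd : 0 < d) (h𝒟 : IsDyadicLattice 𝒟) (hq : 0 < q) (hN : N ≠ ∞)
    (hA : ∀ i j, AEMeasurable (fun x => A x i j) volume) {a : Fin d → ℝ} {ℓ : ℝ} (hℓ : 0 < ℓ)
    (hQ : cube a ℓ ∈ 𝒟)
    (hAQ : ∀ i j, MemLp (fun x => A x i j) (ENNReal.ofReal q) (volume.restrict (cube a ℓ)))
    (hAw : ∀ᵐ x, A x * w x = 1) (k : Fin n) {α : ℕ → StrongDual ℝ B} (hα : ∀ j, ‖α j‖ ≤ 1)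
    {J : (Fin d → ℝ) → ℕ} (hJ : Measurable J) {φ : (Fin d → ℝ) → ℝ} (s : Finset ℕ)
    (hJs : ∀ x, φ x ≠ 0 → J x ∈ s)
    (hφ : ∀ i, IsTestFunction (cube a ℓ) fun x => φ x * w x i k) :
    ENNReal.ofReal |∫ x, φ x * α (J x) (∑ i, w x i k • u i x)| ≤
      N * (∫⁻ x, ‖φ x‖ₑ ^ q) ^ (1 / q) := by
  let b i j := (J ⁻¹' {j}).indicator fun x => φ x * w x i k
  have sum_b_smul : ∀ i x, ∑ j ∈ s, b i j x • α j = (φ x * w x i k) • α (J x) := fun i x =>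
    sum_indicator_preimage_smul s _ α fun hne => hJs x (left_ne_zero_of_mul hne)
  have sum_b_apply : ∀ x, ∑ i, ∑ j ∈ s, b i j x * α j (u i x) =
      φ x * α (J x) (∑ i, w x i k • u i x) := by
    intro x
    rw [map_sum, Finset.mul_sum]
    refine Finset.sum_congr rfl fun i _ => ?_
    simpa [mul_assoc] using congrArg (fun β : StrongDual ℝ B => β (u i x)) (sum_b_smul i x)
  have b_test : ∀ i j, IsTestFunction (cube a ℓ) (b i j) := fun i j =>
    (hφ i).indicator (hJ (measurableSet_singleton j))
  have b_bound := h.le_of_isTestFunction hd h𝒟 hq hN hA hℓ hQ hAQ s α b_test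
  simp only [sum_b_apply, sum_b_smul] at b_bound
  refine b_bound.trans ?_
  gcongr N * ?_ ^ _
  refine lintegral_mono_ae ?_
  filter_upwards [hAw] with x hx
  exact ENNReal.rpow_le_rpow (enorm_matAct_smul_le hx k _ (hα _)) hq.le

theorem StepPairingBound.setLIntegral_rpow_le (h : StepPairingBound 𝒟 A r' u N)
    (hd : 0 < d) (h𝒟 : IsDyadicLattice 𝒟) (hr : r.HolderConjugate r') (hN : N ≠ ∞)
    (hA : ∀ i j, AEMeasurable (fun x => A x i j) volume)
    (hAQ : ∀ Q ∈ cubes d, ∀ i j,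
      MemLp (fun x => A x i j) (ENNReal.ofReal r') (volume.restrict Q))
    (hw : ∀ i j, Measurable fun x => w x i j) (hAw : ∀ᵐ x, A x * w x = 1) (k : Fin n)
    {α : ℕ → StrongDual ℝ B} (hα : ∀ j, ‖α j‖ ≤ 1) {J : (Fin d → ℝ) → ℕ} (hJ : Measurable J)
    {S : (Fin d → ℝ) → ℝ} (hS : Measurable S)
    (hS_eq : ∀ x, S x = α (J x) (∑ i, w x i k • u i x)) (hS0 : ∀ x, 0 ≤ S x)
    {Q Z : Set (Fin d → ℝ)} (hQ : Q ∈ 𝒟) (hZ : MeasurableSet Z) (hZQ : Z ⊆ Q) (m : ℕ)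
    (hZm : ∀ x ∈ Z, S x ≤ m ∧ J x ≤ m ∧ ∀ i, |w x i k| ≤ m) :
    ∫⁻ x in Z, ENNReal.ofReal (S x) ^ r ≤ N ^ r := by
  obtain ⟨a, ℓ, hℓ, rfl⟩ := subset_cubes_of_isDyadicLattice h𝒟 hQ
  have lintegral_ne_top : ∫⁻ x in Z, ENNReal.ofReal (S x) ^ r ≠ ∞ := by
    have volume_ne_top : volume Z ≠ ∞ := measure_ne_top_of_subset hZQ (volume_cube_ne_top a ℓ)
    refine (setLIntegral_lt_top_of_le_nnreal volume_ne_top ⟨(m : ℝ≥0) ^ r, fun x hx => ?_⟩).ne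
    rw [ENNReal.coe_rpow_of_nonneg _ hr.nonneg]
    exact ENNReal.rpow_le_rpow (ENNReal.ofReal_le_of_le_toReal (hZm x hx).1) hr.nonneg
  have J_mem : ∀ x, Z.indicator (fun y => S y ^ (r - 1)) x ≠ 0 → J x ∈ Finset.range (m + 1) :=
    fun x hx => Finset.mem_range_succ_iff.2 (hZm x (Set.mem_of_indicator_ne_zero hx)).2.1
  have φ_test : ∀ i, IsTestFunction (cube a ℓ)
      fun x => Z.indicator (fun y => S y ^ (r - 1)) x * w x i k := fun i =>
    isTestFunction_indicator_rpow_mul (sub_nonneg.2 hr.lt.le) hS hS0 (hw i k) hZ hZQ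
      fun x hx => ⟨(hZm x hx).1, (hZm x hx).2.2 i⟩
  have pairing_le := h.ofReal_abs_integral_mul_le hd h𝒟 hr.symm.pos hN hA hℓ hQ
    (hAQ _ ⟨a, ℓ, hℓ, rfl⟩) hAw k hα hJ (Finset.range (m + 1)) J_mem φ_test
  simp only [← hS_eq] at pairing_le
  rw [ofReal_abs_integral_indicator_rpow_mul hr hS hS0 hZ lintegral_ne_top,
    lintegral_enorm_indicator_rpow hr hS0 hZ] at pairing_le
  exact le_rpow_of_le_mul_rpow hr lintegral_ne_top pairing_le

theorem exists_measurableSet_sequence_of_isDyadicLattice (hd : 0 < d) (h𝒟 : IsDyadicLattice 𝒟)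
    {φ : (Fin d → ℝ) → ℝ} (hφ : Measurable φ) :
    ∃ Q Z : ℕ → Set (Fin d → ℝ), (∀ m, Q m ∈ 𝒟) ∧ (∀ m, Z m ⊆ Q m) ∧
      (∀ m, ∀ x ∈ Z m, φ x ≤ m) ∧ AECover volume atTop Z := by
  choose Q hQ subset_Q using fun m : ℕ =>
    h𝒟.compact_subset _ (isCompact_closedBall (0 : Fin d → ℝ) m)
  refine ⟨Q, fun m => Q m ∩ {x | φ x ≤ m}, hQ, fun m => Set.inter_subset_left,
    fun m x hx => hx.2, ?_, fun m => ?_⟩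
  · refine Eventually.of_forall fun x => ?_
    filter_upwards [tendsto_natCast_atTop_atTop.eventually_ge_atTop ‖x‖,
      tendsto_natCast_atTop_atTop.eventually_ge_atTop (φ x)] with m norm_le φ_le
    exact ⟨subset_Q m (mem_closedBall_zero_iff.2 norm_le), φ_le⟩
  · exact ((isLaminar_of_isDyadicLattice hd h𝒟).measurableSet _ (hQ m)).inter
      (measurableSet_le hφ measurable_const)

theorem StepPairingBound.lintegral_rpow_le (h : StepPairingBound 𝒟 A r' u N)
    (hd : 0 < d) (h𝒟 : IsDyadicLattice 𝒟) (hr : r.HolderConjugate r') (hN : N ≠ ∞)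
    (hA : ∀ i j, AEMeasurable (fun x => A x i j) volume)
    (hAQ : ∀ Q ∈ cubes d, ∀ i j,
      MemLp (fun x => A x i j) (ENNReal.ofReal r') (volume.restrict Q))
    (hw : ∀ i j, Measurable fun x => w x i j) (hAw : ∀ᵐ x, A x * w x = 1) (k : Fin n)
    {α : ℕ → StrongDual ℝ B} (hα : ∀ j, ‖α j‖ ≤ 1) {J : (Fin d → ℝ) → ℕ} (hJ : Measurable J)
    {S : (Fin d → ℝ) → ℝ} (hS : Measurable S)
    (hS_eq : ∀ x, S x = α (J x) (∑ i, w x i k • u i x)) (hS0 : ∀ x, 0 ≤ S x) :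
    ∫⁻ x, ENNReal.ofReal (S x) ^ r ≤ N ^ r := by
  let φ x := S x + J x + ∑ i, |w x i k|
  have φ_measurable : Measurable φ :=
    (hS.add (measurable_from_top.comp hJ)).add
      (Finset.measurable_fun_sum _ fun i _ => (hw i k).abs)
  have le_φ : ∀ x, S x ≤ φ x ∧ J x ≤ φ x ∧ ∀ i, |w x i k| ≤ φ x := by
    intro x
    have sum_nonneg : 0 ≤ ∑ i, |w x i k| := Finset.sum_nonneg fun i _ => abs_nonneg _
    have le_sum : ∀ i, |w x i k| ≤ ∑ i, |w x i k| := fun i =>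
      Finset.single_le_sum (f := fun i => |w x i k|) (fun i _ => abs_nonneg _) (Finset.mem_univ i)
    have J_nonneg : (0 : ℝ) ≤ J x := Nat.cast_nonneg _
    exact ⟨by linarith only [sum_nonneg, J_nonneg], by linarith only [sum_nonneg, hS0 x],
      fun i => by linarith only [le_sum i, J_nonneg, hS0 x]⟩
  obtain ⟨Q, Z, hQ, Z_subset, φ_le, Z_cover⟩ :=
    exists_measurableSet_sequence_of_isDyadicLattice hd h𝒟 φ_measurable
  refine le_of_tendsto' (Z_cover.lintegral_tendsto_of_countably_generated
    (hS.ennreal_ofReal.pow_const r).aemeasurable) fun m => ?_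
  exact h.setLIntegral_rpow_le hd h𝒟 hr hN hA hAQ hw hAw k hα hJ hS hS_eq hS0 (hQ m)
    (Z_cover.measurableSet m) (Z_subset m) m fun x hx =>
      ⟨(le_φ x).1.trans (φ_le m x hx), by exact_mod_cast (le_φ x).2.1.trans (φ_le m x hx),
        fun i => ((le_φ x).2.2 i).trans (φ_le m x hx)⟩

theorem StepPairingBound.eLpNorm_sum_smul_le (h : StepPairingBound 𝒟 A r' u N)
    (hd : 0 < d) (h𝒟 : IsDyadicLattice 𝒟) (hr : r.HolderConjugate r') (hN : N ≠ ∞)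
    (hA : ∀ i j, AEMeasurable (fun x => A x i j) volume)
    (hAQ : ∀ Q ∈ cubes d, ∀ i j,
      MemLp (fun x => A x i j) (ENNReal.ofReal r') (volume.restrict Q))
    (hw : ∀ i j, Measurable fun x => w x i j) (hAw : ∀ᵐ x, A x * w x = 1) (k : Fin n) :
    eLpNorm (fun x => ∑ i, w x i k • u i x) (ENNReal.ofReal r) volume ≤ N := by
  let v x := ∑ i, w x i k • u i x
  have v_measurable : StronglyMeasurable v := Finset.stronglyMeasurable_fun_sum _ fun i _ =>
    (hw i k).stronglyMeasurable.smul (u i).stronglyMeasurable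
  refine ENNReal.le_of_forall_lt_one_mul_le fun c hc => ?_
  lift c to ℝ≥0 using (hc.trans ENNReal.one_lt_top).ne
  obtain ⟨α, J, hα, hJ, le_apply⟩ :=
    exists_measurable_almost_norming v_measurable (c := c) (by exact_mod_cast hc)
  let S x := α (J x) (v x)
  have S_measurable : Measurable S := by
    have uncurry_measurable : Measurable fun y : ℕ × (Fin d → ℝ) => α y.1 (v y.2) :=
      measurable_from_prod_countable_right fun j =>
        ((α j).continuous.comp_stronglyMeasurable v_measurable).measurable
    exact uncurry_measurable.comp (hJ.prodMk measurable_id)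
  have S_nonneg : ∀ x, 0 ≤ S x := fun x =>
    (mul_nonneg c.coe_nonneg (norm_nonneg _)).trans (le_apply x)
  have lintegral_le := h.lintegral_rpow_le hd h𝒟 hr hN hA hAQ hw hAw k hα hJ S_measurable
    (fun _ => rfl) S_nonneg
  calc (c : ℝ≥0∞) * eLpNorm v (ENNReal.ofReal r) volume
      = eLpNorm (fun x => (c : ℝ) • v x) (ENNReal.ofReal r) volume := by
        rw [show (fun x => (c : ℝ) • v x) = (c : ℝ) • v from rfl, eLpNorm_const_smul,
          Real.enorm_of_nonneg c.coe_nonneg, ENNReal.ofReal_coe_nnreal]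
    _ ≤ eLpNorm S (ENNReal.ofReal r) volume := by
        refine eLpNorm_mono_real fun x => ?_
        rw [norm_smul, Real.norm_of_nonneg c.coe_nonneg]
        exact le_apply x
    _ = (∫⁻ x, ENNReal.ofReal (S x) ^ r) ^ (1 / r) := by
        rw [eLpNorm_eq_lintegral_rpow_enorm_toReal (by simpa using hr.pos) ENNReal.ofReal_ne_top,
          ENNReal.toReal_ofReal hr.nonneg]
        simp only [Real.enorm_of_nonneg (S_nonneg _)]
    _ ≤ N := by rwa [one_div, ENNReal.rpow_inv_le_iff hr.pos]

theorem StepPairingBound.eLpNorm_matAct_le (h : StepPairingBound 𝒟 A r' u N)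
    (hd : 0 < d) (h𝒟 : IsDyadicLattice 𝒟) (hr : r.HolderConjugate r') (hN : N ≠ ∞)
    (hA : ∀ i j, AEMeasurable (fun x => A x i j) volume)
    (hAQ : ∀ Q ∈ cubes d, ∀ i j,
      MemLp (fun x => A x i j) (ENNReal.ofReal r') (volume.restrict Q))
    (hw : ∀ i j, AEMeasurable (fun x => w x i j) volume) (hAw : ∀ᵐ x, A x * w x = 1)
    (hsymm : ∀ᵐ x, ∀ i j, w x i j = w x j i) :
    eLpNorm (fun x => matAct (w x) fun i => u i x) (ENNReal.ofReal r) volume ≤ n * N := by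
  obtain ⟨w', hw', w_ae_eq⟩ : ∃ w' : (Fin d → ℝ) → Matrix (Fin n) (Fin n) ℝ,
      (∀ i j, Measurable fun x => w' x i j) ∧ ∀ᵐ x, w x = w' x := by
    refine ⟨fun x => Matrix.of fun i j => (hw i j).mk _ x, fun i j => (hw i j).measurable_mk, ?_⟩
    filter_upwards [ae_all_iff.2 fun i => ae_all_iff.2 fun j => (hw i j).ae_eq_mk] with x hx
    ext i j
    exact hx i j
  have hAw' : ∀ᵐ x, A x * w' x = 1 := by
    filter_upwards [hAw, w_ae_eq] with x A_mul_eq w_eq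
    rw [← w_eq, A_mul_eq]
  let v k x := ∑ i, w' x i k • u i x
  have v_bound : ∀ k, eLpNorm (v k) (ENNReal.ofReal r) volume ≤ N :=
    h.eLpNorm_sum_smul_le hd h𝒟 hr hN hA hAQ hw' hAw'
  have v_aestronglyMeasurable : ∀ k, AEStronglyMeasurable (v k) volume := fun k =>
    Finset.aestronglyMeasurable_fun_sum _ fun i _ =>
      (hw' i k).aestronglyMeasurable.smul (u i).aestronglyMeasurable
  let e k x : PiLp 2 fun _ : Fin n => B := PiLp.single 2 k (v k x)
  have e_aestronglyMeasurable : ∀ k, AEStronglyMeasurable (e k) volume := fun k =>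
    ((PiLp.continuous_toLp 2 _).comp (continuous_single k)).comp_aestronglyMeasurable
      (v_aestronglyMeasurable k)
  have e_bound : ∀ k, eLpNorm (e k) (ENNReal.ofReal r) volume ≤ N := fun k => by
    have norm_e : ∀ x, ‖e k x‖ = ‖v k x‖ := fun x => PiLp.norm_single 2 _ k _
    exact (eLpNorm_congr_norm_ae (.of_forall norm_e)).trans_le (v_bound k)
  have matAct_ae_eq : (fun x => matAct (w x) fun i => u i x) =ᵐ[volume] ∑ k, e k := by
    filter_upwards [hsymm, w_ae_eq] with x w_symm w_eq
    rw [Finset.sum_apply]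
    simp only [PiLp.single, matAct, ← WithLp.toLp_sum, Finset.univ_sum_single, e, v, ← w_eq]
    congr 1
    funext l
    exact Finset.sum_congr rfl fun i _ => by rw [w_symm l i]
  calc eLpNorm (fun x => matAct (w x) fun i => u i x) (ENNReal.ofReal r) volume
      = eLpNorm (∑ k, e k) (ENNReal.ofReal r) volume := eLpNorm_congr_ae matAct_ae_eq
    _ ≤ ∑ k, eLpNorm (e k) (ENNReal.ofReal r) volume :=
        eLpNorm_sum_le (fun k _ => e_aestronglyMeasurable k) (by simpa using hr.lt.le)
    _ ≤ ∑ _k : Fin n, N := Finset.sum_le_sum fun k _ => e_bound k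
    _ = n * N := by simp

end Duality

/-! ### Local integrability of the dual weight -/

section DualWeight

open Matrix

variable {d n : ℕ} {W : (Fin d → ℝ) → Matrix (Fin n) (Fin n) ℝ} {r r' t : ℝ}

theorem conjugate_le_conjugate {t' : ℝ} (ht : t.HolderConjugate t') (hr : r.HolderConjugate r')
    (htr : t ≤ r) : r' ≤ t' := by
  rw [ht.conjugate_eq, hr.conjugate_eq, div_le_div_iff₀ hr.sub_one_pos ht.sub_one_pos]
  linarith

theorem enorm_apply_le_normMulVec (A : Matrix (Fin n) (Fin n) ℝ) (i j : Fin n) :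
    ‖A i j‖ₑ ≤ normMulVec A (EuclideanSpace.single j 1) := by
  have apply_eq : A i j = toEuclideanCLM (n := Fin n) (𝕜 := ℝ) A (EuclideanSpace.single j 1) i := by
    simp [toEuclideanCLM_apply_apply]
  rw [apply_eq, normMulVec, enorm_le_iff_norm_le]
  exact PiLp.norm_apply_le _ i

theorem enorm_matPow_neg_apply_rpow_le (hr : r.HolderConjugate r') (ht : 1 < t) (htr : t ≤ r)
    {A : Matrix (Fin n) (Fin n) ℝ} (hA : A.PosDef) (i j : Fin n) :
    ‖matPow A (-(1 / r)) i j‖ₑ ^ r' ≤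
      1 + normMulVec (matPow A (-(1 / t))) (EuclideanSpace.single j 1) ^ t.conjExponent := by
  have conj := Real.HolderConjugate.conjExponent ht
  set x := normMulVec (matPow A (-(1 / t))) (EuclideanSpace.single j 1)
  have ratio_nonneg : 0 ≤ t / r := div_nonneg conj.nonneg hr.nonneg
  have ratio_le_one : t / r ≤ 1 := (div_le_one hr.pos).2 htr
  have neg_one_div_eq : -(1 / r) = -(1 / t) * (t / r) := by
    have := conj.ne_zero
    field_simp
  have exponent_le : t / r * r' ≤ t.conjExponent :=
    (mul_le_of_le_one_left hr.symm.nonneg ratio_le_one).trans (conjugate_le_conjugate conj hr htr)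
  have entry_le : ‖matPow A (-(1 / r)) i j‖ₑ ≤ x ^ (t / r) := by
    rw [neg_one_div_eq]
    exact (enorm_apply_le_normMulVec _ i j).trans
      (normMulVec_matPow_mul_le hA _ ratio_nonneg ratio_le_one (by simp))
  calc ‖matPow A (-(1 / r)) i j‖ₑ ^ r' ≤ (x ^ (t / r)) ^ r' :=
        ENNReal.rpow_le_rpow entry_le hr.symm.nonneg
    _ = x ^ (t / r * r') := (ENNReal.rpow_mul _ _ _).symm
    _ ≤ 1 + x ^ t.conjExponent := by
        rcases le_total x 1 with x_le | le_x
        · exact (ENNReal.rpow_le_one x_le (mul_nonneg ratio_nonneg hr.symm.nonneg)).trans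
            le_self_add
        · exact (ENNReal.rpow_le_rpow_of_exponent_le le_x exponent_le).trans le_add_self

theorem memLp_matPow_neg_apply (hW : IsMatrixWeight W) (hr : r.HolderConjugate r') (ht : 1 < t)
    (htr : t ≤ r) (hA : ApConst W t < ∞) {Q : Set (Fin d → ℝ)} (hQ : Q ∈ cubes d) (i j : Fin n) :
    MemLp (fun x => matPow (W x) (-(1 / r)) i j) (ENNReal.ofReal r') (volume.restrict Q) := by
  have := isProbabilityMeasure_avgMeasure hQ
  have avg_ne_top : ∫⁻ x, ‖matPow (W x) (-(1 / r)) i j‖ₑ ^ r' ∂avgMeasure Q ≠ ∞ := by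
    refine ne_top_of_le_ne_top ?_ (lintegral_mono_ae ((ae_posDef_avgMeasure hW Q).mono
      fun x hx => enorm_matPow_neg_apply_rpow_le hr ht htr hx i j))
    rw [lintegral_add_left measurable_const, lintegral_one, measure_univ]
    exact ENNReal.add_ne_top.2 ⟨ENNReal.one_ne_top, dirMoment_conjExponent_ne_top hW ht hA hQ _⟩
  refine ⟨(aemeasurable_matPow_of_isMatrixWeight hW _ i j).aestronglyMeasurable.restrict, ?_⟩
  rw [eLpNorm_lt_top_iff_lintegral_rpow_enorm_lt_top (by simpa using hr.symm.pos)
    ENNReal.ofReal_ne_top, ENNReal.toReal_ofReal hr.symm.nonneg]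
  exact (setLIntegral_ne_top_of_lintegral_avgMeasure hQ avg_ne_top).lt_top

end DualWeight

/-! ### Exponents -/

section Exponents

variable {p q q' : ℝ≥0∞} {r : ℝ≥0}

theorem one_lt_coe_div_toReal [Fact (1 ≤ p)] (hpr : p < r) : 1 < r / p.toReal := by
  have one_le : 1 ≤ p.toReal := (ENNReal.dichotomy p).resolve_left hpr.ne_top
  rw [one_lt_div (one_pos.trans_le one_le)]
  exact (ENNReal.toReal_lt_toReal hpr.ne_top ENNReal.coe_ne_top).2 hpr

theorem toReal_inv_add_toReal_inv (h : q.HolderConjugate q') : q.toReal⁻¹ + q'.toReal⁻¹ = 1 := by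
  have inv_add_inv := h.inv_add_inv_eq_one
  have inv_add_inv_ne_top : q⁻¹ + q'⁻¹ ≠ ∞ := inv_add_inv.symm ▸ ENNReal.one_ne_top
  obtain ⟨inv_ne_top, inv_ne_top'⟩ := ENNReal.add_ne_top.1 inv_add_inv_ne_top
  rw [← ENNReal.toReal_inv, ← ENNReal.toReal_inv, ← ENNReal.toReal_add inv_ne_top inv_ne_top',
    inv_add_inv, ENNReal.toReal_one]

theorem toReal_conjExponent_pos (hq : 1 < q) : 0 < q.conjExponent.toReal := by
  have conj := ENNReal.HolderConjugate.conjExponent hq.le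
  have lt_top : q.conjExponent < ∞ := (ENNReal.HolderConjugate.lt_top_iff_one_lt _ q).2 hq
  exact ENNReal.toReal_pos (ENNReal.HolderConjugate.ne_zero _ q) lt_top.ne

theorem one_lt_div_coe (hr : r ≠ 0) (hrq : r < q) : 1 < q / r := by
  rwa [ENNReal.lt_div_iff_mul_lt (.inl (by exact_mod_cast hr)) (.inl ENNReal.coe_ne_top), one_mul]

theorem holderTriple_mul_toReal_conjExponent (hqq' : q.HolderConjugate q') (hr : 1 < r)
    (hrq : r < q) :
    (r * (q / r).conjExponent.toReal).HolderTriple (r : ℝ).conjExponent q'.toReal := by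
  have r_pos : 0 < r := one_pos.trans hr
  have one_lt_div := one_lt_div_coe r_pos.ne' hrq
  have r_conj : (r : ℝ).HolderConjugate (r : ℝ).conjExponent := .conjExponent (by exact_mod_cast hr)
  refine ⟨?_, mul_pos (by exact_mod_cast r_pos) (toReal_conjExponent_pos one_lt_div),
    r_conj.symm.pos⟩
  have div_inv_add_inv : (q.toReal / r)⁻¹ + (q / r).conjExponent.toReal⁻¹ = 1 := by
    simpa using toReal_inv_add_toReal_inv (.conjExponent one_lt_div.le)
  rw [inv_div] at div_inv_add_inv
  rw [mul_inv, eq_sub_of_add_eq' div_inv_add_inv, eq_sub_of_add_eq'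
    (toReal_inv_add_toReal_inv hqq'), eq_sub_of_add_eq' r_conj.inv_add_inv_eq_one]
  field_simp
  ring

end Exponents

/-! ### From domination to the weighted bound -/

section Operator

variable {d n : ℕ} {𝒟 : Set (Set (Fin d → ℝ))} {p q' : ℝ≥0∞} [Fact (1 ≤ p)] [Fact (1 ≤ q')]
  {γ : ℝ} {C₁ : ℝ≥0} {B₁ B₂ : Type*} [NormedAddCommGroup B₁] [NormedSpace ℝ B₁]
  [NormedAddCommGroup B₂] [NormedSpace ℝ B₂]
  {F : Submodule ℝ ((Fin d → ℝ) →ₘ[volume] B₁)}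
  {G : Submodule ℝ ((Fin d → ℝ) →ₘ[volume] StrongDual ℝ B₂)}
  {T : F →ₗ[ℝ] ((Fin d → ℝ) →ₘ[volume] B₂)}
  {W : (Fin d → ℝ) → Matrix (Fin n) (Fin n) ℝ} {r : ℝ≥0}

theorem weightedNorm_eq_lintegral_rpow (hr : r ≠ 0) (f : Fin n → ((Fin d → ℝ) →ₘ[volume] B₁)) :
    weightedNorm W r f =
      (∫⁻ x, ‖matAct (matPow (W x) (1 / r)) fun i => f i x‖ₑ ^ (r : ℝ)) ^ (1 / (r : ℝ)) :=
  eLpNorm_eq_lintegral_rpow_enorm_toReal (ENNReal.coe_ne_zero.2 hr) ENNReal.coe_ne_top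

theorem ApConst_rpow_mul_RHConst_rpow_ne_top {r r' t s : ℝ} (hr : r.HolderConjugate r')
    (ht : 1 < t) (hs : 0 ≤ s) (hA : ApConst W t < ∞) (hR : RHConst W t s < ∞) :
    ApConst W t ^ (t.conjExponent / r + s / r') * RHConst W t s ^ (1 / r + s / r') ≠ ∞ := by
  have := hr.nonneg
  have := hr.symm.nonneg
  have := (Real.HolderConjugate.conjExponent ht).symm.nonneg
  exact ENNReal.mul_ne_top (ENNReal.rpow_ne_top_of_nonneg (by positivity) hA.ne)
    (ENNReal.rpow_ne_top_of_nonneg (by positivity) hR.ne)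

theorem stepPairingBound_of_convexBodyDomination (hT : ConvexBodyDomination 𝒟 n p q' γ C₁ F G T)
    (hG : stepFunctions 𝒟 (StrongDual ℝ B₂) ≤ G) (f : Fin n → F)
    {A : (Fin d → ℝ) → Matrix (Fin n) (Fin n) ℝ} {a : ℝ} {N : ℝ≥0∞}
    (hN : ∀ {g : Fin n → ((Fin d → ℝ) →ₘ[volume] StrongDual ℝ B₂)} {𝒬 : Set (Set (Fin d → ℝ))},
      𝒬 ⊆ 𝒟 → IsSparse γ 𝒬 →
      ∀ (hf : ∀ Q : 𝒬, ∀ i, MemLp (f i : _ →ₘ[volume] B₁) p (avgMeasure (Q : Set (Fin d → ℝ))))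
        (hg : ∀ Q : 𝒬, ∀ i, MemLp (g i) q' (avgMeasure (Q : Set (Fin d → ℝ)))),
        ∑' Q : 𝒬, volume (Q : Set (Fin d → ℝ)) * ENNReal.ofReal (bodyDot
          (localBody p (Q : Set (Fin d → ℝ)) (fun i => (f i : _ →ₘ[volume] B₁)) (hf Q))
          (localBody q' (Q : Set (Fin d → ℝ)) g (hg Q))) ≤
        N * (∫⁻ x, ‖matAct (A x) fun i => g i x‖ₑ ^ a) ^ (1 / a)) :
    StepPairingBound 𝒟 A a (fun i => T (f i)) (C₁ * N) where
  integrable i g hg := hT.integrable (f i) ⟨g, hG hg⟩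
  le g hg := by
    obtain ⟨𝒬, h𝒬, sparse, pairing_le⟩ := hT.domination f fun i => ⟨g i, hG (hg i)⟩
    refine pairing_le.trans ?_
    rw [mul_assoc]
    exact mul_le_mul_right (hN h𝒬 sparse _ _) _

theorem weightedNorm_le_of_stepPairingBound {t : ℝ} {u : Fin n → ((Fin d → ℝ) →ₘ[volume] B₂)}
    {N : ℝ≥0∞} (hd : 0 < d) (h𝒟 : IsDyadicLattice 𝒟) (hW : IsMatrixWeight W) (hr : 1 < r)
    (ht : 1 < t) (htr : t ≤ r) (hA : ApConst W t < ∞) (hN : N ≠ ∞)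
    (h : StepPairingBound 𝒟 (fun x => matPow (W x) (-(1 / r))) (r : ℝ).conjExponent u N) :
    weightedNorm W r u ≤ n * N := by
  have conj : (r : ℝ).HolderConjugate (r : ℝ).conjExponent := .conjExponent (by exact_mod_cast hr)
  rw [weightedNorm, ← ENNReal.ofReal_coe_nnreal]
  exact h.eLpNorm_matAct_le hd h𝒟 conj hN (aemeasurable_matPow_of_isMatrixWeight hW _)
    (fun Q hQ i j => memLp_matPow_neg_apply hW conj ht htr hA hQ i j)
    (aemeasurable_matPow_of_isMatrixWeight hW _)
    (hW.posDef.mono fun x hx => matPow_neg_mul_matPow hx _)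
    (.of_forall fun x i j => matPow_symm _ _ i j)

end Operator

end MatrixWeighted

open MatrixWeighted in
theorem mainTheorem2_general (d n : ℕ) (hd : 0 < d) (p q q' : ℝ≥0∞) (r : ℝ≥0)
    [Fact (1 ≤ p)] [Fact (1 ≤ q')] (hqq' : q.HolderConjugate q')
    (hpr : p < r) (hrq : r < q) (γ : ℝ) (hγ : 0 < γ)
    (t s : ℝ) (ht : t = r / p.toReal) (hs : s = (q / r).conjExponent.toReal) :
    ∃ C₂ : ℝ≥0,
      ∀ (B₁ B₂ : Type*) [NormedAddCommGroup B₁] [NormedSpace ℝ B₁]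
        [NormedAddCommGroup B₂] [NormedSpace ℝ B₂]
        (𝒟 : Set (Set (Fin d → ℝ))) (_ : IsDyadicLattice 𝒟)
        (F : Submodule ℝ ((Fin d → ℝ) →ₘ[volume] B₁))
        (G : Submodule ℝ ((Fin d → ℝ) →ₘ[volume] StrongDual ℝ B₂))
        (_ : stepFunctions 𝒟 (StrongDual ℝ B₂) ≤ G)
        (T : F →ₗ[ℝ] ((Fin d → ℝ) →ₘ[volume] B₂)) (C₁ : ℝ≥0)
        (_ : ConvexBodyDomination 𝒟 n p q' γ C₁ F G T)
        (W : (Fin d → ℝ) → Matrix (Fin n) (Fin n) ℝ) (_ : IsMatrixWeight W)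
        (_ : ApConst W t < ∞) (_ : RHConst W t s < ∞)
        (f : Fin n → F) (_ : MemWeightedLp W r fun i => (f i : _ →ₘ[volume] B₁)),
        MemWeightedLp W r (fun i => T (f i)) ∧
        weightedNorm W r (fun i => T (f i)) ≤
          C₁ * C₂ * ApConst W t ^ (t.conjExponent / r + s / (r : ℝ).conjExponent) *
            RHConst W t s ^ (1 / r + s / (r : ℝ).conjExponent) *
            weightedNorm W r (fun i => (f i : _ →ₘ[volume] B₁)) := by
  have one_le_p : 1 ≤ p.toReal := (ENNReal.dichotomy p).resolve_left hpr.ne_top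
  have one_lt_r : 1 < r := by exact_mod_cast (Fact.out : 1 ≤ p).trans_lt hpr
  have r_conj := Real.HolderConjugate.conjExponent (NNReal.coe_lt_coe.2 one_lt_r)
  have one_lt_t : 1 < t := ht ▸ one_lt_coe_div_toReal hpr
  have t_le_r : t ≤ r := ht ▸ div_le_self r.2 one_le_p
  have t_mul : t * p.toReal = r := ht ▸ div_mul_cancel₀ _ (one_pos.trans_le one_le_p).ne'
  have s_pos : 0 < s :=
    hs ▸ toReal_conjExponent_pos (one_lt_div_coe (one_pos.trans one_lt_r).ne' hrq)
  obtain ⟨C, tsum_le⟩ := exists_tsum_bodyDot_le hd n r_conj one_lt_t t_mul s_pos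
    (hs ▸ holderTriple_mul_toReal_conjExponent hqq' one_lt_r hrq) hγ
  refine ⟨n * C, fun B₁ B₂ _ _ _ _ 𝒟 h𝒟 F G hG T C₁ hT W hW hA hR f hf => ?_⟩
  set K : ℝ≥0∞ := ApConst W t ^ (t.conjExponent / r + s / (r : ℝ).conjExponent) *
    RHConst W t s ^ (1 / r + s / (r : ℝ).conjExponent)
  set N : ℝ≥0∞ := C * K * weightedNorm W r fun i => (f i : _ →ₘ[volume] B₁)
  have pairing_bound : StepPairingBound 𝒟 (fun x => matPow (W x) (-(1 / r)))
      (r : ℝ).conjExponent (fun i => T (f i)) (C₁ * N) :=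
    stepPairingBound_of_convexBodyDomination hT hG f fun h𝒬 sparse hf hg => by
      rw [mul_assoc, weightedNorm_eq_lintegral_rpow (one_pos.trans one_lt_r).ne']
      exact tsum_le h𝒟 hW hA hR h𝒬 sparse hf hg
  have bound_ne_top : C₁ * N ≠ ∞ := ENNReal.mul_ne_top ENNReal.coe_ne_top (ENNReal.mul_ne_top
    (ENNReal.mul_ne_top ENNReal.coe_ne_top
      (ApConst_rpow_mul_RHConst_rpow_ne_top r_conj one_lt_t s_pos.le hA hR)) hf.2.ne)
  have norm_le := weightedNorm_le_of_stepPairingBound hd h𝒟 hW one_lt_r one_lt_t t_le_r hA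
    bound_ne_top pairing_bound
  refine ⟨⟨aestronglyMeasurable_matAct hW _ fun i => (T (f i)).aestronglyMeasurable,
    norm_le.trans_lt (by finiteness)⟩, norm_le.trans_eq ?_⟩
  push_cast
  ring

end

theorem mainTheorem2 (d n : ℕ) (hd : 0 < d) (p q q' : ℝ≥0∞) (r : ℝ≥0)
    [Fact (1 ≤ p)] [Fact (1 ≤ q')] (hqq' : q.HolderConjugate q')
    (hpr : p < r) (hrq : r < q) (γ : ℝ) (hγ : 0 < γ)
    (t s : ℝ) (ht : t = r / p.toReal) (hs : s = (q / r).conjExponent.toReal) :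
    ∃ C₂ : ℝ≥0,
      ∀ (B₁ B₂ : Type*) [NormedAddCommGroup B₁] [NormedSpace ℝ B₁] [CompleteSpace B₁]
        [NormedAddCommGroup B₂] [NormedSpace ℝ B₂] [CompleteSpace B₂]
        (𝒟 : Set (Set (Fin d → ℝ))) (_ : ConvexBody.IsDyadicLattice 𝒟)
        (F : Submodule ℝ ((Fin d → ℝ) →ₘ[volume] B₁))
        (G : Submodule ℝ ((Fin d → ℝ) →ₘ[volume] StrongDual ℝ B₂))
        (_ : ConvexBody.stepFunctions 𝒟 (StrongDual ℝ B₂) ≤ G)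
        (T : F →ₗ[ℝ] ((Fin d → ℝ) →ₘ[volume] B₂)) (C₁ : ℝ≥0)
        (_ : ConvexBody.ConvexBodyDomination 𝒟 n p q' γ C₁ F G T)
        (W : (Fin d → ℝ) → Matrix (Fin n) (Fin n) ℝ) (_ : ConvexBody.IsMatrixWeight W)
        (_ : ConvexBody.ApConst W t < ∞) (_ : ConvexBody.RHConst W t s < ∞)
        (f : Fin n → F) (_ : ConvexBody.MemWeightedLp W r fun i => (f i : _ →ₘ[volume] B₁)),
        ConvexBody.MemWeightedLp W r (fun i => T (f i)) ∧
        ConvexBody.weightedNorm W r (fun i => T (f i)) ≤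
          C₁ * C₂ *
            ConvexBody.ApConst W t ^ (t.conjExponent / r + s / (r : ℝ).conjExponent) *
            ConvexBody.RHConst W t s ^ (1 / r + s / (r : ℝ).conjExponent) *
            ConvexBody.weightedNorm W r (fun i => (f i : _ →ₘ[volume] B₁)) :=
  (mainTheorem2_general d n hd p q q' r hqq' hpr hrq γ hγ t s ht hs).imp
    fun _ bound B₁ B₂ => by
      intro _ _ _ _ _ _
      exact bound B₁ B₂
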